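/- A vincular pattern of length $k$ is a pair $(\sigma,X)$ with $\sigma$ a permutation of $\{1,\dots,k\}$ and $X\subseteq\{1,\dots,k-1\}$. A permutation $\pi=\pi_1\cdots\pi_n$ contains $(\sigma,X)$ if there are indices $i_1<i_2<\dots<i_k$ such that $\pi_{i_1}\cdots\pi_{i_k}$ is order-isomorphic to $\sigma$ and $i_{j+1}=i_j+1$ for every $j\in X$; otherwise $\pi$ avoids it. The pattern $(\sigma,X)$ is written as the word $\sigma_1\cdots\sigma_k$ with a dash between $\sigma_j$ and $\sigma_{j+1}$ exactly when $j\notin X$; for instance $12\text{-}4\text{-}3=(1243,\{1\})$. Two vincular patterns are Wilf-equivalent, written $\sim$, if for every $n\ge 0$ the same number of permutations of length $n$ avoid the one as avoid the other. The following Wilf-equivalences hold: (a) $123\text{-}4\sim 321\text{-}4$; (b) $213\text{-}4\sim 231\text{-}4\sim 132\text{-}4\sim 312\text{-}4$; (c) $12\text{-}3\text{-}4\sim 12\text{-}4\text{-}3\sim 21\text{-}3\text{-}4\sim 21\text{-}4\text{-}3$; (d) $12\text{-}34\sim 12\text{-}43\sim 21\text{-}34\sim 21\text{-}43$; (e) $12\text{-}345\sim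 21\text{-}345\sim 12\text{-}543\sim 21\text{-}543$; (f) $12\text{-}435\sim 12\text{-}453\sim 12\text{-}534\sim 12\text{-}354\sim 21\text{-}435\sim 21\text{-}453\sim 21\text{-}534\sim 21\text{-}354$; (g) $123\text{-}4\text{-}5\sim 321\text{-}4\text{-}5$; (h) $213\text{-}4\text{-}5\sim 231\text{-}4\text{-}5\sim 132\text{-}4\text{-}5\sim 312\text{-}4\text{-}5$; (i) $12\text{-}3\text{-}4\text{-}5\sim 12\text{-}5\text{-}4\text{-}3\sim 12\text{-}3\text{-}5\text{-}4\sim 21\text{-}3\text{-}4\text{-}5\sim 21\text{-}5\text{-}4\text{-}3\sim 21\text{-}3\text{-}5\text{-}4$; (j) $12\text{-}4\text{-}3\text{-}5\sim 21\text{-}4\text{-}3\text{-}5$; (k) $12\text{-}5\text{-}3\text{-}4\sim 12\text{-}4\text{-}5\text{-}3\sim 21\text{-}5\text{-}3\text{-}4\sim 21\text{-}4\text{-}5\text{-}3$. -/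

import Mathlib

/-- A vincular pattern `(σ, X)`: a permutation `σ` of length `k` (values and positions are
indexed by `Fin k`, that is, from `0`) and a set of adjacencies `X ⊆ {1, …, k - 1}`, where
`j ∈ X` means that the `j`-th and `(j+1)`-st letters (counted from `1`) of a copy have to be
adjacent. -/
structure VincularPattern where
  k : ℕ
  σ : Equiv.Perm (Fin k)
  X : Finset ℕ
  X_subset : X ⊆ Finset.Icc 1 (k - 1)

namespace VincularPattern

/-- The positions given by the strictly increasing map `f` form a copy of `p` in the permutation
`π`: the letters there are order-isomorphic to `p.σ`, and for each `j ∈ X` the positions of the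
`j`-th and the `(j+1)`-st letter (counted from `1`) are consecutive. -/
def IsCopy (p : VincularPattern) {n : ℕ} (π : Equiv.Perm (Fin n)) (f : Fin p.k → Fin n) : Prop :=
  StrictMono f ∧
  (∀ a b : Fin p.k, π (f a) ≤ π (f b) ↔ p.σ a ≤ p.σ b) ∧
  (∀ a b : Fin p.k, (a : ℕ) + 1 = (b : ℕ) → (b : ℕ) ∈ p.X → (f b : ℕ) = (f a : ℕ) + 1)

/-- The permutation `π` contains the vincular pattern `p`. -/
def Contains {n : ℕ} (π : Equiv.Perm (Fin n)) (p : VincularPattern) : Prop :=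
  ∃ f : Fin p.k → Fin n, p.IsCopy π f

/-- The permutation `π` avoids the vincular pattern `p`. -/
def Avoids {n : ℕ} (π : Equiv.Perm (Fin n)) (p : VincularPattern) : Prop :=
  ¬ Contains π p

/-- The number of permutations of length `n` avoiding `p`. -/
noncomputable def avoidCount (n : ℕ) (p : VincularPattern) : ℕ :=
  Nat.card {π : Equiv.Perm (Fin n) // Avoids π p}

/-- Wilf-equivalence of vincular patterns. -/
def WilfEquiv (p q : VincularPattern) : Prop :=
  ∀ n : ℕ, avoidCount n p = avoidCount n q

/-- The word `w` is a permutation of `{1, …, w.length}` in one-line notation. -/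
def IsPermWord (w : List ℕ) : Prop :=
  (∀ a ∈ w, 1 ≤ a ∧ a ≤ w.length) ∧ w.Nodup

instance (w : List ℕ) : Decidable (IsPermWord w) :=
  inferInstanceAs (Decidable (_ ∧ _))

/-- The map `i ↦ wᵢ`, shifted so that both positions and values start at `0`. -/
def wordFun (w : List ℕ) (h : IsPermWord w) (i : Fin w.length) : Fin w.length :=
  ⟨w[i] - 1, by
    have h1 := h.1 w[i] (List.getElem_mem _)
    omega⟩

theorem wordFun_bijective (w : List ℕ) (h : IsPermWord w) :
    Function.Bijective (wordFun w h) := by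
  refine Finite.injective_iff_bijective.mp fun i j hij => ?_
  have hi := h.1 w[i] (List.getElem_mem _)
  have hj := h.1 w[j] (List.getElem_mem _)
  have e : w[i] - 1 = w[j] - 1 := congrArg Fin.val hij
  have e' : w[(i : ℕ)] = w[(j : ℕ)] := by
    simp only [Fin.getElem_fin] at hi hj e
    omega
  exact Fin.ext ((List.Nodup.getElem_inj_iff h.2).mp e')

/-- The vincular pattern in dashed notation, given by the list of its blocks between the dashes:
`dashed [[1, 2], [4], [3]]` is `12-4-3`. Its permutation is the concatenation of the blocks in
one-line notation, and `j ∈ X` unless there is a dash right after the `j`-th letter, that is,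
unless the first few blocks have exactly `j` letters together. -/
noncomputable def dashed (bs : List (List ℕ)) (h : IsPermWord bs.flatten := by decide) :
    VincularPattern where
  k := bs.flatten.length
  σ := Equiv.ofBijective (wordFun bs.flatten h) (wordFun_bijective bs.flatten h)
  X := (Finset.Icc 1 (bs.flatten.length - 1)).filter
    fun j => ∀ p ∈ bs.inits, p.flatten.length ≠ j
  X_subset := Finset.filter_subset _ _

end VincularPattern

/-!
The patterns in question are direct sums `τ ⊕ σ`: a copy of `τ` followed by a copy of `σ` all of
whose letters are larger. The proof replaces one of the summands.

Fix `τ` and call a point `(x, v)` of the diagram of a permutation `π` dominated if a copy of `τ`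
lies strictly to the left of and below it. A copy of `τ ⊕ σ` is a copy of `σ` whose bounding
rectangle is dominated (`contains_directSum_iff_dominates`). The dominated region is already
generated by the undominated letters, so rearranging the dominated letters inside the region does
not change it (`SameFrame.dominates_iff`), and it suffices to count the avoiders in each class of
permutations with the same undominated letters (`wilfEquiv_directSum_of_frames`).

*Consecutive summands* (`wilfEquiv_directSum_of_isConsecutive`). Along a run of dominated positions
the region has constant height, so the letters of a run may be permuted freely. If `σ` is
consecutive, its copies live inside runs, and each run avoids `σ` in the fraction
`avoidCount m σ / m!` of the cases. Hence Wilf-equivalent consecutive patterns `σ`, `σ'` give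
Wilf-equivalent `τ ⊕ σ`, `τ ⊕ σ'`. Reversal and complementation provide the equivalences
`12 ~ 21`, `123 ~ 321` and `213 ~ 231 ~ 132 ~ 312` of consecutive patterns, and they also exchange
the roles of the two summands (`wilfEquiv_directSum_left_of_isConsecutive`).

*Summands without adjacencies* (`wilfEquiv_directSum_of_shapeWilfEquiv`). Deleting the undominated
letters turns each class into the placements on a board, so shape-Wilf-equivalent patterns may be
exchanged. What is needed is `12 ~ 21`, `321 ~ 123 ~ 132` and `312 ~ 231` on boards. A placement is
read along the boundary of the board: a step to the left adds a letter in front of the current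
word, a step up deletes the least letter, and the words met on the way have to avoid the pattern
(`boardCount_eq_pathCount`). For each pattern the possible next letters are governed by a small
state of the word.

* For `12` and `21` there is exactly one possible next letter.
* For `123` and `132` the state is a threshold, with the same rule for both (`pathCount_123`,
  `pathCount_132`).
* For `321` the state is a list of flags. Standard Young tableaux with two rows have both flags
  (their descents) and a threshold; a step to the left amounts to row insertion on the flags, and
  summed over all tableaux of a given shape the flags and the thresholds have the same growth
  (`stackRun_steps321_eq_thresholdCount`).
* For `312` the state is a list of flags, too. On nonempty lists every balanced piece of the path
  acts as a sum of powers of one operator, which changes a flag of the first block. Such pieces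
  therefore commute and the path may be walked backwards (`stackRun_steps312_transposePath`). As
  `231` is the inverse of `312`, and inversion transposes the board, this gives `312 ~ 231`.
-/

namespace VincularPattern

/-! ### Reversal, complement and direct sum of vincular patterns -/

/-- A pattern is determined by its word and its set of adjacencies. -/
theorem eq_of_ofFn_eq {p q : VincularPattern}
    (h : List.ofFn (fun i => (p.σ i : ℕ)) = List.ofFn (fun i => (q.σ i : ℕ)))
    (hX : p.X = q.X) : p = q := by
  obtain ⟨k, σ, X, hXk⟩ := p
  obtain ⟨k', σ', X', hXk'⟩ := q
  have hk : k = k' := by simpa using congrArg List.length h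
  subst hk
  have hσ : σ = σ' := by
    refine Equiv.ext fun i => Fin.ext ?_
    exact congrFun (List.ofFn_injective h) i
  subst hσ
  cases hX
  rfl

/-- The reversed pattern. -/
abbrev reverse (p : VincularPattern) : VincularPattern where
  k := p.k
  σ := Fin.revPerm.trans p.σ
  X := p.X.image (p.k - ·)
  X_subset := by
    intro x hx
    obtain ⟨y, hy, rfl⟩ := Finset.mem_image.mp hx
    have := Finset.mem_Icc.mp (p.X_subset hy)
    exact Finset.mem_Icc.mpr (by omega)

/-- The complemented pattern. -/
abbrev complement (p : VincularPattern) : VincularPattern where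
  k := p.k
  σ := p.σ.trans Fin.revPerm
  X := p.X
  X_subset := p.X_subset

theorem reverse_reverse (p : VincularPattern) : p.reverse.reverse = p := by
  refine eq_of_ofFn_eq ?_ ?_
  · simp [reverse]
  · ext x
    simp only [Finset.mem_image]
    constructor
    · rintro ⟨_, ⟨y, hy, rfl⟩, rfl⟩
      have := Finset.mem_Icc.mp (p.X_subset hy)
      rwa [show p.k - (p.k - y) = y by omega]
    · intro hx
      have := Finset.mem_Icc.mp (p.X_subset hx)
      exact ⟨p.k - x, ⟨x, hx, rfl⟩, by omega⟩

theorem complement_complement (p : VincularPattern) : p.complement.complement = p := by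
  refine eq_of_ofFn_eq ?_ rfl
  simp [complement]

theorem Contains.reverse {n : ℕ} {π : Equiv.Perm (Fin n)} {p : VincularPattern}
    (h : Contains π p) : Contains (Fin.revPerm.trans π) p.reverse := by
  obtain ⟨f, hf, ho, ha⟩ := h
  refine ⟨fun i : Fin p.k => (f i.rev).rev, ?_, ?_, ?_⟩
  · intro a b hab
    exact Fin.rev_lt_rev.mpr (hf (Fin.rev_lt_rev.mpr hab))
  · intro a b
    simpa [VincularPattern.reverse] using ho (Fin.rev (a : Fin p.k)) (Fin.rev (b : Fin p.k))
  · intro a b hab hb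
    obtain ⟨y, hy, hyb⟩ := Finset.mem_image.mp hb
    have hy' := Finset.mem_Icc.mp (p.X_subset hy)
    have hbk : (b : ℕ) < p.k := b.2
    have key := ha (Fin.rev (b : Fin p.k)) (Fin.rev (a : Fin p.k))
      (by simp only [Fin.val_rev]; dsimp only at hyb; omega)
      (by
        have : ((Fin.rev (a : Fin p.k) : Fin p.k) : ℕ) = y := by
          rw [Fin.val_rev]; dsimp only at hyb; omega
        rw [this]; exact hy)
    have h1 := (f (Fin.rev (a : Fin p.k))).2
    have h2 := (f (Fin.rev (b : Fin p.k))).2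
    simp only [Fin.val_rev]
    omega

theorem Contains.complement {n : ℕ} {π : Equiv.Perm (Fin n)} {p : VincularPattern}
    (h : Contains π p) : Contains (π.trans Fin.revPerm) p.complement := by
  obtain ⟨f, hf, ho, ha⟩ := h
  refine ⟨f, hf, ?_, ha⟩
  intro a b
  simpa [VincularPattern.complement] using ho b a

theorem avoidCount_congr {n : ℕ} {p q : VincularPattern}
    (e : Equiv.Perm (Fin n) ≃ Equiv.Perm (Fin n))
    (h : ∀ π, Contains π p ↔ Contains (e π) q) : avoidCount n p = avoidCount n q :=
  Nat.card_congr (e.subtypeEquiv fun π => not_congr (h π))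

theorem avoidCount_reverse (n : ℕ) (p : VincularPattern) :
    avoidCount n p.reverse = avoidCount n p := by
  refine (avoidCount_congr (Equiv.mulRight Fin.revPerm) fun π => ⟨fun h => h.reverse, ?_⟩).symm
  intro h
  have h' := Contains.reverse h
  rw [reverse_reverse] at h'
  convert h'
  ext i
  simp

theorem avoidCount_complement (n : ℕ) (p : VincularPattern) :
    avoidCount n p.complement = avoidCount n p := by
  refine (avoidCount_congr (Equiv.mulLeft Fin.revPerm) fun π => ⟨fun h => h.complement, ?_⟩).symm
  intro h
  have h' := Contains.complement h
  rw [complement_complement] at h'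
  convert h'
  ext i
  simp

theorem WilfEquiv.symm {p q : VincularPattern} (h : WilfEquiv p q) : WilfEquiv q p :=
  fun n => (h n).symm

theorem WilfEquiv.trans {p q r : VincularPattern} (h : WilfEquiv p q) (h' : WilfEquiv q r) :
    WilfEquiv p r :=
  fun n => (h n).trans (h' n)

theorem wilfEquiv_reverse (p : VincularPattern) : WilfEquiv p.reverse p :=
  fun n => avoidCount_reverse n p

theorem wilfEquiv_complement (p : VincularPattern) : WilfEquiv p.complement p :=
  fun n => avoidCount_complement n p

/-- The direct sum `p ⊕ q`: a copy of `p` followed, with a dash in between, by a copy of `q` all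
of whose letters are larger. -/
abbrev directSum (p q : VincularPattern) : VincularPattern where
  k := p.k + q.k
  σ := finSumFinEquiv.symm.trans ((Equiv.sumCongr p.σ q.σ).trans finSumFinEquiv)
  X := p.X ∪ q.X.image (· + p.k)
  X_subset := by
    intro x hx
    rcases Finset.mem_union.mp hx with h | h
    · have := Finset.mem_Icc.mp (p.X_subset h)
      exact Finset.mem_Icc.mpr (by omega)
    · obtain ⟨y, hy, rfl⟩ := Finset.mem_image.mp h
      have := Finset.mem_Icc.mp (q.X_subset hy)
      exact Finset.mem_Icc.mpr (by omega)

theorem directSum_σ_castAdd (p q : VincularPattern) (i : Fin p.k) :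
    (directSum p q).σ (Fin.castAdd q.k i) = Fin.castAdd q.k (p.σ i) := by
  simp [directSum]

theorem directSum_σ_natAdd (p q : VincularPattern) (i : Fin q.k) :
    (directSum p q).σ (Fin.natAdd p.k i) = Fin.natAdd p.k (q.σ i) := by
  simp [directSum]

theorem _root_.Fin.castAdd_lt_natAdd {m n : ℕ} (i : Fin m) (j : Fin n) :
    Fin.castAdd n i < Fin.natAdd m j := by
  show (i : ℕ) < m + j
  omega

theorem contains_directSum_iff {n : ℕ} {π : Equiv.Perm (Fin n)} {p q : VincularPattern} :
    Contains π (directSum p q) ↔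
      ∃ f g, p.IsCopy π f ∧ q.IsCopy π g ∧ ∀ i j, f i < g j ∧ π (f i) < π (g j) := by
  constructor
  · rintro ⟨F, hF, ho, ha⟩
    refine ⟨fun i => F (Fin.castAdd q.k i), fun j => F (Fin.natAdd p.k j), ⟨?_, ?_, ?_⟩,
      ⟨?_, ?_, ?_⟩, ?_⟩
    · intro a b hab
      exact hF (Fin.strictMono_castAdd q.k hab)
    · intro a b
      rw [ho, directSum_σ_castAdd, directSum_σ_castAdd]
      exact (Fin.strictMono_castAdd q.k).le_iff_le
    · intro a b hab hb
      exact ha _ _ (by simpa using hab) (Finset.mem_union_left _ (by simpa using hb))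
    · intro a b hab
      exact hF (Fin.strictMono_natAdd p.k hab)
    · intro a b
      rw [ho, directSum_σ_natAdd, directSum_σ_natAdd]
      exact (Fin.strictMono_natAdd p.k).le_iff_le
    · intro a b hab hb
      refine ha _ _ (by simp; omega) (Finset.mem_union_right _ (Finset.mem_image.mpr ⟨b, hb, ?_⟩))
      simp [add_comm]
    · intro i j
      refine ⟨hF (Fin.castAdd_lt_natAdd i j), ?_⟩
      rw [← not_le, ho, directSum_σ_castAdd, directSum_σ_natAdd]
      exact not_le.mpr (Fin.castAdd_lt_natAdd _ _)
  · rintro ⟨f, g, ⟨hf, hfo, hfa⟩, ⟨hg, hgo, hga⟩, hfg⟩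
    have hcases : ∀ a : Fin (directSum p q).k, (∃ i : Fin p.k, a = Fin.castAdd q.k i) ∨
        ∃ j : Fin q.k, a = Fin.natAdd p.k j := fun a =>
      Fin.addCases (motive := fun a => (∃ i : Fin p.k, a = Fin.castAdd q.k i) ∨
        ∃ j : Fin q.k, a = Fin.natAdd p.k j) (fun i => Or.inl ⟨i, rfl⟩)
        (fun j => Or.inr ⟨j, rfl⟩) a
    have hl : ∀ i, Fin.append f g (Fin.castAdd q.k i) = f i := Fin.append_left f g
    have hr : ∀ j, Fin.append f g (Fin.natAdd p.k j) = g j := Fin.append_right f g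
    refine ⟨Fin.append f g, ?_, ?_, ?_⟩
    · intro a b hab
      rcases hcases a with ⟨i, rfl⟩ | ⟨i, rfl⟩ <;> rcases hcases b with ⟨j, rfl⟩ | ⟨j, rfl⟩
      · rw [hl, hl]; exact hf ((Fin.strictMono_castAdd q.k).lt_iff_lt.mp hab)
      · rw [hl, hr]; exact (hfg _ _).1
      · exact absurd hab (Fin.castAdd_lt_natAdd _ _).asymm
      · rw [hr, hr]; exact hg ((Fin.strictMono_natAdd p.k).lt_iff_lt.mp hab)
    · intro a b
      rcases hcases a with ⟨i, rfl⟩ | ⟨i, rfl⟩ <;> rcases hcases b with ⟨j, rfl⟩ | ⟨j, rfl⟩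
      · rw [hl, hl, directSum_σ_castAdd, directSum_σ_castAdd, hfo]
        exact (Fin.strictMono_castAdd q.k).le_iff_le.symm
      · rw [hl, hr, directSum_σ_castAdd, directSum_σ_natAdd]
        exact iff_of_true (hfg _ _).2.le (Fin.castAdd_lt_natAdd _ _).le
      · rw [hl, hr, directSum_σ_castAdd, directSum_σ_natAdd]
        exact iff_of_false (not_le.mpr (hfg _ _).2) (not_le.mpr (Fin.castAdd_lt_natAdd _ _))
      · rw [hr, hr, directSum_σ_natAdd, directSum_σ_natAdd, hgo]
        exact (Fin.strictMono_natAdd p.k).le_iff_le.symm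
    · intro a b hab hb
      rcases Finset.mem_union.mp hb with hb | hb
      · have hb' := Finset.mem_Icc.mp (p.X_subset hb)
        rcases hcases a with ⟨i, rfl⟩ | ⟨i, rfl⟩ <;> rcases hcases b with ⟨j, rfl⟩ | ⟨j, rfl⟩ <;>
          simp only [Fin.val_natAdd, Fin.val_castAdd] at hab hb hb' <;> try omega
        rw [hl, hl]; exact hfa _ _ hab hb
      · obtain ⟨y, hy, hyb⟩ := Finset.mem_image.mp hb
        have hy' := Finset.mem_Icc.mp (q.X_subset hy)
        rcases hcases a with ⟨i, rfl⟩ | ⟨i, rfl⟩ <;> rcases hcases b with ⟨j, rfl⟩ | ⟨j, rfl⟩ <;>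
          simp only [Fin.val_natAdd, Fin.val_castAdd] at hab hyb <;> try omega
        rw [hr, hr]
        exact hga _ _ (by omega) (by rwa [show (j : ℕ) = y by omega])

end VincularPattern

/-! ### Counting along the classes of an equivalence relation -/

theorem Nat.card_subtype_eq_of_classes {α : Type*} [Finite α] (r : Setoid α) {A A' : α → Prop}
    (h : ∀ x₀, Nat.card {x // r x₀ x ∧ A x} = Nat.card {x // r x₀ x ∧ A' x}) :
    Nat.card {x // A x} = Nat.card {x // A' x} := by
  have key : ∀ B : α → Prop, Nat.card {x // B x} =
      ∑ᶠ q : Quotient r, Nat.card {x // q = Quotient.mk r x ∧ B x} := by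
    intro B
    have := Fintype.ofFinite (Quotient r)
    rw [finsum_eq_sum_of_fintype, ← Nat.card_sigma]
    exact Nat.card_congr
      { toFun := fun x => ⟨Quotient.mk r x.1, x.1, rfl, x.2⟩
        invFun := fun y => ⟨y.2.1, y.2.2.2⟩
        left_inv := fun x => rfl
        right_inv := by rintro ⟨_, x, rfl, hx⟩; rfl }
  rw [key, key]
  refine finsum_congr fun q => ?_
  induction q using Quotient.inductionOn with
  | h x₀ => simpa only [Quotient.eq] using h x₀

namespace VincularPattern

/-! ### The region dominated by a pattern -/

variable {n : ℕ}

/-- The point `(x, v)` is dominated by `τ` in `π` if some copy of `τ` lies strictly to the left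
of and strictly below it. -/
def Dominates (τ : VincularPattern) (π : Equiv.Perm (Fin n)) (x v : Fin n) : Prop :=
  ∃ f, τ.IsCopy π f ∧ ∀ i, f i < x ∧ π (f i) < v

theorem Dominates.mono {τ : VincularPattern} {π : Equiv.Perm (Fin n)} {x v x' v' : Fin n}
    (h : τ.Dominates π x v) (hx : x ≤ x') (hv : v ≤ v') : τ.Dominates π x' v' := by
  obtain ⟨f, hf, hb⟩ := h
  exact ⟨f, hf, fun i => ⟨(hb i).1.trans_le hx, (hb i).2.trans_le hv⟩⟩

theorem IsCopy.congr {p : VincularPattern} {π π' : Equiv.Perm (Fin n)} {f : Fin p.k → Fin n}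
    (h : p.IsCopy π f) (hπ : ∀ i, π' (f i) = π (f i)) : p.IsCopy π' f :=
  ⟨h.1, fun a b => by rw [hπ, hπ]; exact h.2.1 a b, h.2.2⟩

/-- The dominated region is generated by the copies of the pattern made of letters that are not
dominated themselves: a copy with a dominated letter can be replaced by one further left. -/
theorem Dominates.exists_undominated {τ : VincularPattern} {π : Equiv.Perm (Fin n)} {x v : Fin n}
    (h : τ.Dominates π x v) :
    ∃ f, τ.IsCopy π f ∧ (∀ i, f i < x ∧ π (f i) < v) ∧
      ∀ i, ¬ τ.Dominates π (f i) (π (f i)) := by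
  induction x using WellFoundedLT.induction generalizing v with
  | ind x ih =>
    obtain ⟨f, hf, hb⟩ := h
    by_cases hd : ∃ i, τ.Dominates π (f i) (π (f i))
    · obtain ⟨i, hi⟩ := hd
      obtain ⟨g, hg, hgb, hgu⟩ := ih (f i) (hb i).1 hi
      exact ⟨g, hg, fun j => ⟨(hgb j).1.trans (hb i).1, (hgb j).2.trans (hb i).2⟩, hgu⟩
    · exact ⟨f, hf, hb, not_exists.mp hd⟩

/-- `π` arises from `π₀` by rearranging the letters dominated by `τ` inside the dominated
region. -/
def SameFrame (τ : VincularPattern) (π₀ π : Equiv.Perm (Fin n)) : Prop :=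
  ∀ c, (τ.Dominates π₀ c (π₀ c) → τ.Dominates π₀ c (π c)) ∧
    (¬ τ.Dominates π₀ c (π₀ c) → π c = π₀ c)

theorem SameFrame.dominates_iff {τ : VincularPattern} {π₀ π : Equiv.Perm (Fin n)}
    (h : τ.SameFrame π₀ π) (x v : Fin n) : τ.Dominates π x v ↔ τ.Dominates π₀ x v := by
  constructor
  · rintro ⟨f, hf, hb⟩
    by_cases hd : ∃ i, τ.Dominates π₀ (f i) (π₀ (f i))
    · obtain ⟨i, hi⟩ := hd
      exact ((h (f i)).1 hi).mono (hb i).1.le (hb i).2.le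
    · have hu := fun i => (h (f i)).2 (not_exists.mp hd i)
      exact ⟨f, hf.congr fun i => (hu i).symm, fun i => ⟨(hb i).1, hu i ▸ (hb i).2⟩⟩
  · intro hd
    obtain ⟨f, hf, hb, hu⟩ := hd.exists_undominated
    have hu := fun i => (h (f i)).2 (hu i)
    exact ⟨f, hf.congr hu, fun i => ⟨(hb i).1, (hu i).symm ▸ (hb i).2⟩⟩

theorem SameFrame.dominates_self_iff {τ : VincularPattern} {π₀ π : Equiv.Perm (Fin n)}
    (h : τ.SameFrame π₀ π) (c : Fin n) :
    τ.Dominates π c (π c) ↔ τ.Dominates π₀ c (π₀ c) := by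
  rw [h.dominates_iff]
  by_cases hc : τ.Dominates π₀ c (π₀ c)
  · exact iff_of_true ((h c).1 hc) hc
  · rw [(h c).2 hc]

/-- The relation `SameFrame` as a setoid. -/
def frameSetoid (τ : VincularPattern) (n : ℕ) : Setoid (Equiv.Perm (Fin n)) where
  r := τ.SameFrame
  iseqv :=
    { refl := fun _ _ => ⟨id, fun _ => rfl⟩
      symm := fun {π₀ π} h c => by
        rw [h.dominates_self_iff, h.dominates_iff]
        exact ⟨id, fun hc => ((h c).2 hc).symm⟩
      trans := fun {π₀ π π'} h h' c => by
        have h1 := h' c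
        rw [h.dominates_self_iff, h.dominates_iff] at h1
        exact ⟨h1.1, fun hc => (h1.2 hc).trans ((h c).2 hc)⟩ }

/-- A copy of `τ ⊕ σ` is a copy of `σ` inside the region dominated by `τ`. For a nonempty `σ` it
is the lower left corner of the copy of `σ` that has to be dominated. -/
theorem contains_directSum_iff_dominates {π : Equiv.Perm (Fin n)} {τ σ : VincularPattern}
    (hσ : 0 < σ.k) :
    Contains π (directSum τ σ) ↔
      ∃ g, σ.IsCopy π g ∧ ∀ j j', τ.Dominates π (g j) (π (g j')) := by
  rw [contains_directSum_iff]
  constructor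
  · rintro ⟨f, g, hf, hg, hfg⟩
    exact ⟨g, hg, fun j j' => ⟨f, hf, fun i => ⟨(hfg i j).1, (hfg i j').2⟩⟩⟩
  · rintro ⟨g, hg, hd⟩
    have : NeZero σ.k := ⟨hσ.ne'⟩
    obtain ⟨f, hf, hb⟩ := hd 0 (σ.σ.symm 0)
    refine ⟨f, g, hf, hg, fun i j => ⟨(hb i).1.trans_le (hg.1.monotone (Fin.zero_le j)), ?_⟩⟩
    refine (hb i).2.trans_le ((hg.2.1 _ _).mpr ?_)
    rw [Equiv.apply_symm_apply]
    exact Fin.zero_le _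

/-- It suffices to compare the numbers of permutations avoiding `τ ⊕ σ` and `τ ⊕ σ'` among those
with the same letters outside of the region dominated by `τ`. -/
theorem wilfEquiv_directSum_of_frames {τ σ σ' : VincularPattern} (hσ : 0 < σ.k) (hσ' : 0 < σ'.k)
    (h : ∀ (n : ℕ) (π₀ : Equiv.Perm (Fin n)),
      Nat.card {π // τ.SameFrame π₀ π ∧
        ¬ ∃ g, σ.IsCopy π g ∧ ∀ j j', τ.Dominates π₀ (g j) (π (g j'))} =
      Nat.card {π // τ.SameFrame π₀ π ∧
        ¬ ∃ g, σ'.IsCopy π g ∧ ∀ j j', τ.Dominates π₀ (g j) (π (g j'))}) :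
    WilfEquiv (directSum τ σ) (directSum τ σ') := by
  intro n
  refine Nat.card_subtype_eq_of_classes (τ.frameSetoid n) fun π₀ => ?_
  convert h n π₀ using 1
  · refine Nat.card_congr (Equiv.subtypeEquivRight fun π => and_congr_right fun hπ => ?_)
    rw [Avoids, contains_directSum_iff_dominates hσ]
    simp only [SameFrame.dominates_iff hπ]
  · refine Nat.card_congr (Equiv.subtypeEquivRight fun π => and_congr_right fun hπ => ?_)
    rw [Avoids, contains_directSum_iff_dominates hσ']
    simp only [SameFrame.dominates_iff hπ]

end VincularPattern

namespace VincularPattern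

/-! ### Consecutive patterns above a fixed pattern -/

variable {n : ℕ}

/-- The relative order of finitely many distinct values is that of a permutation. -/
theorem exists_standardization {α : Type*} [LinearOrder α] {m : ℕ} {f : Fin m → α}
    (hf : Function.Injective f) : ∃ s : Equiv.Perm (Fin m), ∀ i j, s i ≤ s j ↔ f i ≤ f j := by
  classical
  have hc : (Finset.univ.image f).card = m := by
    rw [Finset.card_image_of_injective _ hf, Finset.card_univ, Fintype.card_fin]
  let e := (Finset.univ.image f).orderIsoOfFin hc
  let s : Fin m → Fin m := fun i => e.symm ⟨f i, Finset.mem_image_of_mem _ (Finset.mem_univ i)⟩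
  have hs : ∀ i j, s i ≤ s j ↔ f i ≤ f j := fun i j => by
    simp only [s, OrderIso.le_iff_le, Subtype.mk_le_mk]
  have hinj : Function.Injective s := fun i j hij =>
    hf (le_antisymm ((hs i j).mp hij.le) ((hs j i).mp hij.ge))
  exact ⟨Equiv.ofBijective s (Finite.injective_iff_bijective.mp hinj), hs⟩

/-- Averaging over the rearrangements of the letters in the block of positions
`a, …, a + m - 1`: if `Q` does not notice such rearrangements, then the permutations with
property `Q` whose block avoids `σ` make up the fraction `avoidCount m σ / m!`. -/
theorem factorial_mul_card_block_avoids {m a : ℕ} (ham : a + m ≤ n) (σ : VincularPattern)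
    (Q : Equiv.Perm (Fin n) → Prop)
    (hQ : ∀ h : Equiv.Perm (Fin n), (∀ c : Fin n, ¬ (a ≤ (c : ℕ) ∧ (c : ℕ) < a + m) → h c = c) →
      ∀ π, Q π → Q (π * h)) :
    m.factorial * Nat.card {π // Q π ∧
      ¬ ∃ g, σ.IsCopy π g ∧ ∀ j, a ≤ (g j : ℕ) ∧ (g j : ℕ) < a + m} =
    Nat.card {π // Q π} * avoidCount m σ := by
  classical
  set B : Equiv.Perm (Fin n) → Prop := fun π =>
    ¬ ∃ g, σ.IsCopy π g ∧ ∀ j, a ≤ (g j : ℕ) ∧ (g j : ℕ) < a + m with hB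
  let e : Fin m ↪ Fin n :=
    ⟨fun i => ⟨a + i, by omega⟩, fun i j hij => by simpa [Fin.ext_iff] using hij⟩
  have he : ∀ i, (e i : ℕ) = a + i := fun i => rfl
  let ext : Equiv.Perm (Fin m) → Equiv.Perm (Fin n) := fun g => g.viaFintypeEmbedding e
  have hext : ∀ g i, ext g (e i) = e (g i) := fun g i =>
    Equiv.Perm.viaFintypeEmbedding_apply_image g e i
  have hfix : ∀ g (c : Fin n), ¬ (a ≤ (c : ℕ) ∧ (c : ℕ) < a + m) → ext g c = c := by
    intro g c hc
    refine Equiv.Perm.viaFintypeEmbedding_apply_notMem_range g e ?_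
    rintro ⟨i, rfl⟩
    exact hc (by rw [he]; omega)
  have hfix' : ∀ g (c : Fin n), ¬ (a ≤ (c : ℕ) ∧ (c : ℕ) < a + m) → (ext g)⁻¹ c = c := fun g c hc =>
    Equiv.Perm.inv_eq_iff_eq.mpr (hfix g c hc).symm
  -- If `s` is the relative order of the block of `π`, then that of `π * ext g` is `s * g`.
  have hcount : ∀ π : Equiv.Perm (Fin n),
      Nat.card {g : Equiv.Perm (Fin m) // B (π * ext g)} = avoidCount m σ := by
    intro π
    obtain ⟨s, hs⟩ := exists_standardization (f := fun i => π (e i))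
      (fun i j hij => e.injective (π.injective hij))
    refine Nat.card_congr ((Equiv.mulLeft s).subtypeEquiv fun g => not_congr ?_)
    constructor
    · rintro ⟨f, hf, hb⟩
      have hlt : ∀ j, (f j : ℕ) - a < m := fun j => by have := hb j; omega
      have hef : ∀ j, e ⟨(f j : ℕ) - a, hlt j⟩ = f j := fun j => by
        apply Fin.ext
        have := hb j
        rw [he]
        simp only
        omega
      refine ⟨fun j => ⟨(f j : ℕ) - a, hlt j⟩, ?_, ?_, ?_⟩
      · intro i j hij
        have h1 : (f i : ℕ) < f j := hf.1 hij
        have := hb i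
        show (f i : ℕ) - a < (f j : ℕ) - a
        omega
      · intro i j
        rw [← hf.2.1 i j]
        simp only [Equiv.coe_mulLeft, Equiv.Perm.mul_apply, hs, ← hext, hef]
      · intro i j hij hj
        have h1 := hf.2.2 i j hij hj
        have := hb i
        show (f j : ℕ) - a = (f i : ℕ) - a + 1
        omega
    · rintro ⟨f, hf⟩
      refine ⟨fun j => e (f j), ⟨?_, ?_, ?_⟩, fun j => by rw [he]; omega⟩
      · intro i j hij
        have h1 : (f i : ℕ) < f j := hf.1 hij
        show a + (f i : ℕ) < a + (f j : ℕ)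
        omega
      · intro i j
        rw [← hf.2.1 i j]
        simp only [Equiv.coe_mulLeft, Equiv.Perm.mul_apply, hs, hext]
      · intro i j hij hj
        have h1 := hf.2.2 i j hij hj
        show a + (f j : ℕ) = a + (f i : ℕ) + 1
        omega
  have hswap : Nat.card ({π // Q π ∧ B π} × Equiv.Perm (Fin m)) =
      Nat.card (Σ π : {π // Q π}, {g : Equiv.Perm (Fin m) // B (π.1 * ext g)}) := by
    refine Nat.card_congr
      { toFun := fun x => ⟨⟨x.1.1 * (ext x.2)⁻¹, hQ _ (hfix' x.2) _ x.1.2.1⟩, ⟨x.2, ?_⟩⟩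
        invFun := fun y => ⟨⟨y.1.1 * ext y.2.1, hQ _ (hfix y.2.1) _ y.1.2, y.2.2⟩, y.2.1⟩
        left_inv := ?_
        right_inv := ?_ }
    · simpa using x.1.2.2
    · intro x; simp
    · rintro ⟨⟨π, hπ⟩, ⟨g, hg⟩⟩
      exact Sigma.subtype_ext (Subtype.ext (mul_inv_cancel_right _ _)) rfl
  rw [Nat.card_prod, Nat.card_sigma] at hswap
  simp only [hcount, Finset.sum_const, Finset.card_univ, smul_eq_mul] at hswap
  rw [Nat.card_eq_fintype_card (α := Equiv.Perm (Fin m)), Fintype.card_perm, Fintype.card_fin]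
    at hswap
  rw [mul_comm, hswap, Nat.card_eq_fintype_card]

/-- A set of positions without gaps is a block of positions. -/
theorem exists_block {I : Set (Fin n)} (hI : I.OrdConnected) :
    ∃ a m : ℕ, a + m ≤ n ∧ ∀ c : Fin n, c ∈ I ↔ a ≤ (c : ℕ) ∧ (c : ℕ) < a + m := by
  rcases I.eq_empty_or_nonempty with rfl | hne
  · exact ⟨0, 0, by omega, fun c => by simp⟩
  · obtain ⟨x, hx, hmin⟩ := Set.exists_min_image I id I.toFinite hne
    obtain ⟨y, hy, hmax⟩ := Set.exists_max_image I id I.toFinite hne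
    have hxy : (x : ℕ) ≤ y := hmin y hy
    refine ⟨x, y + 1 - x, by omega, fun c => ⟨fun hc => ?_, fun hc => ?_⟩⟩
    · have h1 : (x : ℕ) ≤ c := hmin c hc
      have h2 : (c : ℕ) ≤ y := hmax c hc
      omega
    · refine hI.out hx hy ⟨?_, ?_⟩
      · exact hc.1
      · show (c : ℕ) ≤ y
        omega

/-- All letters of a copy of `p` are adjacent. -/
def IsConsecutive (p : VincularPattern) : Prop := p.X = Finset.Icc 1 (p.k - 1)

/-- A property that passes from a letter of a copy of a consecutive pattern to the next one and
back holds for all letters or for none. -/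
theorem IsCopy.forall_iff_of_isConsecutive {p : VincularPattern} (hp : p.IsConsecutive)
    {π : Equiv.Perm (Fin n)} {g : Fin p.k → Fin n} (hg : p.IsCopy π g) {P : Fin n → Prop}
    (hP : ∀ i j, (g j : ℕ) = g i + 1 → (P (g i) ↔ P (g j))) (i j : Fin p.k) :
    P (g i) ↔ P (g j) := by
  have key : ∀ d : ℕ, ∀ i j : Fin p.k, (j : ℕ) = i + d → (P (g i) ↔ P (g j)) := by
    intro d
    induction d with
    | zero => intro i j hij; rw [Fin.ext (a := j) (b := i) (by omega)]
    | succ d ih =>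
      intro i j hij
      have hj := j.2
      rw [ih i ⟨i + d, by omega⟩ rfl]
      refine hP _ _ (hg.2.2 _ _ (by simp only; omega) ?_)
      rw [hp]
      exact Finset.mem_Icc.mpr (by omega)
  rcases le_total (i : ℕ) j with h | h
  · exact key (j - i) i j (by omega)
  · exact (key (i - j) j i (by omega)).symm

/-- Above a fixed pattern, a consecutive pattern may be replaced by a Wilf-equivalent one. The
dominated region has the same height above all positions of a run of dominated letters, so
whether a consecutive pattern occurs in the region is decided in each run separately, by the
relative order of the letters there; the runs are treated one after the other. -/
theorem wilfEquiv_directSum_of_isConsecutive (τ : VincularPattern) {σ σ' : VincularPattern}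
    (hk : 0 < σ.k) (hk' : 0 < σ'.k) (hσ : σ.IsConsecutive) (hσ' : σ'.IsConsecutive)
    (h : WilfEquiv σ σ') : WilfEquiv (directSum τ σ) (directSum τ σ') := by
  classical
  refine wilfEquiv_directSum_of_frames hk hk' fun n π₀ => ?_
  set C : Fin n → Prop := fun c => τ.Dominates π₀ c (π₀ c) with hC
  -- If a copy of `τ` that dominates `(d, v)` uses the position `c` just before `d`, then `v` is
  -- above the letter at `c`, and a copy that dominates this letter dominates `(c, v)`.
  have hstep : ∀ c d v : Fin n, (d : ℕ) = c + 1 → C c → τ.Dominates π₀ d v →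
      τ.Dominates π₀ c v := by
    rintro c d v hcd hc ⟨f, hf, hb⟩
    by_cases hfc : ∃ i, f i = c
    · obtain ⟨i, rfl⟩ := hfc
      exact hc.mono le_rfl (hb i).2.le
    · refine ⟨f, hf, fun i => ⟨?_, (hb i).2⟩⟩
      have h1 : (f i : ℕ) < d := (hb i).1
      have h2 : (f i : ℕ) ≠ c := fun h => hfc ⟨i, Fin.ext h⟩
      show (f i : ℕ) < c
      omega
  -- The runs of dominated positions are told apart by the number of undominated positions to
  -- their left.
  let ρ : Fin n → ℕ := fun c => (Finset.univ.filter fun b => b < c ∧ ¬ C b).card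
  have hρ_mono : ∀ c d, c ≤ d → ρ c ≤ ρ d := fun c d hcd =>
    Finset.card_le_card fun b hb => by
      simp only [Finset.mem_filter, Finset.mem_univ, true_and] at hb ⊢
      exact ⟨hb.1.trans_le hcd, hb.2⟩
  have hρ_lt : ∀ b c d, b < d → c ≤ b → ¬ C b → ρ c < ρ d := fun b c d hbd hcb hb =>
    Finset.card_lt_card (by
      refine ⟨fun x hx => ?_, fun hsub => ?_⟩
      · simp only [Finset.mem_filter, Finset.mem_univ, true_and] at hx ⊢
        exact ⟨hx.1.trans_le (hcb.trans hbd.le), hx.2⟩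
      · have := hsub (show b ∈ _ from by simp [hbd, hb])
        simp only [Finset.mem_filter, Finset.mem_univ, true_and] at this
        exact absurd this.1 (not_lt.mpr hcb))
  have hρ_succ : ∀ c d : Fin n, (d : ℕ) = c + 1 → C c → ρ c = ρ d := fun c d hcd hc => by
    refine congrArg Finset.card (Finset.filter_congr fun b _ => ?_)
    refine and_congr_left fun hb => ?_
    have : b ≠ c := fun h => hb (h ▸ hc)
    have : (b : ℕ) ≠ c := fun h => this (Fin.ext h)
    show (b : ℕ) < c ↔ (b : ℕ) < d
    omega
  have hρ_le : ∀ c, ρ c < n + 1 := fun c => by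
    have := Finset.card_le_univ (Finset.univ.filter fun b => b < c ∧ ¬ C b)
    rw [Fintype.card_fin] at this
    exact Nat.lt_succ_of_le this
  -- A copy lies in the dominated region as soon as its letters do.
  have hcorner : ∀ p : VincularPattern, p.IsConsecutive → ∀ π, τ.SameFrame π₀ π →
      ((¬ ∃ g, p.IsCopy π g ∧ ∀ j j', τ.Dominates π₀ (g j) (π (g j'))) ↔
        ¬ ∃ g, p.IsCopy π g ∧ ∀ j, C (g j)) := by
    intro p hp π hπ
    refine not_congr (exists_congr fun g => and_congr_right fun hg => ?_)
    constructor
    · intro hd j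
      refine (hπ.dominates_self_iff _).mp ?_
      rw [hπ.dominates_iff]
      exact hd j j
    · intro hc j j'
      refine (hg.forall_iff_of_isConsecutive hp (P := fun c => τ.Dominates π₀ c (π (g j')))
        (fun i i' hi => ⟨fun hd => hd.mono ?_ le_rfl, hstep _ _ _ hi (hc i)⟩) j' j).mp
        ((hπ _).1 (hc j'))
      show (g i : ℕ) ≤ g i'
      omega
  -- In the `t`-th hybrid the first `t` runs avoid `σ'`, the others avoid `σ`.
  let H : ℕ → Equiv.Perm (Fin n) → Prop := fun t π => τ.SameFrame π₀ π ∧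
    (¬ ∃ g, σ'.IsCopy π g ∧ ∀ j, C (g j) ∧ ρ (g j) < t) ∧
    ¬ ∃ g, σ.IsCopy π g ∧ ∀ j, C (g j) ∧ t ≤ ρ (g j)
  have hH0 : Nat.card {π // τ.SameFrame π₀ π ∧
      ¬ ∃ g, σ.IsCopy π g ∧ ∀ j j', τ.Dominates π₀ (g j) (π (g j'))} =
      Nat.card {π // H 0 π} := by
    refine Nat.card_congr (Equiv.subtypeEquivRight fun π => and_congr_right fun hπ => ?_)
    rw [hcorner σ hσ π hπ]
    simp only [not_lt_zero, and_false, zero_le, and_true, iff_and_self]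
    rintro - ⟨g, -, hg⟩
    exact hg ⟨0, hk'⟩
  have hHn : Nat.card {π // τ.SameFrame π₀ π ∧
      ¬ ∃ g, σ'.IsCopy π g ∧ ∀ j j', τ.Dominates π₀ (g j) (π (g j'))} =
      Nat.card {π // H (n + 1) π} := by
    refine Nat.card_congr (Equiv.subtypeEquivRight fun π => and_congr_right fun hπ => ?_)
    rw [hcorner σ' hσ' π hπ]
    simp only [hρ_le, and_true, iff_self_and]
    rintro - ⟨g, -, hg⟩
    exact absurd (hρ_le (g ⟨0, hk⟩)) (not_lt.mpr (hg ⟨0, hk⟩).2)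
  have hsplit : ∀ p : VincularPattern, 0 < p.k → p.IsConsecutive → ∀ π, ∀ g, p.IsCopy π g →
      (∀ j, C (g j)) → ∃ s, ∀ j, ρ (g j) = s := by
    intro p hpk hp π g hg hc
    refine ⟨ρ (g ⟨0, hpk⟩), fun j => ?_⟩
    exact (hg.forall_iff_of_isConsecutive hp (P := fun c => ρ c = ρ (g ⟨0, hpk⟩))
      (fun i i' hi => by rw [hρ_succ _ _ hi (hc i)]) ⟨0, hpk⟩ j).mp rfl
  have hHstep : ∀ t, Nat.card {π // H t π} = Nat.card {π // H (t + 1) π} := by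
    intro t
    obtain ⟨a, m, ham, hI⟩ := exists_block (I := {c : Fin n | C c ∧ ρ c = t}) ⟨by
      rintro x ⟨hx, hxt⟩ y ⟨hy, hyt⟩ z ⟨hxz, hzy⟩
      have h1 := hρ_mono x z hxz
      have h2 := hρ_mono z y hzy
      refine ⟨?_, by omega⟩
      by_contra hz
      have hzy' : z ≠ y := fun h => hz (h ▸ hy)
      have := hρ_lt z x y (lt_of_le_of_ne hzy hzy') hxz hz
      omega⟩
    let Q : Equiv.Perm (Fin n) → Prop := fun π => τ.SameFrame π₀ π ∧
      (¬ ∃ g, σ'.IsCopy π g ∧ ∀ j, C (g j) ∧ ρ (g j) < t) ∧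
      ¬ ∃ g, σ.IsCopy π g ∧ ∀ j, C (g j) ∧ t < ρ (g j)
    have hQ : ∀ h : Equiv.Perm (Fin n), (∀ c : Fin n, ¬ (a ≤ (c : ℕ) ∧ (c : ℕ) < a + m) → h c = c) →
        ∀ π, Q π → Q (π * h) := by
      rintro h hh π ⟨hπ, hq1, hq2⟩
      have hh' : ∀ c, ¬ (C c ∧ ρ c = t) → h c = c := fun c hc => hh c fun hc' => hc ((hI c).mpr hc')
      have hmem : ∀ c, C c ∧ ρ c = t → C (h c) ∧ ρ (h c) = t := by
        intro c hc
        by_contra hcon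
        exact hcon (by rwa [h.injective (hh' _ hcon)])
      refine ⟨fun c => ?_, ?_, ?_⟩
      · by_cases hc : C c ∧ ρ c = t
        · refine ⟨fun _ => ?_, fun hc' => absurd hc.1 hc'⟩
          have hd : τ.Dominates π₀ (h c) (π (h c)) := (hπ _).1 (hmem c hc).1
          have hcI := (hI c).mp hc
          have hhI := (hI (h c)).mp (hmem c hc)
          -- Walk from `h c` to `c` inside the run.
          rcases le_total (h c) c with hle | hle
          · exact hd.mono hle le_rfl
          · have walk : ∀ d : ℕ, ∀ x y : Fin n, (y : ℕ) = x + d → (a ≤ (x : ℕ)) →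
                (y : ℕ) < a + m → τ.Dominates π₀ y (π (h c)) → τ.Dominates π₀ x (π (h c)) := by
              intro d
              induction d with
              | zero =>
                intro x y hxy _ _ hy
                rwa [Fin.ext (a := x) (b := y) (by omega)]
              | succ d ih =>
                intro x y hxy hx hy hyd
                have hz : (x : ℕ) + d < n := by omega
                refine ih x ⟨x + d, hz⟩ rfl hx (by simp only; omega) ?_
                refine hstep _ y _ (by simp only; omega) ?_ hyd
                exact ((hI ⟨x + d, hz⟩).mpr (by simp only; omega)).1
            exact walk ((h c : ℕ) - c) c (h c) (by
              have : (c : ℕ) ≤ h c := hle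
              omega) hcI.1 hhI.2 hd
        · rw [Equiv.Perm.mul_apply, hh' c hc]
          exact hπ c
      · rintro ⟨g, hg, hgc⟩
        refine hq1 ⟨g, hg.congr fun i => ?_, hgc⟩
        rw [Equiv.Perm.mul_apply, hh']
        exact fun hc => absurd hc.2 (hgc i).2.ne
      · rintro ⟨g, hg, hgc⟩
        refine hq2 ⟨g, hg.congr fun i => ?_, hgc⟩
        rw [Equiv.Perm.mul_apply, hh']
        exact fun hc => absurd hc.2 (hgc i).2.ne'
    have h1 := factorial_mul_card_block_avoids ham σ Q hQ
    have h2 := factorial_mul_card_block_avoids ham σ' Q hQ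
    rw [h m, ← h2] at h1
    have h3 := Nat.eq_of_mul_eq_mul_left (Nat.factorial_pos m) h1
    simp only [← hI, Set.mem_ofPred_eq] at h3
    convert h3 using 1
    · refine Nat.card_congr (Equiv.subtypeEquivRight fun π => ?_)
      simp only [H, Q, and_assoc]
      refine and_congr_right fun _ => and_congr_right fun _ => ?_
      rw [← not_or, ← exists_or]
      refine not_congr (exists_congr fun g => ⟨?_, ?_⟩)
      · rintro ⟨hg, hgc⟩
        obtain ⟨s, hs⟩ := hsplit σ hk hσ π g hg fun j => (hgc j).1
        rcases (show t ≤ s from hs ⟨0, hk⟩ ▸ (hgc ⟨0, hk⟩).2).eq_or_lt with hts | hts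
        · exact Or.inr ⟨hg, fun j => ⟨(hgc j).1, (hs j).trans hts.symm⟩⟩
        · exact Or.inl ⟨hg, fun j => ⟨(hgc j).1, by rw [hs j]; exact hts⟩⟩
      · rintro (⟨hg, hgc⟩ | ⟨hg, hgc⟩)
        · exact ⟨hg, fun j => ⟨(hgc j).1, (hgc j).2.le⟩⟩
        · exact ⟨hg, fun j => ⟨(hgc j).1, (hgc j).2.ge⟩⟩
    · refine Nat.card_congr (Equiv.subtypeEquivRight fun π => ?_)
      simp only [H, Q, and_assoc]
      refine and_congr_right fun _ => ?_
      rw [and_comm (b := ¬ ∃ g, σ'.IsCopy π g ∧ ∀ j, C (g j) ∧ ρ (g j) = t), ← and_assoc]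
      refine and_congr ?_ Iff.rfl
      rw [← not_or, ← exists_or]
      refine not_congr (exists_congr fun g => ⟨?_, ?_⟩)
      · rintro ⟨hg, hgc⟩
        obtain ⟨s, hs⟩ := hsplit σ' hk' hσ' π g hg fun j => (hgc j).1
        have hst : s < t + 1 := hs ⟨0, hk'⟩ ▸ (hgc ⟨0, hk'⟩).2
        rcases (Nat.lt_succ_iff.mp hst).eq_or_lt with hts | hts
        · exact Or.inr ⟨hg, fun j => ⟨(hgc j).1, (hs j).trans hts⟩⟩
        · exact Or.inl ⟨hg, fun j => ⟨(hgc j).1, by rw [hs j]; exact hts⟩⟩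
      · rintro (⟨hg, hgc⟩ | ⟨hg, hgc⟩)
        · exact ⟨hg, fun j => ⟨(hgc j).1, (hgc j).2.trans (Nat.lt_succ_self t)⟩⟩
        · exact ⟨hg, fun j => ⟨(hgc j).1, by rw [(hgc j).2]; exact Nat.lt_succ_self t⟩⟩
  rw [hH0, hHn]
  have : ∀ t, Nat.card {π // H 0 π} = Nat.card {π // H t π} := by
    intro t
    induction t with
    | zero => rfl
    | succ t ih => rw [ih, hHstep]
  exact this _

end VincularPattern

namespace VincularPattern

/-! ### Placements on boards -/

/-- A board: a set of cells (position, value) that is closed under going right and up. -/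
def IsBoard (D : ℕ → ℕ → Prop) : Prop :=
  ∀ ⦃x x' y y' : ℕ⦄, x ≤ x' → y ≤ y' → D x y → D x' y'

/-- The number of permutations of length `m`, seen as placements on the board `D`, with no copy
of `σ` whose bounding rectangle lies in the board. -/
noncomputable def boardCount (σ : VincularPattern) (m : ℕ) (D : ℕ → ℕ → Prop) : ℕ :=
  Nat.card {w : Equiv.Perm (Fin m) // (∀ i : Fin m, D i (w i)) ∧
    ¬ ∃ g, σ.IsCopy w g ∧ ∀ j j', D (g j) (w (g j'))}

/-- Shape-Wilf-equivalence: equally many placements on every board avoid `σ` and `σ'`. -/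
def ShapeWilfEquiv (σ σ' : VincularPattern) : Prop :=
  ∀ m D, IsBoard D → boardCount σ m D = boardCount σ' m D

theorem isCopy_iff_of_X_eq_empty {p : VincularPattern} (hp : p.X = ∅) {n : ℕ}
    {π : Equiv.Perm (Fin n)} {f : Fin p.k → Fin n} :
    p.IsCopy π f ↔ StrictMono f ∧ ∀ a b, π (f a) ≤ π (f b) ↔ p.σ a ≤ p.σ b := by
  simp [IsCopy, hp]

/-- The permutations with the same letters as `π₀` outside of the region dominated by `τ`
correspond to the placements on a board: keep only the positions and the values of the
dominated letters. -/
theorem exists_board_of_frame (τ : VincularPattern) {n : ℕ} (π₀ : Equiv.Perm (Fin n)) :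
    ∃ m D, IsBoard D ∧ ∀ σ : VincularPattern, σ.X = ∅ →
      Nat.card {π // τ.SameFrame π₀ π ∧
        ¬ ∃ g, σ.IsCopy π g ∧ ∀ j j', τ.Dominates π₀ (g j) (π (g j'))} = boardCount σ m D := by
  classical
  let C : Finset (Fin n) := Finset.univ.filter fun c => τ.Dominates π₀ c (π₀ c)
  have hC : ∀ c, c ∈ C ↔ τ.Dominates π₀ c (π₀ c) := fun c => by simp [C]
  let m := C.card
  let eC : Fin m ↪o Fin n := C.orderEmbOfFin rfl
  have heC : ∀ c, c ∈ C ↔ ∃ i, eC i = c := fun c => by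
    have := C.range_orderEmbOfFin rfl
    rw [← Finset.mem_coe, ← this]
    rfl
  have hR : (C.image π₀).card = m := Finset.card_image_of_injective _ π₀.injective
  let eR : Fin m ↪o Fin n := (C.image π₀).orderEmbOfFin hR
  have heR : ∀ v, (∃ i, eR i = v) ↔ ∃ i, π₀ (eC i) = v := fun v => by
    have := (C.image π₀).range_orderEmbOfFin hR
    have h1 : (∃ i, eR i = v) ↔ v ∈ C.image π₀ := by
      rw [← Finset.mem_coe, ← this]
      rfl
    rw [h1, Finset.mem_image]
    constructor
    · rintro ⟨c, hc, rfl⟩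
      obtain ⟨i, rfl⟩ := (heC c).mp hc
      exact ⟨i, rfl⟩
    · rintro ⟨i, rfl⟩
      exact ⟨eC i, (heC _).mpr ⟨i, rfl⟩, rfl⟩
  -- Every permutation with the same frame permutes the values of the dominated letters.
  have hperm : ∀ π, τ.SameFrame π₀ π → ∃ w : Equiv.Perm (Fin m), ∀ i, eR (w i) = π (eC i) := by
    intro π hπ
    have hex : ∀ i, ∃ j, eR j = π (eC i) := by
      intro i
      rw [heR]
      obtain ⟨d, hd⟩ := π₀.surjective (π (eC i))
      by_cases hdC : d ∈ C
      · obtain ⟨j, rfl⟩ := (heC d).mp hdC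
        exact ⟨j, hd⟩
      · have h1 := (hπ d).2 (fun h => hdC ((hC d).mpr h))
        have h2 : d = eC i := π.injective (h1.trans hd)
        exact absurd ((heC d).mpr ⟨i, h2.symm⟩) hdC
    choose w hw using hex
    have hinj : Function.Injective w := fun i j hij => by
      have : π (eC i) = π (eC j) := by rw [← hw, ← hw, hij]
      exact eC.injective (π.injective this)
    exact ⟨Equiv.ofBijective w (Finite.injective_iff_bijective.mp hinj), hw⟩
  obtain ⟨w₀, hw₀⟩ := hperm π₀ ((τ.frameSetoid n).refl π₀)
  let F : Equiv.Perm (Fin m) → Equiv.Perm (Fin n) := fun w =>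
    π₀ * (w₀⁻¹ * w).viaFintypeEmbedding eC.toEmbedding
  have hF : ∀ w i, F w (eC i) = eR (w i) := by
    intro w i
    have := Equiv.Perm.viaFintypeEmbedding_apply_image (w₀⁻¹ * w) eC.toEmbedding i
    simp only [RelEmbedding.coe_toEmbedding] at this
    simp only [F, Equiv.Perm.mul_apply, this, ← hw₀]
    simp
  have hF' : ∀ w c, c ∉ C → F w c = π₀ c := by
    intro w c hc
    have := Equiv.Perm.viaFintypeEmbedding_apply_notMem_range (w₀⁻¹ * w) eC.toEmbedding
      (b := c) (fun ⟨i, hi⟩ => hc ((heC c).mpr ⟨i, hi⟩))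
    simp only [F, Equiv.Perm.mul_apply, this]
  let D : ℕ → ℕ → Prop := fun x y =>
    ∃ i j : Fin m, (i : ℕ) ≤ x ∧ (j : ℕ) ≤ y ∧ τ.Dominates π₀ (eC i) (eR j)
  have hDiff : ∀ i j : Fin m, D i j ↔ τ.Dominates π₀ (eC i) (eR j) := fun i j =>
    ⟨fun ⟨i', j', hi, hj, hd⟩ => hd.mono (eC.monotone hi) (eR.monotone hj),
      fun hd => ⟨i, j, le_rfl, le_rfl, hd⟩⟩
  refine ⟨m, D, fun x x' y y' hx hy ⟨i, j, hi, hj, hd⟩ => ⟨i, j, hi.trans hx, hj.trans hy, hd⟩,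
    fun σ hσ => ?_⟩
  have hframe : ∀ w, (∀ i : Fin m, D i (w i)) ↔ τ.SameFrame π₀ (F w) := by
    intro w
    constructor
    · intro hw c
      by_cases hc : c ∈ C
      · refine ⟨fun _ => ?_, fun h => absurd ((hC c).mp hc) h⟩
        obtain ⟨i, rfl⟩ := (heC c).mp hc
        rw [hF, ← hDiff]
        exact hw i
      · exact ⟨fun h => absurd ((hC c).mpr h) hc, fun _ => hF' w c hc⟩
    · intro hw i
      rw [hDiff, ← hF]
      exact (hw _).1 ((hC _).mp ((heC _).mpr ⟨i, rfl⟩))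
  have hcopy : ∀ w, τ.SameFrame π₀ (F w) →
      ((∃ g, σ.IsCopy (F w) g ∧ ∀ j j', τ.Dominates π₀ (g j) (F w (g j'))) ↔
        ∃ g, σ.IsCopy w g ∧ ∀ j j', D (g j) (w (g j'))) := by
    intro w hw
    simp only [isCopy_iff_of_X_eq_empty hσ]
    constructor
    · rintro ⟨g, ⟨hg, ho⟩, hd⟩
      have hgC : ∀ j, ∃ i, eC i = g j := fun j => by
        rw [← heC, hC, ← hw.dominates_self_iff, hw.dominates_iff]
        exact hd j j
      choose f hf using hgC
      simp only [← hf, hF, ← hDiff] at hd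
      refine ⟨f, ⟨fun a b hab => ?_, fun a b => ?_⟩, hd⟩
      · rw [← eC.lt_iff_lt, hf, hf]
        exact hg hab
      · rw [← ho, ← hf, ← hf, hF, hF, eR.le_iff_le]
    · rintro ⟨f, ⟨hf, ho⟩, hd⟩
      refine ⟨fun j => eC (f j), ⟨fun a b hab => eC.lt_iff_lt.mpr (hf hab), fun a b => ?_⟩, ?_⟩
      · rw [hF, hF, eR.le_iff_le, ho]
      · intro j j'
        rw [hF, ← hDiff]
        exact hd j j'
  refine (Nat.card_congr (Equiv.ofBijective
    (fun w => ⟨F w.1, (hframe w.1).mp w.2.1, fun h => w.2.2 ((hcopy w.1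
      ((hframe w.1).mp w.2.1)).mp h)⟩) ⟨?_, ?_⟩)).symm
  · rintro ⟨w, hw⟩ ⟨w', hw'⟩ h
    have h1 : F w = F w' := congrArg Subtype.val h
    refine Subtype.ext (Equiv.ext fun i => eR.injective ?_)
    rw [← hF, ← hF, h1]
  · rintro ⟨π, hπ, hav⟩
    obtain ⟨w, hw⟩ := hperm π hπ
    have hFw : F w = π := by
      refine Equiv.ext fun c => ?_
      by_cases hc : c ∈ C
      · obtain ⟨i, rfl⟩ := (heC c).mp hc
        rw [hF, hw]
      · rw [hF' w c hc, (hπ c).2 fun h => hc ((hC c).mpr h)]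
    subst hFw
    exact ⟨⟨w, (hframe w).mpr hπ, fun h => hav ((hcopy w hπ).mpr h)⟩, rfl⟩

/-- Above a fixed pattern, a pattern without adjacencies may be replaced by a
shape-Wilf-equivalent one. -/
theorem wilfEquiv_directSum_of_shapeWilfEquiv (τ : VincularPattern) {σ σ' : VincularPattern}
    (hk : 0 < σ.k) (hk' : 0 < σ'.k) (hσ : σ.X = ∅) (hσ' : σ'.X = ∅)
    (h : ShapeWilfEquiv σ σ') : WilfEquiv (directSum τ σ) (directSum τ σ') := by
  refine wilfEquiv_directSum_of_frames hk hk' fun n π₀ => ?_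
  obtain ⟨m, D, hD, hcount⟩ := exists_board_of_frame τ π₀
  rw [hcount σ hσ, hcount σ' hσ', h m D hD]

/-- The inverse of a pattern without adjacencies. -/
abbrev inverse (p : VincularPattern) : VincularPattern where
  k := p.k
  σ := p.σ.symm
  X := ∅
  X_subset := Finset.empty_subset _

/-- Inverting permutations transposes boards. -/
theorem boardCount_inverse {p : VincularPattern} (hp : p.X = ∅) (m : ℕ) (D : ℕ → ℕ → Prop) :
    boardCount p.inverse m (fun x y => D y x) = boardCount p m D := by
  have key : ∀ (q : VincularPattern), q.X = ∅ → ∀ (B : ℕ → ℕ → Prop) (w : Equiv.Perm (Fin m)),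
      (∃ g, q.IsCopy w g ∧ ∀ j j', B (g j) (w (g j'))) →
      ∃ g, q.inverse.IsCopy w⁻¹ g ∧ ∀ j j', B (w⁻¹ (g j')) (g j) := by
    intro q hq B w
    simp only [isCopy_iff_of_X_eq_empty hq, isCopy_iff_of_X_eq_empty (p := q.inverse) rfl]
    rintro ⟨g, ⟨hg, ho⟩, hB⟩
    refine ⟨fun i => w (g (q.σ.symm i)), ⟨?_, ?_⟩, ?_⟩
    · intro a b hab
      rw [← not_le, ho]
      simpa using hab
    · intro a b
      simp [hg.le_iff_le]
    · intro j j'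
      simpa using hB _ _
  have hpp : p.inverse.inverse = p := by
    obtain ⟨k, σ, X, hX⟩ := p
    cases hp
    rfl
  refine Nat.card_congr ((Equiv.inv _).subtypeEquiv fun w => ?_)
  refine and_congr ?_ (not_congr ⟨fun h => ?_, fun h => ?_⟩)
  · constructor
    · intro h i
      simpa using h (w⁻¹ i)
    · intro h i
      simpa using h (w i)
  · have := key p.inverse rfl (fun x y => D y x) w h
    rw [hpp] at this
    exact this
  · simpa using key p hp D w⁻¹ h

end VincularPattern

/-! ### Standardization of words -/

namespace List

/-- The standardization of a word of distinct letters: each letter is replaced by its rank. -/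
def standardize (L : List ℕ) : List ℕ := L.map fun a => L.countP (· < a)

/-- Prepend a letter of relative value `v` to a standardized word. -/
def consRank (v : ℕ) (π : List ℕ) : List ℕ := v :: π.map fun x => if v ≤ x then x + 1 else x

/-- Delete the smallest letter of a standardized word. -/
def eraseMin (π : List ℕ) : List ℕ := (π.erase 0).map Nat.pred

@[simp] theorem length_standardize (L : List ℕ) : L.standardize.length = L.length := by
  simp [standardize]

@[simp] theorem length_consRank (v : ℕ) (π : List ℕ) : (consRank v π).length = π.length + 1 := by
  simp [consRank]

theorem countP_lt_mono (L : List ℕ) {a b : ℕ} (hab : a ≤ b) :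
    L.countP (· < a) ≤ L.countP (· < b) :=
  List.countP_mono_left fun x _ hx => by
    simp only [decide_eq_true_eq] at hx ⊢
    omega

theorem countP_lt_strictMono {L : List ℕ} {a b : ℕ} (ha : a ∈ L) (hab : a < b) :
    L.countP (· < a) < L.countP (· < b) := by
  induction L with
  | nil => simp at ha
  | cons x L ih =>
    rw [List.countP_cons, List.countP_cons]
    rcases List.mem_cons.mp ha with rfl | ha
    · have := countP_lt_mono L hab.le
      simp [hab]
      omega
    · have := ih ha
      by_cases h1 : x < a
      · simp [h1, h1.trans hab]; omega
      · simp only [h1, decide_false, Bool.false_eq_true, if_false]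
        omega

theorem countP_lt_iff {L : List ℕ} {a b : ℕ} (ha : a ∈ L) :
    L.countP (· < a) < L.countP (· < b) ↔ a < b := by
  refine ⟨fun h => ?_, countP_lt_strictMono ha⟩
  by_contra hab
  exact absurd (countP_lt_mono L (not_lt.mp hab)) (not_le.mpr h)

theorem countP_le_iff {L : List ℕ} {a b : ℕ} (hb : b ∈ L) :
    L.countP (· < a) ≤ L.countP (· < b) ↔ a ≤ b := by
  rw [← not_lt, countP_lt_iff hb, not_lt]

theorem standardize_cons {a : ℕ} {L : List ℕ} (ha : a ∉ L) :
    (a :: L).standardize = consRank (L.countP (· < a)) L.standardize := by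
  unfold standardize consRank
  rw [List.map_cons, List.map_map]
  congr 1
  · simp
  · refine List.map_congr_left fun b hb => ?_
    have hba : b ≠ a := fun h => ha (h ▸ hb)
    simp only [Function.comp]
    rw [List.countP_cons]
    rcases lt_or_gt_of_ne hba with h | h
    · have h1 := countP_lt_strictMono hb h
      simp only [not_lt.mpr h.le, decide_false, Bool.false_eq_true, if_false, not_le.mpr h1]
      rfl
    · have h1 := countP_lt_mono L h.le
      simp [h, h1]

theorem countP_erase_min {L : List ℕ} {r a : ℕ} (hr : r ∈ L) (ha : r < a) :
    (L.erase r).countP (· < a) = (L.countP (· < a)).pred := by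
  have h1 : L.Perm (r :: L.erase r) := List.perm_cons_erase hr
  rw [h1.countP_eq, List.countP_cons]
  simp [ha]

theorem standardize_erase {L : List ℕ} (hL : L.Nodup) {r : ℕ} (hr : r ∈ L)
    (hmin : ∀ x ∈ L, r ≤ x) : (L.erase r).standardize = L.standardize.eraseMin := by
  have h0 : L.countP (· < r) = 0 := by
    rw [List.countP_eq_zero]
    intro x hx
    simpa using hmin x hx
  have hpos : ∀ x ∈ L, x ≠ r → L.countP (· < x) ≠ 0 := by
    intro x hx hxr
    have := countP_lt_strictMono hr (lt_of_le_of_ne (hmin x hx) (Ne.symm hxr))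
    omega
  unfold standardize eraseMin
  rw [hL.erase_eq_filter]
  have h2 : (L.map fun a => L.countP (· < a)).Nodup := by
    refine hL.map_on fun x hx y hy hxy => ?_
    exact le_antisymm ((countP_le_iff hy).mp hxy.le) ((countP_le_iff hx).mp hxy.ge)
  rw [h2.erase_eq_filter, List.filter_map, List.map_map]
  have h3 : L.filter ((fun x => x != 0) ∘ fun a => L.countP (· < a)) = L.filter (· != r) := by
    refine List.filter_congr fun x hx => ?_
    by_cases hxr : x = r
    · simp [hxr, h0]
    · exact (bne_iff_ne.mpr (hpos x hx hxr)).trans (bne_iff_ne.mpr hxr).symm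
  rw [h3]
  refine List.map_congr_left fun x hx => ?_
  rw [List.mem_filter] at hx
  have hxr : x ≠ r := by simpa using hx.2
  rw [← hL.erase_eq_filter, countP_erase_min hr (lt_of_le_of_ne (hmin x hx.1) hxr.symm)]
  rfl

theorem standardize_perm_range {L : List ℕ} (hL : L.Nodup) :
    L.standardize.Perm (List.range L.length) := by
  have h2 : L.standardize.Nodup := by
    refine hL.map_on fun x hx y hy hxy => ?_
    exact le_antisymm ((countP_le_iff hy).mp hxy.le) ((countP_le_iff hx).mp hxy.ge)
  have hsub : L.standardize ⊆ List.range L.length := by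
    intro x hx
    obtain ⟨a, ha, rfl⟩ := List.mem_map.mp hx
    rw [List.mem_range]
    refine lt_of_le_of_ne List.countP_le_length fun h => ?_
    have := (List.countP_eq_length.mp h) a ha
    simp at this
  exact (h2.subperm hsub).perm_of_length_le (by simp)

theorem consRank_injective {v v' : ℕ} {π π' : List ℕ} (h : consRank v π = consRank v' π') :
    v = v' ∧ π = π' := by
  obtain ⟨rfl, h⟩ := List.cons.inj h
  refine ⟨rfl, List.map_injective_iff.mpr (fun x y hxy => ?_) h⟩
  split_ifs at hxy <;> omega

theorem consRank_perm_range {v : ℕ} {π : List ℕ} (hπ : π.Perm (List.range π.length))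
    (hv : v ≤ π.length) : (consRank v π).Perm (List.range (consRank v π).length) := by
  have hnd : π.Nodup := hπ.nodup_iff.mpr List.nodup_range
  have hinj : Function.Injective fun x : ℕ => if v ≤ x then x + 1 else x := by
    intro x y hxy
    dsimp only at hxy
    split_ifs at hxy <;> omega
  have h1 : (consRank v π).Nodup := by
    refine List.nodup_cons.mpr ⟨?_, hnd.map hinj⟩
    rw [List.mem_map]
    rintro ⟨x, -, hx⟩
    split_ifs at hx <;> omega
  refine (h1.subperm fun x hx => ?_).perm_of_length_le (by simp)
  rw [length_consRank, List.mem_range]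
  rcases List.mem_cons.mp hx with rfl | hx
  · omega
  · obtain ⟨y, hy, rfl⟩ := List.mem_map.mp hx
    have := List.mem_range.mp (hπ.mem_iff.mp hy)
    split_ifs <;> omega

theorem length_eraseMin {π : List ℕ} (h : 0 ∈ π) : π.eraseMin.length = π.length - 1 := by
  simp [eraseMin, List.length_erase_of_mem h]

theorem eraseMin_perm_range {π : List ℕ} (hπ : π.Perm (List.range π.length)) (h : 0 ∈ π) :
    π.eraseMin.Perm (List.range π.eraseMin.length) := by
  have hnd : π.Nodup := hπ.nodup_iff.mpr List.nodup_range
  have h0 : ∀ x ∈ π.erase 0, x ≠ 0 := fun x hx => (hnd.mem_erase_iff.mp hx).1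
  have h1 : π.eraseMin.Nodup := (hnd.erase 0).map_on fun x hx y hy hxy => by
    have := h0 x hx
    have := h0 y hy
    simp only [Nat.pred_eq_sub_one] at hxy
    omega
  refine (h1.subperm fun x hx => ?_).perm_of_length_le (by simp)
  obtain ⟨y, hy, rfl⟩ := List.mem_map.mp hx
  have h2 := List.mem_range.mp (hπ.mem_iff.mp (List.mem_of_mem_erase hy))
  have h3 := h0 y hy
  rw [List.mem_range, length_eraseMin h, Nat.pred_eq_sub_one]
  omega

theorem eq_insertIdx_erase {α : Type*} [DecidableEq α] {l : List α} {a : α} (h : a ∈ l) :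
    (l.erase a).insertIdx (l.idxOf a) a = l := by
  induction l with
  | nil => simp at h
  | cons x l ih =>
    by_cases hx : x = a
    · subst hx; simp
    · rcases List.mem_cons.mp h with rfl | h
      · exact absurd rfl hx
      · rw [List.erase_cons_tail (by simpa using hx), List.idxOf_cons_ne _ hx,
          List.insertIdx_succ_cons, ih h]

theorem idxOf_and_erase_insertIdx {α : Type*} [DecidableEq α] {l : List α} {a : α} (ha : a ∉ l)
    {i : ℕ} (hi : i ≤ l.length) :
    (l.insertIdx i a).idxOf a = i ∧ (l.insertIdx i a).erase a = l := by
  induction l generalizing i with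
  | nil =>
    have : i = 0 := by simpa using hi
    subst this
    simp
  | cons x l ih =>
    cases i with
    | zero => simp
    | succ i =>
      have hx : x ≠ a := fun h => ha (h ▸ List.mem_cons_self)
      have := ih (fun h => ha (List.mem_cons_of_mem _ h)) (i := i) (by simpa using hi)
      rw [List.insertIdx_succ_cons, List.idxOf_cons_ne _ hx,
        List.erase_cons_tail (by simpa using hx), this.1, this.2]
      exact ⟨rfl, rfl⟩

/-- A standardized word can be recovered after the deletion of its smallest letter from the
position of that letter. -/
theorem eq_of_eraseMin_eq {π π' : List ℕ} (hπ : π.Nodup) (hπ' : π'.Nodup) (h0 : 0 ∈ π)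
    (h0' : 0 ∈ π') (h : π.eraseMin = π'.eraseMin) (hi : π.idxOf 0 = π'.idxOf 0) : π = π' := by
  have key : ∀ l : List ℕ, l.Nodup → l.eraseMin.map Nat.succ = l.erase 0 := by
    intro l hl
    unfold eraseMin
    rw [List.map_map]
    conv_rhs => rw [← List.map_id (l.erase 0)]
    refine List.map_congr_left fun x hx => ?_
    exact Nat.succ_pred_eq_of_ne_zero (hl.mem_erase_iff.mp hx).1
  rw [← eq_insertIdx_erase h0, ← eq_insertIdx_erase h0', ← key π hπ, ← key π' hπ', h, hi]

theorem idxOf_map_of_inj_on {α β : Type*} [DecidableEq α] [DecidableEq β] {l : List α} {a : α}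
    (f : α → β) (h : ∀ x ∈ l, f x = f a → x = a) : (l.map f).idxOf (f a) = l.idxOf a := by
  induction l with
  | nil => rfl
  | cons x l ih =>
    rw [List.map_cons]
    by_cases hx : x = a
    · subst hx; simp
    · have hfx : f x ≠ f a := fun hf => hx (h x List.mem_cons_self hf)
      rw [List.idxOf_cons_ne _ hfx, List.idxOf_cons_ne _ hx,
        ih fun y hy => h y (List.mem_cons_of_mem _ hy)]

theorem idxOf_zero_standardize {L : List ℕ} {r : ℕ} (hr : r ∈ L) (hmin : ∀ x ∈ L, r ≤ x) :
    L.standardize.idxOf 0 = L.idxOf r := by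
  have h0 : L.countP (· < r) = 0 := by
    rw [List.countP_eq_zero]
    intro x hx
    simpa using hmin x hx
  have := idxOf_map_of_inj_on (l := L) (a := r) (fun a => L.countP (· < a)) fun x hx hxr =>
    le_antisymm ((countP_le_iff hr).mp hxr.le) (hmin x hx)
  simp only [h0] at this
  exact this

theorem zero_mem_standardize {L : List ℕ} {r : ℕ} (hr : r ∈ L) (hmin : ∀ x ∈ L, r ≤ x) :
    0 ∈ L.standardize := by
  refine List.mem_map.mpr ⟨r, hr, ?_⟩
  rw [List.countP_eq_zero]
  intro x hx
  simpa using hmin x hx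

end List

/-! ### Reading a placement along the boundary of the board -/

/-- A property of words that depends only on the relative order of the letters. -/
def IsOrderInvariant (A : List ℕ → Prop) : Prop :=
  ∀ (L : List ℕ) (f : ℕ → ℕ), (∀ x ∈ L, ∀ y ∈ L, x < y → f x < f y) → (A (L.map f) ↔ A L)

/-- The reading of a placement along a lattice path. A letter `true` of the path adds the next
column to the left of the current word `L`, a letter `false` deletes the lowest row, which must
contain a letter of `L`. Here `q` lists the letters of the columns to come and `rows` the rows
to come. `ReadsTo` says that all steps are possible, that everything is used up at the end, and
that after each step that adds a column the current word has property `A`. -/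
def ReadsTo (A : List ℕ → Prop) : List Bool → List ℕ → List ℕ → List ℕ → Prop
  | [], rows, q, L => rows = [] ∧ q = [] ∧ L = []
  | true :: _, _, [], _ => False
  | true :: p, rows, a :: q, L => A (a :: L) ∧ ReadsTo A p rows q (a :: L)
  | false :: _, [], _, _ => False
  | false :: p, r :: rows, q, L => r ∈ L ∧ ReadsTo A p rows q (L.erase r)

open Classical in
/-- The number of ways to go along a lattice path when only the relative order of the letters of
the current word `π` is recorded: a new letter gets a relative value, the values of the letters
to come being left open. -/
noncomputable def pathCount (A : List ℕ → Prop) : List Bool → List ℕ → ℕ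
  | [], π => if π = [] then 1 else 0
  | true :: p, π => ∑ v ∈ Finset.range (π.length + 1),
      if A (List.consRank v π) then pathCount A p (List.consRank v π) else 0
  | false :: p, π => if 0 ∈ π then pathCount A p π.eraseMin else 0

namespace ReadsTo

variable {A : List ℕ → Prop}

theorem perm {p : List Bool} {rows q L : List ℕ} (h : ReadsTo A p rows q L) :
    (q ++ L).Perm rows := by
  induction p generalizing rows q L with
  | nil => obtain ⟨rfl, rfl, rfl⟩ := h; rfl
  | cons b p ih =>
    cases b with
    | true =>
      cases q with
      | nil => exact h.elim
      | cons a q => exact List.perm_middle.symm.trans (ih h.2)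
    | false =>
      cases rows with
      | nil => exact h.elim
      | cons r rows =>
        have h1 : L.Perm (r :: L.erase r) := List.perm_cons_erase h.1
        exact (h1.append_left q).trans (List.perm_middle.trans ((ih h.2).cons r))

theorem nodup {p : List Bool} {rows q L : List ℕ} (h : ReadsTo A p rows q L)
    (hr : rows.Nodup) : (q ++ L).Nodup := h.perm.nodup_iff.mpr hr

/-- The readings that start from a word of relative order `π` are counted by `pathCount`, which does
not refer to the actual letters. -/
theorem finite_and_card (hA : IsOrderInvariant A) (p : List Bool) (rows π : List ℕ)
    (hrows : rows.Pairwise (· < ·)) (hlen : p.count false = rows.length)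
    (hπ : π.Perm (List.range π.length)) :
    Finite {x : List ℕ × List ℕ // x.2.standardize = π ∧ ReadsTo A p rows x.1 x.2} ∧
      Nat.card {x : List ℕ × List ℕ // x.2.standardize = π ∧ ReadsTo A p rows x.1 x.2} =
        pathCount A p π := by
  classical
  induction p generalizing rows π with
  | nil =>
    have hrows0 : rows = [] := List.length_eq_zero_iff.mp (by simpa using hlen.symm)
    subst hrows0
    have hsub : Subsingleton
        {x : List ℕ × List ℕ // x.2.standardize = π ∧ ReadsTo A [] [] x.1 x.2} := by
      refine ⟨fun ⟨⟨q, L⟩, _, _, hq, hL⟩ ⟨⟨q', L'⟩, _, _, hq', hL'⟩ => ?_⟩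
      simp only at hq hL hq' hL'
      subst hq hL hq' hL'
      rfl
    refine ⟨inferInstance, ?_⟩
    by_cases h : π = []
    · subst h
      simp only [pathCount, if_true]
      rw [Nat.card_eq_one_iff_unique]
      exact ⟨hsub, ⟨⟨([], []), rfl, rfl, rfl, rfl⟩⟩⟩
    · simp only [pathCount, h, if_false]
      rw [Nat.card_eq_zero]
      refine Or.inl ⟨fun ⟨⟨q, L⟩, hst, _, _, hL⟩ => h ?_⟩
      simp only at hst hL
      rw [← hst, hL]
      rfl
  | cons b p ih =>
    cases b with
    | true =>
      have hlen' : p.count false = rows.length := by simpa using hlen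
      have hnd : rows.Nodup := hrows.imp fun h => h.ne
      let V := {v : Fin (π.length + 1) // A (List.consRank v π)}
      let T : V → Type := fun v => {x : List ℕ × List ℕ //
        x.2.standardize = List.consRank v.1 π ∧ ReadsTo A p rows x.1 x.2}
      have hih := fun v : V => ih rows (List.consRank v.1 π) hrows hlen'
        (List.consRank_perm_range hπ (Nat.lt_succ_iff.mp v.1.2))
      have hfin : ∀ v : V, Finite (T v) := fun v => (hih v).1
      have hhead : ∀ v : V, ∀ y : T v, ∃ q a L, y.1 = (q, a :: L) ∧
          L.standardize = π ∧ A (a :: L) ∧ (v.1 : ℕ) = L.countP (· < a) := by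
        rintro v ⟨⟨q, L'⟩, hst, hr⟩
        cases L' with
        | nil => simp [List.standardize, List.consRank] at hst
        | cons a L =>
          have hnd' := (List.nodup_append.mp (hr.nodup hnd)).2.1
          have hst' := hst
          simp only at hst'
          rw [List.standardize_cons (List.nodup_cons.mp hnd').1] at hst'
          have h2 := List.consRank_injective hst'
          refine ⟨q, a, L, rfl, h2.2, ?_, h2.1.symm⟩
          rw [← hA (a :: L) (fun x => (a :: L).countP (· < x))
            fun x hx y _ hxy => List.countP_lt_strictMono hx hxy]
          have : (a :: L).map (fun x => (a :: L).countP (· < x)) = List.consRank v.1 π := hst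
          rw [this]
          exact v.2
      let F : (Σ v, T v) →
          {x : List ℕ × List ℕ // x.2.standardize = π ∧ ReadsTo A (true :: p) rows x.1 x.2} :=
        fun y => ⟨(y.2.1.2.headD 0 :: y.2.1.1, y.2.1.2.tail), by
          obtain ⟨q, a, L, hy, hL, ha, -⟩ := hhead y.1 y.2
          have hr := y.2.2.2
          rw [hy] at hr ⊢
          exact ⟨hL, ha, hr⟩⟩
      have hbij : Function.Bijective F := by
        constructor
        · rintro ⟨v, y⟩ ⟨v', y'⟩ h
          obtain ⟨q, a, L, hy, -, -, hv⟩ := hhead v y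
          obtain ⟨q', a', L', hy', -, -, hv'⟩ := hhead v' y'
          have h1 := congrArg Subtype.val h
          simp only [F, hy, hy', List.headD_cons, List.tail_cons, Prod.mk.injEq,
            List.cons.injEq] at h1
          obtain ⟨⟨rfl, rfl⟩, rfl⟩ := h1
          have hvv : v = v' := Subtype.ext (Fin.ext (hv.trans hv'.symm))
          exact Sigma.subtype_ext hvv (hy.trans hy'.symm)
        · rintro ⟨⟨q, L⟩, hst, hr⟩
          cases q with
          | nil => exact hr.elim
          | cons a q =>
            have haL : a ∉ L := fun h => by
              have := (List.nodup_cons.mp (List.cons_append ▸ hr.nodup hnd)).1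
              exact this (List.mem_append_right _ h)
            simp only at hst
            have hcons : (a :: L).standardize = List.consRank (L.countP (· < a)) π := by
              rw [List.standardize_cons haL, hst]
            have hv : L.countP (· < a) < π.length + 1 := by
              rw [← hst, List.length_standardize]
              exact Nat.lt_succ_of_le List.countP_le_length
            have hAv : A (List.consRank (L.countP (· < a)) π) := by
              rw [← hcons]
              exact (hA (a :: L) (fun x => (a :: L).countP (· < x))
                fun x hx y _ hxy => List.countP_lt_strictMono hx hxy).mpr hr.1
            exact ⟨⟨⟨⟨_, hv⟩, hAv⟩, ⟨(q, a :: L), hcons, hr.2⟩⟩, rfl⟩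
      refine ⟨Finite.of_surjective F hbij.2, ?_⟩
      rw [← Nat.card_congr (Equiv.ofBijective F hbij), Nat.card_sigma]
      simp only [pathCount]
      rw [← Finset.sum_filter, Finset.sum_congr rfl fun v _ => (hih v).2]
      refine Finset.sum_bij (fun v _ => v.1.1) ?_ ?_ ?_ ?_
      · intro v _
        exact Finset.mem_filter.mpr ⟨Finset.mem_range.mpr v.1.2, v.2⟩
      · intro v _ v' _ h
        exact Subtype.ext (Fin.ext h)
      · intro v hv
        obtain ⟨h1, h2⟩ := Finset.mem_filter.mp hv
        exact ⟨⟨⟨v, Finset.mem_range.mp h1⟩, h2⟩, Finset.mem_univ _, rfl⟩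
      · intro v _
        rfl
    | false =>
      cases rows with
      | nil => simp at hlen
      | cons r rows =>
        have hlen' : p.count false = rows.length := by simpa using hlen
        have hnd : (r :: rows).Nodup := hrows.imp fun h => h.ne
        have hmin : ∀ q L, ReadsTo A (false :: p) (r :: rows) q L → ∀ x ∈ L, r ≤ x := by
          intro q L h x hx
          rcases List.mem_cons.mp (h.perm.mem_iff.mp (List.mem_append_right q hx)) with rfl | h'
          · exact le_rfl
          · exact ((List.pairwise_cons.mp hrows).1 x h').le
        by_cases h0 : 0 ∈ π
        · have hih := ih rows π.eraseMin (List.pairwise_cons.mp hrows).2 hlen'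
            (List.eraseMin_perm_range hπ h0)
          have hπnd : π.Nodup := hπ.nodup_iff.mpr List.nodup_range
          let F : {x : List ℕ × List ℕ // x.2.standardize = π ∧
              ReadsTo A (false :: p) (r :: rows) x.1 x.2} →
              {x : List ℕ × List ℕ // x.2.standardize = π.eraseMin ∧
                ReadsTo A p rows x.1 x.2} :=
            fun x => ⟨(x.1.1, x.1.2.erase r), by
              rw [List.standardize_erase (List.nodup_append.mp (x.2.2.nodup hnd)).2.1 x.2.2.1
                (hmin _ _ x.2.2), x.2.1], x.2.2.2⟩
          have hbij : Function.Bijective F := by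
            constructor
            · rintro ⟨⟨q, L⟩, hst, hr⟩ ⟨⟨q', L'⟩, hst', hr'⟩ h
              have h1 := congrArg Subtype.val h
              simp only [F, Prod.mk.injEq] at h1
              simp only at hst hst' hr hr'
              have h2 : L.idxOf r = L'.idxOf r := by
                rw [← List.idxOf_zero_standardize hr.1 (hmin _ _ hr),
                  ← List.idxOf_zero_standardize hr'.1 (hmin _ _ hr'), hst, hst']
              have h3 : L = L' := by
                rw [← List.eq_insertIdx_erase hr.1, ← List.eq_insertIdx_erase hr'.1, h1.2, h2]
              exact Subtype.ext (Prod.ext h1.1 h3)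
            · rintro ⟨⟨q, L⟩, hst, hr⟩
              simp only at hst hr
              have hrL : r ∉ L := fun h =>
                (List.nodup_cons.mp hnd).1 (hr.perm.mem_iff.mp (List.mem_append_right q h))
              have hlenL : π.idxOf 0 ≤ L.length := by
                rw [← List.length_standardize, hst, List.length_eraseMin h0]
                have := List.idxOf_lt_length_iff.mpr h0
                omega
              set L' := L.insertIdx (π.idxOf 0) r with hL'
              have hmem : r ∈ L' := (List.mem_insertIdx hlenL).mpr (Or.inl rfl)
              have hidx : L'.idxOf r = π.idxOf 0 ∧ L'.erase r = L :=
                List.idxOf_and_erase_insertIdx hrL hlenL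
              have hreads : ReadsTo A (false :: p) (r :: rows) q L' :=
                ⟨hmem, by rw [hidx.2]; exact hr⟩
              have hnd' := (List.nodup_append.mp (hreads.nodup hnd)).2.1
              have hst' : L'.standardize = π := by
                refine List.eq_of_eraseMin_eq
                  ((List.standardize_perm_range hnd').nodup_iff.mpr List.nodup_range) hπnd
                  (List.zero_mem_standardize hmem (hmin _ _ hreads)) h0 ?_ ?_
                · rw [← List.standardize_erase hnd' hmem (hmin _ _ hreads), hidx.2, hst]
                · rw [List.idxOf_zero_standardize hmem (hmin _ _ hreads), hidx.1]
              exact ⟨⟨(q, L'), hst', hreads⟩, Subtype.ext (Prod.ext rfl hidx.2)⟩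
          have := hih.1
          refine ⟨Finite.of_injective F hbij.1, ?_⟩
          rw [Nat.card_congr (Equiv.ofBijective F hbij), hih.2]
          simp only [pathCount, h0, if_true]
        · have hemp : IsEmpty {x : List ℕ × List ℕ // x.2.standardize = π ∧
              ReadsTo A (false :: p) (r :: rows) x.1 x.2} := by
            refine ⟨fun ⟨⟨q, L⟩, hst, hr⟩ => h0 ?_⟩
            simp only at hst hr
            rw [← hst]
            exact List.zero_mem_standardize hr.1 (hmin _ _ hr)
          refine ⟨inferInstance, ?_⟩
          rw [Nat.card_of_isEmpty]
          simp only [pathCount, h0, if_false]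

end ReadsTo

/-! ### The boundary path of a board -/

open Classical in
/-- The boundary of the board `D` inside the rectangle with columns `x₀, …, x₀ + x - 1` and rows
`y, …, y + k - 1`, walked from its lower right to its upper left corner: `true` is a step to the
left, `false` a step up. -/
noncomputable def boundary (D : ℕ → ℕ → Prop) : ℕ → ℕ → ℕ → ℕ → List Bool
  | _, 0, _, k => List.replicate k false
  | _, x + 1, _, 0 => List.replicate (x + 1) true
  | x₀, x + 1, y, k + 1 =>
    if D (x₀ + x) y then true :: boundary D x₀ x y (k + 1)
    else false :: boundary D x₀ (x + 1) (y + 1) k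
termination_by _ x _ k => x + k

theorem count_false_boundary (D : ℕ → ℕ → Prop) (x₀ x y k : ℕ) :
    (boundary D x₀ x y k).count false = k := by
  induction x₀, x, y, k using boundary.induct D with
  | case1 => simp [boundary]
  | case2 => simp [boundary, List.count_replicate]
  | case3 x₀ x y k h ih => rw [boundary, if_pos h]; simpa using ih
  | case4 x₀ x y k h ih => rw [boundary, if_neg h]; simpa using ih

/-- The last step of the boundary, seen from the upper left corner of the rectangle. -/
theorem boundary_eq_append {D : ℕ → ℕ → Prop} (hD : VincularPattern.IsBoard D)
    (x₀ x y k : ℕ) :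
    (D x₀ (y + k) → boundary D x₀ (x + 1) y (k + 1) = boundary D x₀ (x + 1) y k ++ [false]) ∧
    (¬ D x₀ (y + k) →
      boundary D x₀ (x + 1) y (k + 1) = boundary D (x₀ + 1) x y (k + 1) ++ [true]) := by
  induction hs : x + k using Nat.strong_induction_on generalizing x y k with
  | _ s ih =>
    subst hs
    constructor
    · intro hc
      rw [boundary]
      split_ifs with h
      · cases x with
        | zero =>
          cases k with
          | zero => simp [boundary]
          | succ k =>
            rw [boundary, boundary, if_pos h, boundary, List.replicate_succ' (n := k + 1)]
            simp
        | succ x =>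
          rw [(ih (x + k) (by omega) x y k rfl).1 hc]
          cases k with
          | zero => simp [boundary, List.replicate_succ]
          | succ k =>
            conv_rhs => rw [boundary, if_pos h]
            simp
      · cases k with
        | zero => exact absurd (hD (by omega) le_rfl hc) h
        | succ k =>
          rw [(ih (x + k) (by omega) x (y + 1) k rfl).1
            (by rwa [show y + 1 + k = y + (k + 1) by omega])]
          conv_rhs => rw [boundary, if_neg h]
          simp
    · intro hc
      rw [boundary]
      split_ifs with h
      · cases x with
        | zero => exact absurd (hD le_rfl (by omega) h) hc
        | succ x =>
          rw [(ih (x + k) (by omega) x y k rfl).2 hc]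
          conv_rhs => rw [boundary, if_pos (by rwa [show x₀ + 1 + x = x₀ + (x + 1) by omega])]
          simp
      · cases k with
        | zero =>
          cases x with
          | zero => simp [boundary]
          | succ x =>
            conv_rhs => rw [boundary, if_neg (by rwa [show x₀ + 1 + x = x₀ + (x + 1) by omega])]
            simp only [boundary]
            rw [List.replicate_succ']
            simp
        | succ k =>
          rw [(ih (x + k) (by omega) x (y + 1) k rfl).2
            (by rwa [show y + 1 + k = y + (k + 1) by omega])]
          cases x with
          | zero => simp [boundary, List.replicate_succ]
          | succ x =>
            conv_rhs => rw [boundary, if_neg (by rwa [show x₀ + 1 + x = x₀ + (x + 1) by omega])]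
            simp

/-- Walk a path backwards and exchange the two kinds of steps. -/
def List.transposePath (p : List Bool) : List Bool := (p.map not).reverse

/-- The transposed board has the transposed boundary. -/
theorem boundary_transpose {D : ℕ → ℕ → Prop} (hD : VincularPattern.IsBoard D) (x₀ x y k : ℕ) :
    boundary (fun a b => D b a) y k x₀ x = (boundary D x₀ x y k).transposePath := by
  induction hs : x + k using Nat.strong_induction_on generalizing x₀ x y k with
  | _ s ih =>
    subst hs
    cases x with
    | zero =>
      cases k with
      | zero => simp [boundary, List.transposePath]
      | succ k => simp [boundary, List.transposePath]
    | succ x =>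
      cases k with
      | zero => simp [boundary, List.transposePath]
      | succ k =>
        rw [boundary]
        split_ifs with h
        · rw [(boundary_eq_append hD x₀ x y k).1 h, ih (x + 1 + k) (by omega) x₀ (x + 1) y k rfl]
          simp [List.transposePath]
        · rw [(boundary_eq_append hD x₀ x y k).2 h,
            ih (x + (k + 1)) (by omega) (x₀ + 1) x y (k + 1) rfl]
          simp [List.transposePath]

theorem List.erase_filter_le {V : List ℕ} (hV : V.Nodup) (y : ℕ) :
    (V.filter (y ≤ ·)).erase y = V.filter (y + 1 ≤ ·) := by
  rw [(hV.filter _).erase_eq_filter, List.filter_filter]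
  refine List.filter_congr fun x _ => ?_
  rw [Bool.eq_iff_iff]
  simp
  omega

open Classical in
/-- Reading a permutation `V` along the boundary of a board succeeds if and only if `V` is a
placement on the board and, for each column, the part of `V` that lies in the board rectangle
with this first column has property `A`. -/
theorem readsTo_boundary_iff {A : List ℕ → Prop} {D : ℕ → ℕ → Prop}
    (hD : VincularPattern.IsBoard D) {m : ℕ} {V : List ℕ} (hV : V.Perm (List.range m))
    (x y k : ℕ) (hx : x ≤ V.length) (hyk : y + k = m) (hout : ∀ c < x, ∀ v < y, ¬ D c v) :
    ReadsTo A (boundary D 0 x y k) (List.range' y k) (V.take x).reverse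
        ((V.drop x).filter (y ≤ ·)) ↔
      ∀ c (hc : c < V.length), c < x →
        D c V[c] ∧ A (V[c] :: (V.drop (c + 1)).filter (D c ·)) := by
  have hnd : V.Nodup := hV.nodup_iff.mpr List.nodup_range
  have hVm : ∀ v, v ∈ V ↔ v < m := fun v => by rw [hV.mem_iff, List.mem_range]
  induction hs : x + k using Nat.strong_induction_on generalizing x y k with
  | _ s ih =>
    subst hs
    cases x with
    | zero =>
      refine iff_of_true ?_ (fun c _ h => absurd h (Nat.not_lt_zero c))
      clear ih hout
      induction k generalizing y with
      | zero =>
        simp only [boundary, List.replicate_zero]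
        refine ⟨rfl, rfl, ?_⟩
        rw [List.filter_eq_nil_iff]
        intro v hv
        have := (hVm v).mp hv
        simp
        omega
      | succ k ihk =>
        simp only [boundary, List.drop_zero] at ihk ⊢
        refine ⟨?_, ?_⟩
        · exact List.mem_filter.mpr ⟨(hVm y).mpr (by omega), by simp⟩
        · rw [List.erase_filter_le hnd]
          exact ihk (y + 1) (by omega)
    | succ x =>
      have hsplit : (V.take (x + 1)).reverse = V[x] :: (V.take x).reverse := by
        rw [List.take_succ_eq_append_getElem (by omega)]
        simp
      have hmem : V[x] ∈ V := List.getElem_mem _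
      cases k with
      | zero =>
        refine iff_of_false (fun h => ?_) (fun h => ?_)
        · have h1 := h.perm.length_eq
          rw [hsplit] at h1
          simp at h1
        · have := (hVm _).mp hmem
          exact hout x (Nat.lt_succ_self x) _ (by omega) (h x (by omega) (Nat.lt_succ_self x)).1
      | succ k =>
        rw [boundary]
        simp only [Nat.zero_add]
        split_ifs with h
        · rw [hsplit]
          have hrow : ∀ v, D x v ↔ y ≤ v := fun v =>
            ⟨fun hv => not_lt.mp fun hlt => hout x (Nat.lt_succ_self x) v hlt hv,
              fun hv => hD le_rfl hv h⟩
          have hrow' : (V.drop (x + 1)).filter (y ≤ ·) = (V.drop (x + 1)).filter (D x ·) :=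
            List.filter_congr fun v _ => by simp [hrow]
          have hih := ih (x + (k + 1)) (by omega) x y (k + 1) (by omega) hyk
            (fun c hc v hv hcv => hout x (Nat.lt_succ_self x) v hv (hD hc.le le_rfl hcv)) rfl
          have hdrop : y ≤ V[x] → (V.drop x).filter (y ≤ ·) =
              V[x] :: (V.drop (x + 1)).filter (y ≤ ·) := fun hy => by
            rw [List.drop_eq_getElem_cons (by omega), List.filter_cons_of_pos (by simpa using hy)]
          have hsuc : (∀ c (hc : c < V.length), c < x + 1 →
              D c V[c] ∧ A (V[c] :: (V.drop (c + 1)).filter (D c ·))) ↔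
              (D x V[x] ∧ A (V[x] :: (V.drop (x + 1)).filter (D x ·))) ∧
              ∀ c (hc : c < V.length), c < x →
                D c V[c] ∧ A (V[c] :: (V.drop (c + 1)).filter (D c ·)) := by
            constructor
            · intro hall
              exact ⟨hall x (by omega) (Nat.lt_succ_self x),
                fun c hc hcx => hall c hc (by omega)⟩
            · rintro ⟨h1, h2⟩ c hc hcx
              rcases Nat.lt_succ_iff_lt_or_eq.mp hcx with h3 | rfl
              · exact h2 c hc h3
              · exact h1
          rw [hsuc]
          constructor
          · rintro ⟨h1, h2⟩
            have hy : y ≤ V[x] := by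
              have := h2.perm.mem_iff.mp
                (List.mem_append_right _ (List.mem_cons_self (a := V[x])))
              rw [List.mem_range'_1] at this
              exact this.1
            rw [← hdrop hy] at h2
            exact ⟨⟨(hrow _).mpr hy, hrow' ▸ h1⟩, hih.mp h2⟩
          · rintro ⟨⟨h1, h2⟩, h3⟩
            refine ⟨hrow' ▸ h2, ?_⟩
            rw [← hdrop ((hrow _).mp h1)]
            exact hih.mpr h3
        · have hih := ih (x + 1 + k) (by omega) (x + 1) (y + 1) k (by omega) (by omega)
            (fun c hc v hv hcv => by
              rcases Nat.lt_succ_iff_lt_or_eq.mp hv with h1 | rfl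
              · exact hout c hc v h1 hcv
              · exact h (hD (by omega) le_rfl hcv)) rfl
          refine Iff.trans ?_ hih
          have hE : ReadsTo A (false :: boundary D 0 (x + 1) (y + 1) k) (List.range' y (k + 1))
              (V.take (x + 1)).reverse ((V.drop (x + 1)).filter (y ≤ ·)) ↔
              y ∈ (V.drop (x + 1)).filter (y ≤ ·) ∧
              ReadsTo A (boundary D 0 (x + 1) (y + 1) k) (List.range' (y + 1) k)
              (V.take (x + 1)).reverse ((V.drop (x + 1)).filter (y + 1 ≤ ·)) := by
            rw [← List.erase_filter_le (hnd.sublist (List.drop_sublist _ _))]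
            rfl
          rw [hE]
          refine and_iff_right_of_imp fun hr => ?_
          replace hr := hih.mp hr
          have hyV : y ∈ V := (hVm y).mpr (by omega)
          rw [← List.take_append_drop (x + 1) V, List.mem_append] at hyV
          rcases hyV with hy | hy
          · exfalso
            obtain ⟨c, hc, hcy⟩ := List.mem_take_iff_getElem.mp hy
            have hc' : c < x + 1 ∧ c < V.length := by omega
            have := (hr c hc'.2 hc'.1).1
            rw [hcy] at this
            exact h (hD (by omega) le_rfl this)
          · exact List.mem_filter.mpr ⟨hy, by simp⟩

namespace VincularPattern

/-- The word `l` is order-isomorphic to the word of `σ`. -/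
def IsOccurrence (σ : VincularPattern) (l : List ℕ) : Prop :=
  ∃ h : Fin σ.k → ℕ, l = List.ofFn h ∧ ∀ a b, h a ≤ h b ↔ σ.σ a ≤ σ.σ b

/-- The word `L` avoids `σ`, regarded as a pattern without adjacencies. -/
def WordAvoids (σ : VincularPattern) (L : List ℕ) : Prop :=
  ∀ l, l.Sublist L → ¬ σ.IsOccurrence l

theorem isOrderInvariant_wordAvoids (σ : VincularPattern) : IsOrderInvariant σ.WordAvoids := by
  intro L f hf
  have hle : ∀ x ∈ L, ∀ y ∈ L, f x ≤ f y ↔ x ≤ y := fun x hx y hy => by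
    constructor
    · intro h
      by_contra hxy
      exact absurd (hf y hy x hx (not_le.mp hxy)) (not_lt.mpr h)
    · intro h
      rcases h.eq_or_lt with rfl | h
      · exact le_rfl
      · exact (hf x hx y hy h).le
  constructor
  · rintro h l hl ⟨g, rfl, hg⟩
    refine h _ (hl.map f) ⟨f ∘ g, List.map_ofFn, fun a b => ?_⟩
    rw [← hg]
    exact hle _ (hl.subset (List.mem_ofFn.mpr ⟨a, rfl⟩)) _ (hl.subset (List.mem_ofFn.mpr ⟨b, rfl⟩))
  · rintro h l hl ⟨g, rfl, hg⟩
    obtain ⟨l', hl', hll⟩ := List.sublist_map_iff.mp hl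
    have hlen : l'.length = σ.k := by simpa using (congrArg List.length hll).symm
    have hget : ∀ a : Fin σ.k, g a = f (l'[(a : ℕ)]) := fun a => by
      have h1 : (List.ofFn g)[(a : ℕ)]'(by simp) = g a := by simp
      rw [← h1]
      simp only [hll, List.getElem_map]
    refine h l' hl' ⟨fun a => l'[(a : ℕ)], ?_, fun a b => ?_⟩
    · refine List.ext_getElem (by simp [hlen]) fun i h1 h2 => by simp
    · rw [← hg, hget, hget, hle _ (hl'.subset (List.getElem_mem _)) _
        (hl'.subset (List.getElem_mem _))]

open Classical in
/-- A copy lies in the board with its bounding rectangle if and only if all of its letters lie in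
the board at the first position of the copy. Hence the condition may be checked column by column. -/
theorem forall_wordAvoids_iff {σ : VincularPattern} (hk : 0 < σ.k) (hX : σ.X = ∅) {m : ℕ}
    {D : ℕ → ℕ → Prop} (hD : IsBoard D) (w : Equiv.Perm (Fin m)) (V : List ℕ)
    (hV : V = List.ofFn fun i => (w i : ℕ)) :
    (∀ c (hc : c < V.length), c < m →
      D c V[c] ∧ σ.WordAvoids (V[c] :: (V.drop (c + 1)).filter (D c ·))) ↔
    (∀ i : Fin m, D i (w i)) ∧ ¬ ∃ g, σ.IsCopy w g ∧ ∀ j j', D (g j) (w (g j')) := by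
  have hlen : V.length = m := by simp [hV]
  have hget : ∀ (c : Fin m) (hc : (c : ℕ) < V.length), V[(c : ℕ)] = w c := fun c hc => by
    simp [hV]
  let Q : Fin m → List (Fin m) := fun c =>
    c :: ((List.finRange m).drop (c + 1)).filter fun i => D c (w i)
  have hQ : ∀ (c : Fin m) (hc : (c : ℕ) < V.length),
      V[(c : ℕ)] :: (V.drop (c + 1)).filter (D c ·) = (Q c).map fun i => (w i : ℕ) := by
    intro c hc
    rw [hget, List.map_cons, hV, List.ofFn_eq_map, ← List.map_drop, List.filter_map]
    rfl
  have hdrop : ∀ c : Fin m, c :: (List.finRange m).drop (c + 1) = (List.finRange m).drop c :=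
    fun c => by rw [List.drop_eq_getElem_cons (i := (c : ℕ)) (by simp)]; simp
  have hQsort : ∀ c, (Q c).Pairwise (· < ·) := fun c =>
    (List.pairwise_lt_finRange m).sublist
      ((List.filter_sublist.cons_cons c).trans (hdrop c ▸ List.drop_sublist _ _))
  have hQmem : ∀ c i, i ∈ Q c ↔ i = c ∨ (c < i ∧ D c (w i)) := by
    intro c i
    rw [List.mem_cons, List.mem_filter, List.mem_drop_iff_getElem]
    simp only [List.getElem_finRange, decide_eq_true_eq]
    refine or_congr_right (and_congr_left fun _ => ⟨?_, fun h => ?_⟩)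
    · rintro ⟨j, hj, rfl⟩
      show (c : ℕ) < _
      simp
      omega
    · have h' : (c : ℕ) < i := h
      exact ⟨i - (c + 1), by simp; omega, Fin.ext (by simp; omega)⟩
  constructor
  · intro h
    have hplace : ∀ i : Fin m, D i (w i) := fun i => by
      have := (h i (by omega) i.2).1
      rwa [hget i] at this
    refine ⟨hplace, ?_⟩
    rintro ⟨g, hg, hd⟩
    let z : Fin σ.k := ⟨0, hk⟩
    have hav := (h (g z) (by omega) (g z).2).2
    rw [hQ] at hav
    refine hav (List.ofFn fun j => (w (g j) : ℕ)) ?_ ⟨fun j => (w (g j) : ℕ), rfl, hg.2.1⟩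
    have hsub : (List.ofFn g).Sublist (Q (g z)) := by
      have hgs : (List.ofFn g).Pairwise (· < ·) := by
        rw [List.pairwise_ofFn]
        intro i j hij
        exact hg.1 hij
      refine List.sublist_of_subperm_of_pairwise
        (List.Nodup.subperm (hgs.imp fun h => h.ne) fun i hi => ?_) hgs (hQsort _)
      obtain ⟨j, rfl⟩ := List.mem_ofFn.mp hi
      rw [hQmem]
      rcases eq_or_ne j z with rfl | hj
      · exact Or.inl rfl
      · refine Or.inr ⟨hg.1 ?_, hd _ _⟩
        have : (j : ℕ) ≠ 0 := fun h => hj (Fin.ext h)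
        show 0 < (j : ℕ)
        omega
    have := hsub.map fun i => (w i : ℕ)
    rwa [List.map_ofFn] at this
  · rintro ⟨hplace, hno⟩ c hc hcm
    lift c to Fin m using hcm
    refine ⟨by rw [hget]; exact hplace c, ?_⟩
    rw [hQ]
    rintro l hl ⟨h, rfl, ho⟩
    obtain ⟨G, hG, hGl⟩ := List.sublist_map_iff.mp hl
    have hGlen : G.length = σ.k := by simpa using (congrArg List.length hGl).symm
    have hw : ∀ a : Fin σ.k, h a = w (G[(a : ℕ)]) := fun a => by
      have h1 : (List.ofFn h)[(a : ℕ)]'(by simp) = h a := by simp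
      rw [← h1]
      simp only [hGl, List.getElem_map]
    refine hno ⟨fun a => G[(a : ℕ)], (isCopy_iff_of_X_eq_empty hX).mpr ⟨?_, ?_⟩, ?_⟩
    · intro a b hab
      exact List.pairwise_iff_getElem.mp ((hQsort c).sublist hG) _ _ _ _ hab
    · intro a b
      rw [← ho, hw, hw]
      exact Iff.rfl
    · intro j j'
      have h1 := (hQmem c _).mp (hG.subset (List.getElem_mem (l := G) (n := j) (by omega)))
      have h2 := (hQmem c _).mp (hG.subset (List.getElem_mem (l := G) (n := j') (by omega)))
      refine hD (x := c) (y := w (G[(j' : ℕ)])) ?_ le_rfl ?_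
      · rcases h1 with h1 | h1
        · exact (congrArg Fin.val h1).ge
        · exact h1.1.le
      · rcases h2 with h2 | h2
        · rw [h2]; exact hplace c
        · exact h2.2

/-- The number of placements on a board that avoid a pattern without adjacencies, computed along
the boundary of the board. -/
theorem boardCount_eq_pathCount {σ : VincularPattern} (hk : 0 < σ.k) (hX : σ.X = ∅) {m : ℕ}
    {D : ℕ → ℕ → Prop} (hD : IsBoard D) :
    boardCount σ m D = pathCount σ.WordAvoids (boundary D 0 m 0 m) [] := by
  classical
  rw [← (ReadsTo.finite_and_card (isOrderInvariant_wordAvoids σ) (boundary D 0 m 0 m)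
    (List.range' 0 m) [] (List.pairwise_lt_range' ..) (by simp [count_false_boundary])
    (by simp)).2]
  have hiff : ∀ w : Equiv.Perm (Fin m), ReadsTo σ.WordAvoids (boundary D 0 m 0 m)
      (List.range' 0 m) (List.ofFn fun i => (w i : ℕ)).reverse [] ↔
      (∀ i : Fin m, D i (w i)) ∧ ¬ ∃ g, σ.IsCopy w g ∧ ∀ j j', D (g j) (w (g j')) := by
    intro w
    have hnd : (List.ofFn fun i => (w i : ℕ)).Nodup := by
      rw [List.nodup_ofFn]
      exact Fin.val_injective.comp w.injective
    have hperm : (List.ofFn fun i => (w i : ℕ)).Perm (List.range m) := by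
      refine (hnd.subperm fun x hx => ?_).perm_of_length_le (by simp)
      obtain ⟨i, rfl⟩ := List.mem_ofFn.mp hx
      exact List.mem_range.mpr (w i).2
    rw [← forall_wordAvoids_iff hk hX hD w _ rfl,
      ← readsTo_boundary_iff hD hperm m 0 m (by simp) (by omega) (by simp)]
    have h1 : (List.ofFn fun i => (w i : ℕ)).take m = List.ofFn fun i => (w i : ℕ) :=
      List.take_of_length_le (by simp)
    have h2 : (List.ofFn fun i => (w i : ℕ)).drop m = [] :=
      List.drop_of_length_le (by simp)
    rw [h1, h2]
    rfl
  refine Nat.card_congr (Equiv.ofBijective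
    (fun w => ⟨((List.ofFn fun i => (w.1 i : ℕ)).reverse, []), rfl, (hiff w.1).mpr w.2⟩) ⟨?_, ?_⟩)
  · rintro ⟨w, hw⟩ ⟨w', hw'⟩ h
    have h1 := congrArg (fun x => x.1.1.reverse) h
    simp only [List.reverse_reverse] at h1
    have h2 := List.ofFn_injective h1
    exact Subtype.ext (Equiv.ext fun i => Fin.ext (congrFun h2 i))
  · rintro ⟨⟨q, L⟩, hst, hr⟩
    have hL : L = [] := by
      have := congrArg List.length hst
      simpa using this
    subst hL
    have hp := hr.perm
    simp only [List.append_nil] at hp hr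
    have hqlen : q.reverse.length = m := by simpa using hp.length_eq
    have hqm : ∀ x ∈ q.reverse, x < m := fun x hx => by
      have := hp.mem_iff.mp (List.mem_reverse.mp hx)
      rw [List.mem_range'_1] at this
      omega
    have hqnd : q.reverse.Nodup := List.nodup_reverse.mpr (hp.nodup_iff.mpr List.nodup_range')
    let f : Fin m → Fin m := fun i => ⟨q.reverse[(i : ℕ)], hqm _ (List.getElem_mem _)⟩
    have hf : Function.Injective f := fun i j hij =>
      Fin.ext ((List.Nodup.getElem_inj_iff hqnd).mp (congrArg Fin.val hij))
    let w : Equiv.Perm (Fin m) := Equiv.ofBijective f (Finite.injective_iff_bijective.mp hf)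
    have hwq : (List.ofFn fun i => (w i : ℕ)) = q.reverse :=
      List.ext_getElem (by simp [hqlen]) fun i h1 h2 => by simp [w, f]
    have hwq' : (List.ofFn fun i => (w i : ℕ)).reverse = q := by rw [hwq, List.reverse_reverse]
    exact ⟨⟨w, (hiff w).mp (by rw [hwq']; exact hr)⟩, Subtype.ext (Prod.ext hwq' rfl)⟩

end VincularPattern

/-! ### Counting paths with stacks of flags -/

/-- The number of ways to go along a path when the state is a list: a step `true` replaces the
state `c` by a member of `E c`, a step `false` deletes the head, and the final state is weighted
by `φ`. -/
def stackRun (E : List Bool → List (List Bool)) : List Bool → (List Bool → ℕ) → List Bool → ℕ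
  | [], φ, c => φ c
  | true :: p, φ, c => ((E c).map (stackRun E p φ)).sum
  | false :: _, _, [] => 0
  | false :: p, φ, _ :: c => stackRun E p φ c

/-- The weight that requires the state to be empty at the end. -/
def emptyWeight (c : List Bool) : ℕ := if c = [] then 1 else 0

/-- The number of ways to go along a path when the state is a threshold `t` for words of
length `m`. -/
def thresholdCount : List Bool → ℕ → ℕ → ℕ
  | [], _, m => if m = 0 then 1 else 0
  | true :: p, t, m => ∑ t' ∈ Finset.Icc t m, thresholdCount p t' (m + 1)
  | false :: _, _, 0 => 0
  | false :: p, t, m + 1 => thresholdCount p (t - 1) m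

/-- The steps for the pattern `321` that do not put the new letter at the bottom. -/
def stepsPlus321 : List Bool → List (List Bool)
  | [] => []
  | [true] => [[true, true]]
  | true :: a :: c => [true :: false :: a :: c]
  | false :: c => (true :: false :: c) :: (stepsPlus321 c).map (List.cons false)

/-- The steps for the pattern `321`: the flags tell for each value `s` of the current word
whether `s` fails to precede `s + 1`. -/
def steps321 : List Bool → List (List Bool)
  | [] => [[true]]
  | a :: c => (false :: a :: c) :: stepsPlus321 (a :: c)

/-! ### Ballot words -/

/-- The sum of `φ` over the ballot words of length `n` with `b` letters `true`: in every suffix at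
most half of the letters are `true`. They encode standard Young tableaux with two rows. -/
def ballotSum : ℕ → ℕ → (List Bool → ℕ) → ℕ
  | 0, 0, φ => φ []
  | 0, _ + 1, _ => 0
  | n + 1, 0, φ => ballotSum n 0 fun T => φ (false :: T)
  | n + 1, b + 1, φ =>
    if 2 * (b + 1) ≤ n + 1 then
      ballotSum n (b + 1) (fun T => φ (false :: T)) + ballotSum n b fun T => φ (true :: T)
    else 0

theorem ballotSum_succ_zero (n : ℕ) (φ : List Bool → ℕ) :
    ballotSum (n + 1) 0 φ = ballotSum n 0 fun T => φ (false :: T) := rfl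

theorem ballotSum_succ_succ {n b : ℕ} (h : 2 * (b + 1) ≤ n + 1) (φ : List Bool → ℕ) :
    ballotSum (n + 1) (b + 1) φ =
      ballotSum n (b + 1) (fun T => φ (false :: T)) + ballotSum n b fun T => φ (true :: T) :=
  if_pos h

theorem ballotSum_congr {n b : ℕ} {φ ψ : List Bool → ℕ}
    (h : ∀ T : List Bool, T.length = n → T.count true = b → φ T = ψ T) :
    ballotSum n b φ = ballotSum n b ψ := by
  induction n generalizing b φ ψ with
  | zero =>
    cases b with
    | zero => exact h [] rfl rfl
    | succ b => rfl
  | succ n ih =>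
    cases b with
    | zero => exact ih fun T h1 h2 => h _ (by simp [h1]) (by simp [h2])
    | succ b =>
      simp only [ballotSum]
      rw [ih (b := b + 1) fun T h1 h2 => h (false :: T) (by simp [h1]) (by simp [h2]),
        ih (b := b) fun T h1 h2 => h (true :: T) (by simp [h1]) (by simp [h2])]

theorem ballotSum_add (n b : ℕ) (φ ψ : List Bool → ℕ) :
    (ballotSum n b fun T => φ T + ψ T) = ballotSum n b φ + ballotSum n b ψ := by
  induction n generalizing b φ ψ with
  | zero => cases b <;> rfl
  | succ n ih =>
    cases b with
    | zero => simp only [ballotSum, ih]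
    | succ b =>
      simp only [ballotSum, ih]
      split_ifs
      · omega
      · rfl

theorem ballotSum_eq_zero {n b : ℕ} (h : n < 2 * b) (φ : List Bool → ℕ) :
    ballotSum n b φ = 0 := by
  cases b with
  | zero => omega
  | succ b =>
    cases n with
    | zero => rfl
    | succ n => rw [ballotSum, if_neg (by omega)]

/-- The flags of a ballot word: `true` at the last letter and wherever `true` is followed by
`false`. -/
def ballotFlags : List Bool → List Bool
  | [] => []
  | [_] => [true]
  | a :: b :: T => (a && !b) :: ballotFlags (b :: T)

/-- Row insertion into a two-row tableau, except for the insertion of a new largest letter. -/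
def ballotInsert : List Bool → List (List Bool)
  | [] => []
  | [_] => [[true, false]]
  | false :: false :: T =>
    (true :: false :: false :: T) :: (ballotInsert (false :: T)).map (List.cons false)
  | false :: true :: T =>
    (true :: false :: true :: T) :: (ballotInsert (true :: T)).map (List.cons true)
  | true :: true :: T =>
    (true :: false :: true :: T) :: (ballotInsert (true :: T)).map (List.cons true)
  | true :: false :: T => [true :: false :: false :: T]

theorem exists_cons_of_mem_ballotInsert_true {T X : List Bool}
    (h : X ∈ ballotInsert (true :: T)) : ∃ Y, X = true :: Y := by
  match T with
  | [] => simp [ballotInsert] at h; exact ⟨_, h⟩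
  | true :: T =>
    simp only [ballotInsert, List.mem_cons, List.mem_map] at h
    rcases h with rfl | ⟨Y, _, rfl⟩ <;> exact ⟨_, rfl⟩
  | false :: T => simp [ballotInsert] at h; exact ⟨_, h⟩

theorem ne_nil_of_mem_ballotInsert {T X : List Bool} (h : X ∈ ballotInsert T) : X ≠ [] := by
  rintro rfl
  match T with
  | [] => simp [ballotInsert] at h
  | [_] => simp [ballotInsert] at h
  | false :: false :: T => simp [ballotInsert] at h
  | false :: true :: T => simp [ballotInsert] at h
  | true :: true :: T => simp [ballotInsert] at h
  | true :: false :: T => simp [ballotInsert] at h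

theorem ballotFlags_false_cons {X : List Bool} (h : X ≠ []) :
    ballotFlags (false :: X) = false :: ballotFlags X := by
  cases X with
  | nil => exact absurd rfl h
  | cons a X => simp [ballotFlags]

theorem ballotFlags_cons (a : Bool) (T : List Bool) :
    ∃ e, ballotFlags (a :: T) = e :: ballotFlags T := by
  cases T with
  | nil => exact ⟨true, rfl⟩
  | cons b T => exact ⟨_, rfl⟩

/-- Row insertion translates into the steps for the pattern `321`. -/
theorem stepsPlus321_ballotFlags (T : List Bool) :
    stepsPlus321 (ballotFlags T) = (ballotInsert T).map ballotFlags := by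
  induction T using ballotInsert.induct with
  | case1 => rfl
  | case2 => rfl
  | case3 T ih =>
    simp only [ballotFlags, ballotInsert, stepsPlus321, ih,
      List.map_cons, List.map_map, Bool.not_false, Bool.and_true]
    congr 1
    refine List.map_congr_left fun X hX => ?_
    rw [Function.comp_apply, Function.comp_apply,
      ballotFlags_false_cons (ne_nil_of_mem_ballotInsert hX)]
  | case4 T ih =>
    simp only [ballotFlags, ballotInsert, Bool.false_and, stepsPlus321, ih,
      List.map_cons, List.map_map, Bool.not_false, Bool.and_true]
    congr 1
    refine List.map_congr_left fun X hX => ?_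
    obtain ⟨Y, rfl⟩ := exists_cons_of_mem_ballotInsert_true hX
    simp [ballotFlags]
  | case5 T ih =>
    simp only [ballotFlags, ballotInsert, stepsPlus321, ih,
      List.map_cons, List.map_map, Bool.not_false, Bool.and_true, Bool.not_true, Bool.and_false]
    congr 1
    refine List.map_congr_left fun X hX => ?_
    obtain ⟨Y, rfl⟩ := exists_cons_of_mem_ballotInsert_true hX
    simp [ballotFlags]
  | case6 T =>
    obtain ⟨e, he⟩ := ballotFlags_cons false T
    simp [ballotFlags, ballotInsert, he, stepsPlus321]

theorem ballotSum_insert_true {n b : ℕ} (h : 2 * b ≤ n) (χ : List Bool → ℕ) :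
    (ballotSum n b fun T => ((ballotInsert (true :: T)).map χ).sum) =
      ballotSum (n + 1) b fun T => χ (true :: T) := by
  induction n generalizing b χ with
  | zero =>
    obtain rfl : b = 0 := by omega
    simp [ballotSum, ballotInsert]
  | succ n ih =>
    cases b with
    | zero => simp [ballotSum, ballotInsert]
    | succ b =>
      rw [ballotSum_succ_succ h, ballotSum_succ_succ (n := n + 1) (by omega),
        ballotSum_succ_succ h]
      simp only [ballotInsert, List.map_cons, List.map_nil, List.sum_cons, List.sum_nil,
        add_zero, List.map_map, Function.comp_def]
      rw [ballotSum_add, ih (b := b) (by omega) fun X => χ (true :: X)]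
      omega

theorem ballotSum_insert_false (n b : ℕ) (χ : List Bool → ℕ) :
    (ballotSum n b fun T => ((ballotInsert (false :: T)).map χ).sum) =
      ballotSum (n + 2) (b + 1) χ := by
  induction n generalizing b χ with
  | zero =>
    cases b with
    | zero => simp [ballotSum, ballotInsert]
    | succ b =>
      rw [ballotSum_eq_zero (by omega), ballotSum_eq_zero (by omega)]
  | succ n ih =>
    by_cases h : 2 * b ≤ n + 1
    swap
    · rw [ballotSum_eq_zero (by omega), ballotSum_eq_zero (by omega)]
    rw [ballotSum_succ_succ (n := n + 2) (by omega)]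
    cases b with
    | zero =>
      simp only [ballotSum_succ_zero, ballotInsert, List.map_cons, List.sum_cons, List.map_map,
        Function.comp_def]
      rw [ballotSum_add, ih 0 fun X => χ (false :: X), add_comm]
    | succ b =>
      rw [ballotSum_succ_succ h]
      simp only [ballotInsert, List.map_cons, List.sum_cons, List.map_map, Function.comp_def]
      rw [ballotSum_add, ballotSum_add, ih (b + 1) fun X => χ (false :: X),
        ballotSum_insert_true (by omega) fun X => χ (true :: X),
        ballotSum_succ_succ (n := n + 1) (b := b) (by omega), ballotSum_succ_succ h]
      omega

/-- Row insertion of a letter into all tableaux of a given shape produces once each tableau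
whose shape has one more box. -/
theorem ballotSum_steps321 {n b : ℕ} (h : 2 * b ≤ n) (ψ : List Bool → ℕ) :
    (ballotSum n b fun T => ((steps321 (ballotFlags T)).map ψ).sum) =
      ballotSum (n + 1) b (fun T => ψ (ballotFlags T)) +
        ballotSum (n + 1) (b + 1) fun T => ψ (ballotFlags T) := by
  cases n with
  | zero =>
    obtain rfl : b = 0 := by omega
    simp [ballotSum, ballotFlags, steps321]
  | succ n =>
    have hsplit : ∀ T : List Bool, T.length = n + 1 → ((steps321 (ballotFlags T)).map ψ).sum =
        ψ (ballotFlags (false :: T)) +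
          ((ballotInsert T).map fun X => ψ (ballotFlags X)).sum := by
      intro T hT
      cases T with
      | nil => simp at hT
      | cons a T =>
        obtain ⟨e, he⟩ := ballotFlags_cons a T
        rw [he, steps321, ← he, stepsPlus321_ballotFlags, ballotFlags_false_cons (by simp)]
        simp [Function.comp_def]
    rw [ballotSum_congr fun T hT _ => hsplit T hT, ballotSum_add]
    cases b with
    | zero =>
      rw [ballotSum_succ_zero n fun T => ((ballotInsert T).map fun X => ψ (ballotFlags X)).sum,
        ballotSum_insert_false n 0 fun X => ψ (ballotFlags X), ballotSum_succ_zero (n + 1)]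
    | succ b =>
      rw [ballotSum_succ_succ h fun T => ((ballotInsert T).map fun X => ψ (ballotFlags X)).sum,
        ballotSum_insert_false n (b + 1) fun X => ψ (ballotFlags X),
        ballotSum_insert_true (by omega) fun X => ψ (ballotFlags X),
        ballotSum_succ_succ (n := n + 1) (b := b) (by omega)]
      simp only [Nat.add_assoc, Nat.reduceAdd]
      omega

/-- The position of the first letter `true` from the end of a word, counted from the front and
from `1`; zero if there is none. -/
def ballotThreshold : List Bool → ℕ
  | [] => 0
  | a :: T => if 0 < ballotThreshold T then ballotThreshold T + 1 else if a then 1 else 0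

theorem ballotThreshold_eq_zero {T : List Bool} (h : T.count true = 0) :
    ballotThreshold T = 0 := by
  induction T with
  | nil => rfl
  | cons a T ih =>
    cases a with
    | true => simp at h
    | false => simp [ballotThreshold, ih (by simpa using h)]

theorem ballotThreshold_true_cons (T : List Bool) :
    ballotThreshold (true :: T) = ballotThreshold T + 1 := by
  rw [ballotThreshold]
  split_ifs <;> simp_all

theorem ballotThreshold_pos {T : List Bool} (h : 0 < T.count true) : 0 < ballotThreshold T := by
  induction T with
  | nil => simp at h
  | cons a T ih =>
    cases a with
    | true => rw [ballotThreshold_true_cons]; omega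
    | false =>
      have := ih (by simpa using h)
      rw [ballotThreshold, if_pos this]
      omega

theorem ballotThreshold_false_cons {T : List Bool} (h : 0 < T.count true) :
    ballotThreshold (false :: T) = ballotThreshold T + 1 := by
  rw [ballotThreshold, if_pos (ballotThreshold_pos h)]

theorem ballotThreshold_cons_sub_one (a : Bool) (T : List Bool) :
    ballotThreshold (a :: T) - 1 = ballotThreshold T := by
  rw [ballotThreshold]
  split_ifs <;> simp_all

theorem ballotSum_zero_const (n : ℕ) (φ : List Bool → ℕ) (k : ℕ)
    (h : ∀ T : List Bool, T.count true = 0 → φ T = k) : ballotSum n 0 φ = k := by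
  induction n generalizing φ with
  | zero => exact h [] rfl
  | succ n ih => exact ih _ fun T hT => h _ (by simpa using hT)

theorem sum_Icc_succ (s n : ℕ) (ψ : ℕ → ℕ) :
    ∑ t ∈ Finset.Icc (s + 1) (n + 1), ψ t = ∑ t ∈ Finset.Icc s n, ψ (t + 1) := by
  rw [← Finset.map_add_right_Icc, Finset.sum_map]
  rfl

theorem sum_Icc_eq_add {s n : ℕ} (h : s ≤ n) (ψ : ℕ → ℕ) :
    ∑ t ∈ Finset.Icc s n, ψ t = ψ s + ∑ t ∈ Finset.Icc (s + 1) n, ψ t := by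
  rw [Finset.Icc_add_one_left_eq_Ioc, Finset.Icc_eq_cons_Ioc h, Finset.sum_cons]

theorem ballotSum_one_threshold (n : ℕ) (ψ : ℕ → ℕ) :
    (ballotSum (n + 1) 1 fun T => ψ (ballotThreshold T)) = ∑ t ∈ Finset.Icc 1 n, ψ t := by
  induction n generalizing ψ with
  | zero => rfl
  | succ n ih =>
    rw [ballotSum_succ_succ (by omega), ballotSum_congr fun T _ h2 => by
        rw [ballotThreshold_false_cons (by omega)],
      ih fun t => ψ (t + 1), ballotSum_zero_const (n + 1) _ (ψ 1) fun T hT => by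
        rw [ballotThreshold_true_cons, ballotThreshold_eq_zero hT]]
    rw [sum_Icc_eq_add (s := 1) (n := n + 1) (by omega), sum_Icc_succ, add_comm]

/-- The threshold model has the same growth as the tableaux with two rows. -/
theorem ballotSum_steps_threshold {n b : ℕ} (h : 2 * b ≤ n) (ψ : ℕ → ℕ) :
    (ballotSum n b fun T => ∑ t ∈ Finset.Icc (ballotThreshold T) n, ψ t) =
      ballotSum (n + 1) b (fun T => ψ (ballotThreshold T)) +
        ballotSum (n + 1) (b + 1) fun T => ψ (ballotThreshold T) := by
  induction n generalizing b ψ with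
  | zero =>
    obtain rfl : b = 0 := by omega
    simp [ballotSum, ballotThreshold]
  | succ n ih =>
    cases b with
    | zero =>
      rw [ballotSum_one_threshold, ballotSum_zero_const (n + 1) _ (∑ t ∈ Finset.Icc 0 (n + 1), ψ t)
          fun T hT => by rw [ballotThreshold_eq_zero hT],
        ballotSum_zero_const (n + 1 + 1) _ (ψ 0) fun T hT => by rw [ballotThreshold_eq_zero hT],
        sum_Icc_eq_add (by omega)]
    | succ b =>
      have hf : ∀ m c, ∀ φ : ℕ → ℕ, (ballotSum m (c + 1) fun T =>
          φ (ballotThreshold (false :: T))) = ballotSum m (c + 1) fun T =>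
          φ (ballotThreshold T + 1) := fun m c φ => ballotSum_congr fun T _ h2 => by
        rw [ballotThreshold_false_cons (by omega)]
      rw [ballotSum_succ_succ h, ballotSum_succ_succ (n := n + 1) (b := b) (by omega),
        hf n b fun s => ∑ t ∈ Finset.Icc s (n + 1), ψ t, hf]
      simp only [ballotThreshold_true_cons, sum_Icc_succ]
      rw [ih (b := b) (by omega) fun t => ψ (t + 1)]
      by_cases h2 : 2 * (b + 1) ≤ n
      · rw [ih h2 fun t => ψ (t + 1), ballotSum_succ_succ (n := n + 1) (b := b + 1) (by omega), hf]
        simp only [ballotThreshold_true_cons]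
        omega
      · rw [ballotSum_eq_zero (by omega), ballotSum_eq_zero (n := n + 1 + 1) (b := b + 1 + 1)
          (by omega)]
        omega

theorem ballotSum_flags_eq_threshold (p : List Bool) (n b : ℕ) :
    (ballotSum n b fun T => stackRun steps321 p emptyWeight (ballotFlags T)) =
      ballotSum n b fun T => thresholdCount p (ballotThreshold T) n := by
  induction p generalizing n b with
  | nil =>
    refine ballotSum_congr fun T hT _ => ?_
    cases T with
    | nil =>
      subst hT
      rfl
    | cons a T =>
      obtain ⟨e, he⟩ := ballotFlags_cons a T
      have : n ≠ 0 := by rw [← hT]; simp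
      simp [stackRun, emptyWeight, he, thresholdCount, this]
  | cons a p ih =>
    cases a with
    | true =>
      by_cases h : 2 * b ≤ n
      · simp only [stackRun, thresholdCount]
        rw [ballotSum_steps321 h, ballotSum_steps_threshold h fun t => thresholdCount p t (n + 1),
          ih, ih]
      · rw [ballotSum_eq_zero (by omega), ballotSum_eq_zero (by omega)]
    | false =>
      have hrun : ∀ a T, stackRun steps321 (false :: p) emptyWeight (ballotFlags (a :: T)) =
          stackRun steps321 p emptyWeight (ballotFlags T) := fun a T => by
        obtain ⟨e, he⟩ := ballotFlags_cons a T
        rw [he]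
        rfl
      cases n with
      | zero => cases b <;> rfl
      | succ n =>
        cases b with
        | zero =>
          rw [ballotSum_succ_zero, ballotSum_succ_zero]
          simp only [hrun, thresholdCount, ballotThreshold_cons_sub_one, ih]
        | succ b =>
          by_cases h : 2 * (b + 1) ≤ n + 1
          · rw [ballotSum_succ_succ h, ballotSum_succ_succ h]
            simp only [hrun, thresholdCount, ballotThreshold_cons_sub_one, ih]
          · rw [ballotSum_eq_zero (by omega), ballotSum_eq_zero (by omega)]

/-- The growth rules of the pattern `321` and of the threshold model have the same number of
closed walks along every path. -/
theorem stackRun_steps321_eq_thresholdCount (p : List Bool) :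
    stackRun steps321 p emptyWeight [] = thresholdCount p 0 0 :=
  ballotSum_flags_eq_threshold p 0 0

/-! ### Reversal of paths for the pattern `312` -/

/-- All ways to change one letter `false` of the first block of flags into `true`; a block ends
with the letter `true`. -/
def flips : List Bool → List (List Bool)
  | [] => []
  | true :: _ => []
  | false :: c => (true :: c) :: (flips c).map (List.cons false)

/-- The steps for the pattern `312`: the flags tell for each value `s` of the current word
whether `s + 1` fails to precede `s`. -/
def steps312 : List Bool → List (List Bool)
  | [] => [[true]]
  | a :: c => (false :: a :: c) :: (true :: a :: c) :: (flips (a :: c)).map (List.cons false)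

/-- The sum of `φ` over all ways to change `s` letters `false` of the first block into `true`. -/
def flipSum : ℕ → List Bool → (List Bool → ℕ) → ℕ
  | 0, c, φ => φ c
  | _ + 1, [], _ => 0
  | _ + 1, true :: _, _ => 0
  | s + 1, false :: c, φ =>
    flipSum (s + 1) c (fun d => φ (false :: d)) + flipSum s c fun d => φ (true :: d)

theorem flipSum_zero_left (c : List Bool) (φ : List Bool → ℕ) : flipSum 0 c φ = φ c := by
  cases c <;> rfl

theorem flipSum_succ_false (s : ℕ) (c : List Bool) (φ : List Bool → ℕ) :
    flipSum (s + 1) (false :: c) φ =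
      flipSum (s + 1) c (fun d => φ (false :: d)) + flipSum s c fun d => φ (true :: d) := rfl

/-- The weight of a list after the deletion of its head. -/
def popWeight (φ : List Bool → ℕ) : List Bool → ℕ
  | [] => 0
  | _ :: c => φ c

theorem stackRun_false_cons (E : List Bool → List (List Bool)) (p : List Bool)
    (φ : List Bool → ℕ) : stackRun E (false :: p) φ = popWeight (stackRun E p φ) := by
  funext c
  cases c <;> rfl

theorem stackRun_append (E : List Bool → List (List Bool)) (p q : List Bool)
    (φ : List Bool → ℕ) : stackRun E (p ++ q) φ = stackRun E p (stackRun E q φ) := by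
  induction p with
  | nil => funext c; simp [stackRun]
  | cons a p ih =>
    cases a with
    | true => funext c; simp only [List.cons_append, stackRun, ih]
    | false => rw [List.cons_append, stackRun_false_cons, ih, stackRun_false_cons]

theorem flipSum_add (s : ℕ) (c : List Bool) (φ ψ : List Bool → ℕ) :
    (flipSum s c fun d => φ d + ψ d) = flipSum s c φ + flipSum s c ψ := by
  induction c generalizing s φ ψ with
  | nil => cases s <;> rfl
  | cons a c ih =>
    cases s with
    | zero => rfl
    | succ s =>
      cases a with
      | true => rfl
      | false =>
        simp only [flipSum, ih]
        omega

theorem flipSum_zero (s : ℕ) (c : List Bool) : (flipSum s c fun _ => 0) = 0 := by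
  induction c generalizing s with
  | nil => cases s <;> rfl
  | cons a c ih =>
    cases s with
    | zero => rfl
    | succ s =>
      cases a with
      | true => rfl
      | false => simp only [flipSum, ih]

theorem flipSum_list_sum {α : Type*} (s : ℕ) (c : List Bool) (l : List α)
    (φ : α → List Bool → ℕ) :
    (flipSum s c fun d => (l.map fun r => φ r d).sum) =
      (l.map fun r => flipSum s c (φ r)).sum := by
  induction l with
  | nil => exact flipSum_zero s c
  | cons r l ih =>
    simp only [List.map_cons, List.sum_cons]
    rw [flipSum_add, ih]

/-- Changing first `s` letters and then `r` letters of the new first block, which come before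
them, amounts to changing `s + r` letters. -/
theorem flipSum_flipSum (s r : ℕ) (c : List Bool) (φ : List Bool → ℕ) :
    (flipSum s c fun d => flipSum r d φ) = flipSum (s + r) c φ := by
  induction c generalizing s r φ with
  | nil =>
    cases s with
    | zero => rw [Nat.zero_add]; rfl
    | succ s => rw [Nat.add_right_comm]; rfl
  | cons a c ih =>
    cases s with
    | zero => rw [Nat.zero_add]; rfl
    | succ s =>
      cases a with
      | true => rw [Nat.add_right_comm]; rfl
      | false =>
        cases r with
        | zero => rfl
        | succ r =>
          have h1 : ∀ d, flipSum (r + 1) (true :: d) φ = 0 := fun d => rfl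
          rw [flipSum_succ_false, ← Nat.add_assoc, flipSum_succ_false]
          simp only [h1, flipSum_succ_false]
          rw [flipSum_add, ih, ih, flipSum_zero, Nat.add_zero, Nat.add_assoc]
          rw [show s + (1 + (r + 1)) = s + (1 + r) + 1 by omega,
            show s + (1 + r) = s + 1 + r by omega]

theorem flipSum_congr {s : ℕ} {c : List Bool} (hc : c ≠ []) {φ ψ : List Bool → ℕ}
    (h : ∀ d, d ≠ [] → φ d = ψ d) : flipSum s c φ = flipSum s c ψ := by
  cases s with
  | zero => rw [flipSum_zero_left, flipSum_zero_left, h c hc]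
  | succ s =>
    match c with
    | [] => exact absurd rfl hc
    | true :: c => rfl
    | false :: c =>
      have h1 : (fun d => φ (false :: d)) = fun d => ψ (false :: d) :=
        funext fun d => h _ (by simp)
      have h2 : (fun d => φ (true :: d)) = fun d => ψ (true :: d) :=
        funext fun d => h _ (by simp)
      simp only [flipSum, h1, h2]

theorem sum_flips (c : List Bool) (ψ : List Bool → ℕ) :
    ((flips c).map ψ).sum = flipSum 1 c ψ := by
  induction c generalizing ψ with
  | nil => rfl
  | cons a c ih =>
    cases a with
    | true => rfl
    | false =>
      simp only [flips, List.map_cons, List.sum_cons, List.map_map]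
      have := ih fun d => ψ (false :: d)
      simp only [Function.comp_def, this]
      rw [show (1 : ℕ) = 0 + 1 from rfl, flipSum_succ_false, flipSum_zero_left, add_comm]

/-- The numbers of changed letters that arise when a step up, a change of `s` letters and a step
down are made one after the other. -/
def wrapFlips : ℕ → List ℕ
  | 0 => [0, 0, 1]
  | s + 1 => [s, s + 1, s + 1, s + 2]

theorem sum_steps312_flipSum {c : List Bool} (hc : c ≠ []) (s : ℕ) (φ : List Bool → ℕ) :
    ((steps312 c).map fun d => flipSum s d (popWeight φ)).sum =
      ((wrapFlips s).map fun r => flipSum r c φ).sum := by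
  cases c with
  | nil => exact absurd rfl hc
  | cons a c =>
    cases s with
    | zero =>
      simp only [steps312, List.map_cons, List.sum_cons, List.map_map, Function.comp_def,
        wrapFlips, List.map_nil, List.sum_nil]
      have := sum_flips (a :: c) fun d => flipSum 0 (false :: d) (popWeight φ)
      rw [this]
      simp only [flipSum_zero_left]
      change φ (a :: c) + (φ (a :: c) + flipSum 1 (a :: c) φ) = _
      omega
    | succ s =>
      simp only [steps312, List.map_cons, List.sum_cons, List.map_map, Function.comp_def,
        wrapFlips, List.map_nil, List.sum_nil]
      have := sum_flips (a :: c) fun d => flipSum (s + 1) (false :: d) (popWeight φ)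
      rw [this]
      have h1 : ∀ d, flipSum (s + 1) (false :: d) (popWeight φ) =
          flipSum (s + 1) d φ + flipSum s d φ := fun d => rfl
      have h2 : flipSum (s + 1) (true :: a :: c) (popWeight φ) = 0 := rfl
      simp only [h1, h2]
      rw [flipSum_add, flipSum_flipSum, flipSum_flipSum,
        show 1 + (s + 1) = s + 2 by omega, show 1 + s = s + 1 by omega]
      omega

/-- The paths that end at the height where they start and never go below it. -/
inductive IsBalanced : List Bool → Prop
  | nil : IsBalanced []
  | wrap {p q : List Bool} : IsBalanced p → IsBalanced q → IsBalanced (true :: p ++ false :: q)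

theorem IsBalanced.append {p q : List Bool} (hp : IsBalanced p) (hq : IsBalanced q) :
    IsBalanced (p ++ q) := by
  induction hp with
  | nil => exact hq
  | @wrap p₁ p₂ h₁ _ _ ih₂ =>
    have := IsBalanced.wrap h₁ ih₂
    simpa using this

theorem transposePath_wrap (p q : List Bool) :
    (true :: p ++ false :: q).transposePath =
      q.transposePath ++ (true :: p.transposePath ++ false :: []) := by
  simp [List.transposePath]

theorem transposePath_transposePath (p : List Bool) : p.transposePath.transposePath = p := by
  simp [List.transposePath, List.map_reverse, Function.comp_def]

theorem IsBalanced.transposePath {p : List Bool} (hp : IsBalanced p) :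
    IsBalanced p.transposePath := by
  induction hp with
  | nil => exact IsBalanced.nil
  | wrap _ _ ih₁ ih₂ =>
    rw [transposePath_wrap]
    exact ih₂.append (IsBalanced.wrap ih₁ IsBalanced.nil)

theorem ne_nil_of_mem_steps312 {c d : List Bool} (h : d ∈ steps312 c) : d ≠ [] := by
  rintro rfl
  cases c <;> simp [steps312] at h

theorem stackRun_wrap (E : List Bool → List (List Bool)) (p q : List Bool) (φ : List Bool → ℕ)
    (c : List Bool) : stackRun E (true :: p ++ false :: q) φ c =
      ((E c).map (stackRun E p (popWeight (stackRun E q φ)))).sum := by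
  rw [stackRun_append, stackRun_false_cons]
  rfl

theorem List.sum_map_flatMap {α β : Type*} (l : List α) (f : α → List β) (g : β → ℕ) :
    ((l.flatMap f).map g).sum = (l.map fun a => ((f a).map g).sum).sum := by
  induction l with
  | nil => rfl
  | cons a l ih => simp [ih]

/-- On a nonempty state, a balanced path acts as a sum of changes of letters of the first
block. -/
theorem IsBalanced.exists_flips {p : List Bool} (hp : IsBalanced p) :
    ∃ l : List ℕ, ∀ φ c, c ≠ [] →
      stackRun steps312 p φ c = (l.map fun s => flipSum s c φ).sum := by
  induction hp with
  | nil => exact ⟨[0], fun φ c _ => by simp [stackRun, flipSum]⟩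
  | @wrap p q _ _ ih₁ ih₂ =>
    obtain ⟨l, hl⟩ := ih₁
    obtain ⟨l', hl'⟩ := ih₂
    refine ⟨(l.flatMap wrapFlips).flatMap fun s => l'.map fun r => s + r, fun φ c hc => ?_⟩
    rw [stackRun_wrap, List.map_congr_left fun d hd => hl _ d (ne_nil_of_mem_steps312 hd)]
    have h1 : ((steps312 c).map fun d => (l.map fun s => flipSum s d
        (popWeight (stackRun steps312 q φ))).sum).sum = (l.map fun s => ((wrapFlips s).map
          fun r => flipSum r c (stackRun steps312 q φ)).sum).sum := by
      clear hl
      induction l with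
      | nil => simp
      | cons s l ih =>
        simp only [List.map_cons, List.sum_cons]
        rw [List.sum_map_add, ih, sum_steps312_flipSum hc]
    have h2 : ∀ r, flipSum r c (stackRun steps312 q φ) =
        (l'.map fun t => flipSum (r + t) c φ).sum := fun r => by
      rw [flipSum_congr hc fun d hd => hl' φ d hd, flipSum_list_sum]
      simp only [flipSum_flipSum]
    rw [h1]
    simp only [h2, List.sum_map_flatMap, List.map_map, Function.comp_def]

/-- On the empty state, a balanced path acts as a multiplication. -/
theorem IsBalanced.exists_mul {p : List Bool} (hp : IsBalanced p) :
    ∃ k : ℕ, ∀ φ, stackRun steps312 p φ [] = k * φ [] := by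
  induction hp with
  | nil => exact ⟨1, fun φ => by simp [stackRun]⟩
  | @wrap p q hp _ _ ih₂ =>
    obtain ⟨l, hl⟩ := hp.exists_flips
    obtain ⟨k, hk⟩ := ih₂
    refine ⟨l.count 0 * k, fun φ => ?_⟩
    rw [stackRun_wrap]
    simp only [steps312, List.map_cons, List.map_nil, List.sum_cons, List.sum_nil, add_zero]
    rw [hl _ _ (by simp), mul_assoc, ← hk]
    clear hl
    induction l with
    | nil => simp
    | cons s l ih =>
      simp only [List.map_cons, List.sum_cons, ih]
      cases s with
      | zero => simp [flipSum, popWeight]; ring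
      | succ s => simp [flipSum]

theorem List.sum_map_sum_comm {α β : Type*} (l : List α) (l' : List β) (f : α → β → ℕ) :
    (l.map fun a => (l'.map fun b => f a b).sum).sum =
      (l'.map fun b => (l.map fun a => f a b).sum).sum := by
  induction l with
  | nil => simp
  | cons a l ih =>
    simp only [List.map_cons, List.sum_cons, ih]
    rw [List.sum_map_add]

/-- Balanced paths act as commuting operators, since changes of letters only add up. -/
theorem IsBalanced.stackRun_comm {p q : List Bool} (hp : IsBalanced p) (hq : IsBalanced q)
    (φ : List Bool → ℕ) :
    stackRun steps312 p (stackRun steps312 q φ) = stackRun steps312 q (stackRun steps312 p φ) := by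
  funext c
  by_cases hc : c = []
  · subst hc
    obtain ⟨k, hk⟩ := hp.exists_mul
    obtain ⟨k', hk'⟩ := hq.exists_mul
    rw [hk, hk', hk', hk, ← mul_assoc, ← mul_assoc, mul_comm k]
  · obtain ⟨l, hl⟩ := hp.exists_flips
    obtain ⟨l', hl'⟩ := hq.exists_flips
    have h1 : ∀ r, flipSum r c (stackRun steps312 q φ) =
        (l'.map fun t => flipSum (r + t) c φ).sum := fun r => by
      rw [flipSum_congr hc fun d hd => hl' φ d hd, flipSum_list_sum]
      simp only [flipSum_flipSum]
    have h2 : ∀ r, flipSum r c (stackRun steps312 p φ) =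
        (l.map fun t => flipSum (r + t) c φ).sum := fun r => by
      rw [flipSum_congr hc fun d hd => hl φ d hd, flipSum_list_sum]
      simp only [flipSum_flipSum]
    rw [hl _ _ hc, hl' _ _ hc]
    simp only [h1, h2]
    rw [List.sum_map_sum_comm]
    simp only [add_comm]

theorem IsBalanced.stackRun_transposePath {p : List Bool} (hp : IsBalanced p)
    (φ : List Bool → ℕ) :
    stackRun steps312 p.transposePath φ = stackRun steps312 p φ := by
  induction hp generalizing φ with
  | nil => rfl
  | @wrap p q hp hq ih₁ ih₂ =>
    rw [transposePath_wrap, stackRun_append,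
      hq.transposePath.stackRun_comm (IsBalanced.wrap hp.transposePath IsBalanced.nil), ih₂]
    funext c
    rw [stackRun_wrap, stackRun_wrap, ih₁]
    rfl

/-- The paths that start at height `n`, end at height `0` and never go below `0`. -/
inductive IsDescent : ℕ → List Bool → Prop
  | nil : IsDescent 0 []
  | up {n : ℕ} {p : List Bool} : IsDescent (n + 1) p → IsDescent n (true :: p)
  | down {n : ℕ} {p : List Bool} : IsDescent n p → IsDescent (n + 1) (false :: p)

/-- A descent from a positive height splits at its first step to a lower level. -/
theorem IsDescent.exists_isBalanced (p : List Bool) :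
    (∀ n, IsDescent (n + 1) p →
      ∃ q r, IsBalanced q ∧ p = q ++ false :: r ∧ IsDescent n r) ∧
    (IsDescent 0 p → IsBalanced p) := by
  induction hs : p.length using Nat.strong_induction_on generalizing p with
  | _ s ih =>
    subst hs
    constructor
    · intro n h
      cases h with
      | up h =>
        rename_i p
        obtain ⟨q, r, hq, rfl, hr⟩ := (ih p.length (by simp) p rfl).1 _ h
        obtain ⟨q', r', hq', rfl, hr'⟩ := (ih r.length (by simp; omega) r rfl).1 _ hr
        exact ⟨true :: q ++ false :: q', r', hq.wrap hq', by simp, hr'⟩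
      | down h => exact ⟨[], _, IsBalanced.nil, rfl, h⟩
    · intro h
      cases h with
      | nil => exact IsBalanced.nil
      | up h =>
        rename_i p
        obtain ⟨q, r, hq, rfl, hr⟩ := (ih p.length (by simp) p rfl).1 _ h
        exact hq.wrap ((ih r.length (by simp; omega) r rfl).2 hr)

theorem length_of_mem_flips {c d : List Bool} (h : d ∈ flips c) : d.length = c.length := by
  induction c generalizing d with
  | nil => simp [flips] at h
  | cons a c ih =>
    cases a with
    | true => simp [flips] at h
    | false =>
      simp only [flips, List.mem_cons, List.mem_map] at h
      rcases h with rfl | ⟨e, he, rfl⟩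
      · simp
      · simp [ih he]

theorem length_of_mem_steps312 {c d : List Bool} (h : d ∈ steps312 c) :
    d.length = c.length + 1 := by
  cases c with
  | nil => simp [steps312] at h; simp [h]
  | cons a c =>
    simp only [steps312, List.mem_cons, List.mem_map] at h
    rcases h with rfl | rfl | ⟨e, he, rfl⟩
    · simp
    · simp
    · simp [length_of_mem_flips he]

theorem isDescent_of_stackRun_ne_zero {p c : List Bool}
    (h : stackRun steps312 p emptyWeight c ≠ 0) : IsDescent c.length p := by
  induction p generalizing c with
  | nil =>
    have : c = [] := by
      by_contra hc
      simp [stackRun, emptyWeight, hc] at h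
    subst this
    exact IsDescent.nil
  | cons a p ih =>
    cases a with
    | true =>
      rw [stackRun] at h
      obtain ⟨x, hx, hx0⟩ : ∃ x ∈ (steps312 c).map (stackRun steps312 p emptyWeight), x ≠ 0 := by
        by_contra hcon
        push Not at hcon
        exact h (List.sum_eq_zero hcon)
      obtain ⟨d, hd, rfl⟩ := List.mem_map.mp hx
      have := ih hx0
      rw [length_of_mem_steps312 hd] at this
      exact this.up
    | false =>
      cases c with
      | nil => exact absurd rfl h
      | cons b c => exact (ih h).down

/-- For the pattern `312`, a path and the transposed path have the same number of closed
walks. -/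
theorem stackRun_steps312_transposePath (p : List Bool) :
    stackRun steps312 p.transposePath emptyWeight [] = stackRun steps312 p emptyWeight [] := by
  by_cases hp : IsBalanced p
  · rw [hp.stackRun_transposePath]
  · have key : ∀ q : List Bool, ¬ IsBalanced q → stackRun steps312 q emptyWeight [] = 0 := by
      intro q hq
      by_contra h
      exact hq ((IsDescent.exists_isBalanced q).2 (isDescent_of_stackRun_ne_zero h))
    rw [key p hp, key]
    intro h
    have := h.transposePath
    rw [transposePath_transposePath] at this
    exact hp this

/-! ### Avoidance of patterns with two or three letters in words -/

namespace List

theorem pair_sublist_iff_idxOf {π : List ℕ} (hπ : π.Nodup) (a b : ℕ) :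
    [a, b].Sublist π ↔ π.idxOf a < π.idxOf b ∧ b ∈ π := by
  induction π with
  | nil => simp
  | cons x π ih =>
    obtain ⟨hx, hπ'⟩ := nodup_cons.mp hπ
    have ih' := ih hπ'
    by_cases hb : x = b
    · subst hb
      have h1 : ¬ [a, x].Sublist (x :: π) := by
        intro h
        rcases cons_sublist_cons'.mp h with h | ⟨rfl, h⟩
        · exact hx (h.subset (by simp))
        · exact hx (singleton_sublist.mp h)
      simp [h1]
    · by_cases ha : x = a
      · subst ha
        have hbx : b ≠ x := fun h => hb h.symm
        simp [idxOf_cons_ne _ hb, hbx]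
      · have hbx : b ≠ x := fun h => hb h.symm
        rw [idxOf_cons_ne _ ha, idxOf_cons_ne _ hb, cons_sublist_cons']
        simp [ih', hbx, Ne.symm ha]

theorem pair_sublist_map_iff {π : List ℕ} {f : ℕ → ℕ} {a b : ℕ} :
    [a, b].Sublist (π.map f) ↔ ∃ x y, [x, y].Sublist π ∧ f x = a ∧ f y = b := by
  rw [sublist_map_iff]
  constructor
  · rintro ⟨l, hl, h⟩
    match l with
    | [] => simp at h
    | [_] => simp at h
    | [x, y] =>
      simp only [map_cons, map_nil, cons.injEq, and_true] at h
      exact ⟨x, y, hl, h.1.symm, h.2.symm⟩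
    | _ :: _ :: _ :: _ => simp at h
  · rintro ⟨x, y, h, rfl, rfl⟩
    exact ⟨[x, y], h, rfl⟩

theorem pair_sublist_eraseMin {π : List ℕ} (hπ : π.Nodup) (a b : ℕ) :
    [a, b].Sublist π.eraseMin ↔ [a + 1, b + 1].Sublist π := by
  unfold eraseMin
  rw [pair_sublist_map_iff]
  constructor
  · rintro ⟨x, y, h, rfl, rfl⟩
    have h0 : ∀ z ∈ [x, y], z ≠ 0 := fun z hz h' => by
      subst h'
      exact hπ.not_mem_erase (h.subset hz)
    have hx := h0 x (by simp)
    have hy := h0 y (by simp)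
    rw [Nat.pred_eq_sub_one, Nat.pred_eq_sub_one, Nat.sub_add_cancel (by omega),
      Nat.sub_add_cancel (by omega)]
    exact h.trans erase_sublist
  · intro h
    refine ⟨a + 1, b + 1, ?_, rfl, rfl⟩
    rw [hπ.erase_eq_filter]
    have := h.filter (· != 0)
    simpa using this

theorem mem_iff_lt_of_perm_range {π : List ℕ} (hπ : π.Perm (range π.length)) {x : ℕ} :
    x ∈ π ↔ x < π.length := by
  rw [hπ.mem_iff, mem_range]

theorem nodup_of_perm_range {π : List ℕ} (hπ : π.Perm (range π.length)) : π.Nodup :=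
  hπ.nodup_iff.mpr nodup_range

/-- Which letter of `consRank v π` comes before which other letter. -/
theorem pair_sublist_consRank {π : List ℕ} (hπ : π.Perm (range π.length)) {v : ℕ}
    (hv : v ≤ π.length) (a b : ℕ) :
    [a, b].Sublist (consRank v π) ↔ (a = v ∧ b ≠ v ∧ b ≤ π.length) ∨
      ∃ x y, [x, y].Sublist π ∧ (if v ≤ x then x + 1 else x) = a ∧
        (if v ≤ y then y + 1 else y) = b := by
  unfold consRank
  rw [cons_sublist_cons', pair_sublist_map_iff, or_comm]
  refine or_congr (and_congr_right fun _ => ?_) Iff.rfl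
  rw [singleton_sublist, mem_map]
  constructor
  · rintro ⟨x, hx, rfl⟩
    have := (mem_iff_lt_of_perm_range hπ).mp hx
    split_ifs <;> omega
  · rintro ⟨h1, h2⟩
    refine ⟨if v < b then b - 1 else b, (mem_iff_lt_of_perm_range hπ).mpr ?_, ?_⟩
    · split_ifs <;> omega
    · split_ifs <;> omega

end List

theorem IsOrderInvariant.map_bump {A : List ℕ → Prop} (hA : IsOrderInvariant A) (v : ℕ)
    (π : List ℕ) : A (π.map fun x => if v ≤ x then x + 1 else x) ↔ A π :=
  hA π _ fun x _ y _ h => by split_ifs <;> omega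

namespace VincularPattern

theorem WordAvoids.mono {σ : VincularPattern} {L L' : List ℕ} (h : σ.WordAvoids L)
    (hL : L'.Sublist L) : σ.WordAvoids L' := fun l hl => h l (hl.trans hL)

theorem WordAvoids.eraseMin {σ : VincularPattern} {π : List ℕ} (hπ : π.Nodup)
    (h : σ.WordAvoids π) : σ.WordAvoids π.eraseMin := by
  refine (isOrderInvariant_wordAvoids σ (π.erase 0) Nat.pred fun x hx y _ hxy => ?_).mpr
    (h.mono List.erase_sublist)
  have hx0 : x ≠ 0 := fun h' => by
    subst h'
    exact hπ.not_mem_erase hx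
  exact Nat.pred_lt_pred hx0 hxy

theorem wordAvoids_nil {σ : VincularPattern} (hk : 0 < σ.k) : σ.WordAvoids [] := by
  rintro l hl ⟨h, rfl, -⟩
  have := congrArg List.length (List.sublist_nil.mp hl)
  simp at this
  omega

/-- If the occurrences of a pattern are the pairs of letters related by `P`, then a new letter in
front can only create occurrences that begin with it. -/
theorem wordAvoids_consRank_two {σ : VincularPattern} {P : ℕ → ℕ → Prop}
    (hσ : ∀ L, σ.WordAvoids L ↔ ∀ a b, [a, b].Sublist L → ¬ P a b) {v : ℕ} {π : List ℕ}
    (h : σ.WordAvoids π) : σ.WordAvoids (List.consRank v π) ↔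
      ∀ x ∈ π, ¬ P v (if v ≤ x then x + 1 else x) := by
  have h' := (hσ _).mp (((isOrderInvariant_wordAvoids σ).map_bump v π).mpr h)
  rw [hσ]
  unfold List.consRank
  constructor
  · intro hv x hx
    refine hv _ _ (List.Sublist.cons_cons v (List.singleton_sublist.mpr ?_))
    exact List.mem_map.mpr ⟨x, hx, rfl⟩
  · intro hv a b hab
    rcases List.cons_sublist_cons'.mp hab with hab | ⟨rfl, hb⟩
    · exact h' a b hab
    · obtain ⟨x, hx, rfl⟩ := List.mem_map.mp (List.singleton_sublist.mp hb)
      exact hv x hx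

/-- If the occurrences of a pattern are the triples of letters related by `P`, then a new letter in
front can only create occurrences that begin with it. -/
theorem wordAvoids_consRank_three {σ : VincularPattern} {P : ℕ → ℕ → ℕ → Prop}
    (hσ : ∀ L, σ.WordAvoids L ↔ ∀ a b c, [a, b, c].Sublist L → ¬ P a b c) {v : ℕ} {π : List ℕ}
    (h : σ.WordAvoids π) : σ.WordAvoids (List.consRank v π) ↔
      ∀ x y, [x, y].Sublist π →
        ¬ P v (if v ≤ x then x + 1 else x) (if v ≤ y then y + 1 else y) := by
  have h' := (hσ _).mp (((isOrderInvariant_wordAvoids σ).map_bump v π).mpr h)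
  rw [hσ]
  unfold List.consRank
  constructor
  · intro hv x y hx
    refine hv _ _ _ (List.Sublist.cons_cons v (List.pair_sublist_map_iff.mpr ?_))
    exact ⟨x, y, hx, rfl, rfl⟩
  · intro hv a b c hab
    rcases List.cons_sublist_cons'.mp hab with hab | ⟨rfl, hb⟩
    · exact h' a b c hab
    · obtain ⟨x, y, hx, rfl, rfl⟩ := List.pair_sublist_map_iff.mp hb
      exact hv x y hx

theorem wordAvoids_iff_two {σ : VincularPattern} {P : ℕ → ℕ → Prop}
    (h : ∀ l, σ.IsOccurrence l ↔ ∃ a b, l = [a, b] ∧ P a b) (L : List ℕ) :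
    σ.WordAvoids L ↔ ∀ a b, [a, b].Sublist L → ¬ P a b := by
  simp only [WordAvoids, h]
  constructor
  · intro hL a b hab hP
    exact hL _ hab ⟨a, b, rfl, hP⟩
  · rintro hL l hl ⟨a, b, rfl, hP⟩
    exact hL a b hl hP

theorem wordAvoids_iff_three {σ : VincularPattern} {P : ℕ → ℕ → ℕ → Prop}
    (h : ∀ l, σ.IsOccurrence l ↔ ∃ a b c, l = [a, b, c] ∧ P a b c) (L : List ℕ) :
    σ.WordAvoids L ↔ ∀ a b c, [a, b, c].Sublist L → ¬ P a b c := by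
  simp only [WordAvoids, h]
  constructor
  · intro hL a b c hab hP
    exact hL _ hab ⟨a, b, c, rfl, hP⟩
  · rintro hL l hl ⟨a, b, c, rfl, hP⟩
    exact hL a b c hl hP

theorem isOccurrence_iff_two {σ : VincularPattern} {e' : Fin 2 → Fin 2}
    (hσ : ∀ l, σ.IsOccurrence l ↔ ∃ h : Fin 2 → ℕ, l = List.ofFn h ∧
      ∀ a b, h a ≤ h b ↔ e' a ≤ e' b) (e : Fin 2 → Fin 2) (he : e' = e) (l : List ℕ) :
    σ.IsOccurrence l ↔ ∃ a b, l = [a, b] ∧ (a ≤ b ↔ e 0 ≤ e 1) ∧ (b ≤ a ↔ e 1 ≤ e 0) := by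
  rw [hσ, he]
  constructor
  · rintro ⟨h, rfl, hh⟩
    exact ⟨h 0, h 1, by simp [List.ofFn_succ], hh 0 1, hh 1 0⟩
  · rintro ⟨a, b, rfl, h1, h2⟩
    refine ⟨![a, b], by simp [List.ofFn_succ], ?_⟩
    simp [Fin.forall_fin_succ, h1, h2]

theorem isOccurrence_iff_three {σ : VincularPattern} {e' : Fin 3 → Fin 3}
    (hσ : ∀ l, σ.IsOccurrence l ↔ ∃ h : Fin 3 → ℕ, l = List.ofFn h ∧
      ∀ a b, h a ≤ h b ↔ e' a ≤ e' b) (e : Fin 3 → Fin 3) (he : e' = e) (l : List ℕ) :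
    σ.IsOccurrence l ↔ ∃ a b c, l = [a, b, c] ∧ (a ≤ b ↔ e 0 ≤ e 1) ∧ (b ≤ a ↔ e 1 ≤ e 0) ∧
      (a ≤ c ↔ e 0 ≤ e 2) ∧ (c ≤ a ↔ e 2 ≤ e 0) ∧ (b ≤ c ↔ e 1 ≤ e 2) ∧
      (c ≤ b ↔ e 2 ≤ e 1) := by
  rw [hσ, he]
  constructor
  · rintro ⟨h, rfl, hh⟩
    exact ⟨h 0, h 1, h 2, by simp [List.ofFn_succ], hh 0 1, hh 1 0, hh 0 2, hh 2 0, hh 1 2,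
      hh 2 1⟩
  · rintro ⟨a, b, c, rfl, h1, h2, h3, h4, h5, h6⟩
    refine ⟨![a, b, c], by simp [List.ofFn_succ], ?_⟩
    simp [Fin.forall_fin_succ, h1, h2, h3, h4, h5, h6]

theorem wordAvoids_12 (L : List ℕ) : (dashed [[1], [2]]).WordAvoids L ↔
    ∀ a b, [a, b].Sublist L → ¬ a < b :=
  wordAvoids_iff_two (fun l => (isOccurrence_iff_two
    (e' := wordFun [1, 2] (by decide)) (fun _ => Iff.rfl) ![0, 1] (by decide) l).trans <|
    exists_congr fun a => exists_congr fun b => and_congr_right fun _ => by simp; omega) L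

theorem wordAvoids_21 (L : List ℕ) : (dashed [[2], [1]]).WordAvoids L ↔
    ∀ a b, [a, b].Sublist L → ¬ b < a :=
  wordAvoids_iff_two (fun l => (isOccurrence_iff_two
    (e' := wordFun [2, 1] (by decide)) (fun _ => Iff.rfl) ![1, 0] (by decide) l).trans <|
    exists_congr fun a => exists_congr fun b => and_congr_right fun _ => by simp; omega) L

theorem wordAvoids_123 (L : List ℕ) : (dashed [[1], [2], [3]]).WordAvoids L ↔
    ∀ a b c, [a, b, c].Sublist L → ¬ (a < b ∧ b < c) :=
  wordAvoids_iff_three (fun l => (isOccurrence_iff_three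
    (e' := wordFun [1, 2, 3] (by decide)) (fun _ => Iff.rfl) ![0, 1, 2] (by decide) l).trans <|
    exists_congr fun a => exists_congr fun b => exists_congr fun c => and_congr_right fun _ => by
      simp; omega) L

theorem wordAvoids_132 (L : List ℕ) : (dashed [[1], [3], [2]]).WordAvoids L ↔
    ∀ a b c, [a, b, c].Sublist L → ¬ (a < c ∧ c < b) :=
  wordAvoids_iff_three (fun l => (isOccurrence_iff_three
    (e' := wordFun [1, 3, 2] (by decide)) (fun _ => Iff.rfl) ![0, 2, 1] (by decide) l).trans <|
    exists_congr fun a => exists_congr fun b => exists_congr fun c => and_congr_right fun _ => by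
      simp; omega) L

theorem wordAvoids_321 (L : List ℕ) : (dashed [[3], [2], [1]]).WordAvoids L ↔
    ∀ a b c, [a, b, c].Sublist L → ¬ (c < b ∧ b < a) :=
  wordAvoids_iff_three (fun l => (isOccurrence_iff_three
    (e' := wordFun [3, 2, 1] (by decide)) (fun _ => Iff.rfl) ![2, 1, 0] (by decide) l).trans <|
    exists_congr fun a => exists_congr fun b => exists_congr fun c => and_congr_right fun _ => by
      simp; omega) L

theorem wordAvoids_312 (L : List ℕ) : (dashed [[3], [1], [2]]).WordAvoids L ↔
    ∀ a b c, [a, b, c].Sublist L → ¬ (b < c ∧ c < a) :=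
  wordAvoids_iff_three (fun l => (isOccurrence_iff_three
    (e' := wordFun [3, 1, 2] (by decide)) (fun _ => Iff.rfl) ![2, 0, 1] (by decide) l).trans <|
    exists_congr fun a => exists_congr fun b => exists_congr fun c => and_congr_right fun _ => by
      simp; omega) L

end VincularPattern

/-! ### Growth rules of words that avoid a short pattern -/

namespace VincularPattern

/-- The number of ways to go along a path when the state is only the length of the word. -/
def lengthCount : List Bool → ℕ → ℕ
  | [], m => if m = 0 then 1 else 0
  | true :: p, m => lengthCount p (m + 1)
  | false :: _, 0 => 0
  | false :: p, m + 1 => lengthCount p m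

/-- If there is always exactly one possible value `f m` of the next letter, then the number of ways
to go along a path depends only on the length of the word. -/
theorem pathCount_eq_lengthCount {σ : VincularPattern} (f : ℕ → ℕ) (hf : ∀ m, f m ≤ m)
    (h : ∀ π : List ℕ, π.Perm (List.range π.length) → σ.WordAvoids π → ∀ v ≤ π.length,
      (σ.WordAvoids (List.consRank v π) ↔ v = f π.length))
    (p : List Bool) (π : List ℕ) (hπ : π.Perm (List.range π.length)) (hA : σ.WordAvoids π) :
    pathCount σ.WordAvoids p π = lengthCount p π.length := by
  classical
  induction p generalizing π with
  | nil => simp [pathCount, lengthCount]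
  | cons b p ih =>
    cases b with
    | true =>
      have hv := (h π hπ hA _ (hf _)).mpr rfl
      simp only [pathCount]
      rw [Finset.sum_eq_single_of_mem (f π.length)
        (Finset.mem_range.mpr (Nat.lt_succ_of_le (hf _))) fun v hv hne =>
          if_neg fun hA' => hne ((h π hπ hA v
            (Nat.lt_succ_iff.mp (Finset.mem_range.mp hv))).mp hA'),
        if_pos hv, ih _ (List.consRank_perm_range hπ (hf _)) hv, List.length_consRank, lengthCount]
    | false =>
      have h0 : 0 ∈ π ↔ 0 < π.length := List.mem_iff_lt_of_perm_range hπ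
      simp only [pathCount]
      split_ifs with h'
      · rw [ih _ (List.eraseMin_perm_range hπ h') (hA.eraseMin (List.nodup_of_perm_range hπ)),
          List.length_eraseMin h']
        obtain ⟨m, hm⟩ := Nat.exists_eq_succ_of_ne_zero (h0.mp h').ne'
        rw [hm]
        rfl
      · have hm : π.length = 0 := Nat.eq_zero_of_not_pos fun h => h' (h0.mpr h)
        rw [hm]
        rfl

theorem pathCount_12 (p : List Bool) :
    pathCount (dashed [[1], [2]]).WordAvoids p [] = lengthCount p 0 := by
  refine pathCount_eq_lengthCount (fun m => m) (fun _ => le_rfl) (fun π hπ hA v hv => ?_) p []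
    (by simp) (wordAvoids_nil (by decide))
  rw [wordAvoids_consRank_two wordAvoids_12 hA]
  constructor
  · intro h
    by_contra hne
    have := h v ((List.mem_iff_lt_of_perm_range hπ).mpr (by omega))
    simp at this
  · rintro rfl x hx
    have := (List.mem_iff_lt_of_perm_range hπ).mp hx
    split_ifs <;> omega

theorem pathCount_21 (p : List Bool) :
    pathCount (dashed [[2], [1]]).WordAvoids p [] = lengthCount p 0 := by
  refine pathCount_eq_lengthCount (fun _ => 0) (fun _ => Nat.zero_le _) (fun π hπ hA v hv => ?_)
    p [] (by simp) (wordAvoids_nil (by decide))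
  rw [wordAvoids_consRank_two wordAvoids_21 hA]
  constructor
  · intro h
    by_contra hne
    have := h 0 ((List.mem_iff_lt_of_perm_range hπ).mpr (by omega))
    rw [if_neg (by omega)] at this
    omega
  · rintro rfl x hx
    omega

/-- Let `T π t` say that `t` is a threshold of the word `π`: the possible values of the next letter
are those that are at least `t`. If the new thresholds `f m t v` run through `t, …, m` in some
order, then the words are counted by `thresholdCount`. -/
theorem pathCount_eq_thresholdCount {σ : VincularPattern} (hk : 0 < σ.k)
    (T : List ℕ → ℕ → Prop) (f : ℕ → ℕ → ℕ → ℕ)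
    (hf : ∀ m t, ∀ φ : ℕ → ℕ, (∑ v ∈ Finset.range (m + 1), if t ≤ v then φ (f m t v) else 0) =
      ∑ t' ∈ Finset.Icc t m, φ t')
    (h0 : T [] 0)
    (h : ∀ π t, π.Perm (List.range π.length) → σ.WordAvoids π → T π t → ∀ v ≤ π.length,
      (σ.WordAvoids (List.consRank v π) ↔ t ≤ v) ∧
        (t ≤ v → T (List.consRank v π) (f π.length t v)))
    (hS : ∀ π t, π.Nodup → T π t → T π.eraseMin (t - 1))
    (p : List Bool) : pathCount σ.WordAvoids p [] = thresholdCount p 0 0 := by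
  classical
  suffices key : ∀ π t, π.Perm (List.range π.length) → σ.WordAvoids π → T π t →
      pathCount σ.WordAvoids p π = thresholdCount p t π.length from
    key [] 0 (by simp) (wordAvoids_nil hk) h0
  induction p with
  | nil =>
    intro π t _ _ _
    simp [pathCount, thresholdCount]
  | cons b p ih =>
    intro π t hπ hA hT
    cases b with
    | true =>
      simp only [pathCount, thresholdCount]
      rw [← hf]
      refine Finset.sum_congr rfl fun v hv => ?_
      have hv' := Nat.lt_succ_iff.mp (Finset.mem_range.mp hv)
      obtain ⟨h1, h2⟩ := h π t hπ hA hT v hv'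
      by_cases htv : t ≤ v
      · rw [if_pos htv, if_pos (h1.mpr htv),
          ih _ _ (List.consRank_perm_range hπ hv') (h1.mpr htv) (h2 htv), List.length_consRank]
      · rw [if_neg htv, if_neg fun h' => htv (h1.mp h')]
    | false =>
      have h0 : 0 ∈ π ↔ 0 < π.length := List.mem_iff_lt_of_perm_range hπ
      have hnd := List.nodup_of_perm_range hπ
      simp only [pathCount]
      split_ifs with h'
      · rw [ih _ _ (List.eraseMin_perm_range hπ h') (hA.eraseMin hnd) (hS π t hnd hT),
          List.length_eraseMin h']
        obtain ⟨m, hm⟩ := Nat.exists_eq_succ_of_ne_zero (h0.mp h').ne'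
        rw [hm]
        rfl
      · have hm : π.length = 0 := Nat.eq_zero_of_not_pos fun h => h' (h0.mpr h)
        rw [hm]
        rfl

/-- For the pattern `123` the threshold is the successor of the greatest letter that has a
greater letter to its right. -/
theorem pathCount_123 (p : List Bool) :
    pathCount (dashed [[1], [2], [3]]).WordAvoids p [] = thresholdCount p 0 0 := by
  refine pathCount_eq_thresholdCount (by decide)
    (fun π t => (∀ b c, [b, c].Sublist π → b < c → b < t) ∧
      (t = 0 ∨ ∃ c, [t - 1, c].Sublist π ∧ t - 1 < c))
    (fun m t v => if v = m then t else v + 1) ?_ (by simp) ?_ ?_ p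
  · intro m t φ
    rw [← Finset.sum_filter]
    refine Finset.sum_nbij' (fun v => if v = m then t else v + 1)
      (fun v => if v = t then m else v - 1) ?_ ?_ ?_ ?_ ?_
    all_goals
      intro v hv
      simp only [Finset.mem_filter, Finset.mem_range, Finset.mem_Icc] at hv ⊢
      try (split_ifs <;> omega)
  · rintro π t hπ hA ⟨hT, hT'⟩ v hv
    constructor
    · rw [wordAvoids_consRank_three wordAvoids_123 hA]
      constructor
      · intro h
        rcases hT' with rfl | ⟨c, hc, htc⟩
        · exact Nat.zero_le _
        · have := h _ _ hc
          split_ifs at this <;> omega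
      · intro htv x y hxy
        have := hT x y hxy
        split_ifs <;> omega
    · intro htv
      constructor
      · intro b c hbc hlt
        rcases (List.pair_sublist_consRank hπ hv b c).mp hbc with
          ⟨rfl, h1, h2⟩ | ⟨x, y, hxy, rfl, rfl⟩
        · rw [if_neg (by omega)]
          omega
        · have := hT x y hxy
          split_ifs at hlt ⊢ <;> omega
      · by_cases hvm : v = π.length
        · rw [if_pos hvm]
          refine hT'.imp_right ?_
          rintro ⟨c, hc, htc⟩
          refine ⟨if v ≤ c then c + 1 else c,
            (List.pair_sublist_consRank hπ hv _ _).mpr (Or.inr ⟨_, _, hc, ?_, rfl⟩), ?_⟩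
          · have := (List.mem_iff_lt_of_perm_range hπ).mp (hc.subset (List.mem_cons_self ..))
            rw [if_neg (by omega)]
          · split_ifs <;> omega
        · rw [if_neg hvm]
          exact Or.inr ⟨v + 1, (List.pair_sublist_consRank hπ hv _ _).mpr
            (Or.inl ⟨by omega, by omega, by omega⟩), by omega⟩
  · rintro π t hπ ⟨hT, hT'⟩
    constructor
    · intro b c hbc hlt
      have := hT _ _ ((List.pair_sublist_eraseMin hπ b c).mp hbc) (by omega)
      omega
    · rcases hT' with rfl | ⟨c, hc, htc⟩
      · exact Or.inl rfl
      · by_cases ht : t - 1 = 0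
        · exact Or.inl ht
        · refine Or.inr ⟨c - 1, (List.pair_sublist_eraseMin hπ _ _).mpr ?_, by omega⟩
          rwa [Nat.sub_add_cancel (by omega), Nat.sub_add_cancel (by omega)]

/-- For the pattern `132` the threshold is the successor of the greatest letter that has a
greater letter to its left. -/
theorem pathCount_132 (p : List Bool) :
    pathCount (dashed [[1], [3], [2]]).WordAvoids p [] = thresholdCount p 0 0 := by
  refine pathCount_eq_thresholdCount (by decide)
    (fun π t => (∀ b c, [c, b].Sublist π → b < c → b < t) ∧
      (t = 0 ∨ ∃ c, [c, t - 1].Sublist π ∧ t - 1 < c))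
    (fun _ _ v => v) ?_ (by simp) ?_ ?_ p
  · intro m t φ
    rw [← Finset.sum_filter]
    refine Finset.sum_congr ?_ fun _ _ => rfl
    ext v
    simp only [Finset.mem_filter, Finset.mem_range, Finset.mem_Icc]
    omega
  · rintro π t hπ hA ⟨hT, hT'⟩ v hv
    constructor
    · rw [wordAvoids_consRank_three wordAvoids_132 hA]
      constructor
      · intro h
        rcases hT' with rfl | ⟨c, hc, htc⟩
        · exact Nat.zero_le _
        · have := h _ _ hc
          split_ifs at this <;> omega
      · intro htv x y hxy
        have := hT y x hxy
        split_ifs <;> omega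
    · intro htv
      constructor
      · intro b c hbc hlt
        rcases (List.pair_sublist_consRank hπ hv c b).mp hbc with
          ⟨rfl, h1, h2⟩ | ⟨x, y, hxy, rfl, rfl⟩
        · exact hlt
        · have := hT y x hxy
          split_ifs at hlt ⊢ <;> omega
      · by_cases hv0 : v = 0
        · exact Or.inl hv0
        · exact Or.inr ⟨v, (List.pair_sublist_consRank hπ hv _ _).mpr
            (Or.inl ⟨rfl, by omega, by omega⟩), by omega⟩
  · rintro π t hπ ⟨hT, hT'⟩
    constructor
    · intro b c hbc hlt
      have := hT _ _ ((List.pair_sublist_eraseMin hπ c b).mp hbc) (by omega)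
      omega
    · rcases hT' with rfl | ⟨c, hc, htc⟩
      · exact Or.inl rfl
      · by_cases ht : t - 1 = 0
        · exact Or.inl ht
        · refine Or.inr ⟨c - 1, (List.pair_sublist_eraseMin hπ _ _).mpr ?_, by omega⟩
          rwa [Nat.sub_add_cancel (by omega), Nat.sub_add_cancel (by omega)]

/-- The flags of a word for a family `g` of pairs of letters: the `s`-th flag tells whether the
pair `g s` fails to be a subword. -/
def pairFlags (g : ℕ → List ℕ) (π : List ℕ) : List Bool :=
  (List.range π.length).map fun s => !(g s).isSublist π

theorem length_pairFlags (g : ℕ → List ℕ) (π : List ℕ) :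
    (pairFlags g π).length = π.length := by
  simp [pairFlags]

theorem getElem_pairFlags (g : ℕ → List ℕ) (π : List ℕ) (s : ℕ)
    (hs : s < (pairFlags g π).length) : (pairFlags g π)[s] = !(g s).isSublist π := by
  simp [pairFlags]

theorem isSublist_congr {l l' L L' : List ℕ} (h : l.Sublist L ↔ l'.Sublist L') :
    l.isSublist L = l'.isSublist L' := by
  rw [Bool.eq_iff_iff, List.isSublist_iff_sublist, List.isSublist_iff_sublist, h]

/-- If the flags of a word determine its growth, the words are counted by a stack of flags. -/
theorem pathCount_eq_stackRun {σ : VincularPattern} (hk : 0 < σ.k) (g : ℕ → List ℕ)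
    (E : List Bool → List (List Bool))
    (hE : ∀ π, π.Perm (List.range π.length) → σ.WordAvoids π → ∀ (B : ℕ → Prop) [DecidablePred B],
      (∀ v, B v ↔ σ.WordAvoids (List.consRank v π)) → ∀ φ : List Bool → ℕ,
      (∑ v ∈ Finset.range (π.length + 1),
        if B v then φ (pairFlags g (List.consRank v π)) else 0) =
        ((E (pairFlags g π)).map φ).sum)
    (hS : ∀ π s, π.Nodup → ((g s).Sublist π.eraseMin ↔ (g (s + 1)).Sublist π))
    (p : List Bool) : pathCount σ.WordAvoids p [] = stackRun E p emptyWeight [] := by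
  classical
  suffices key : ∀ π, π.Perm (List.range π.length) → σ.WordAvoids π →
      pathCount σ.WordAvoids p π = stackRun E p emptyWeight (pairFlags g π) from
    key [] (by simp) (wordAvoids_nil hk)
  induction p with
  | nil =>
    intro π _ _
    simp [pathCount, stackRun, emptyWeight, pairFlags]
  | cons b p ih =>
    intro π hπ hA
    cases b with
    | true =>
      simp only [pathCount, stackRun]
      rw [← hE π hπ hA (fun v => σ.WordAvoids (List.consRank v π)) (fun _ => Iff.rfl)]
      refine Finset.sum_congr rfl fun v hv => ?_
      have hv' := Nat.lt_succ_iff.mp (Finset.mem_range.mp hv)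
      split_ifs with h'
      · exact ih _ (List.consRank_perm_range hπ hv') h'
      · rfl
    | false =>
      have h0 : 0 ∈ π ↔ 0 < π.length := List.mem_iff_lt_of_perm_range hπ
      have hnd := List.nodup_of_perm_range hπ
      simp only [pathCount]
      split_ifs with h'
      · rw [ih _ (List.eraseMin_perm_range hπ h') (hA.eraseMin hnd)]
        obtain ⟨m, hm⟩ := Nat.exists_eq_succ_of_ne_zero (h0.mp h').ne'
        have : pairFlags g π = (!(g 0).isSublist π) :: pairFlags g π.eraseMin := by
          unfold pairFlags
          rw [List.length_eraseMin h', hm, Nat.succ_sub_one, List.range_succ_eq_map,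
            List.map_cons, List.map_map]
          refine congrArg _ (List.map_congr_left fun s _ => ?_)
          rw [isSublist_congr (hS π s hnd)]
          rfl
        rw [this]
        rfl
      · have hm : π = [] := List.length_eq_zero_iff.mp
          (Nat.eq_zero_of_not_pos fun h => h' (h0.mpr h))
        rw [hm]
        rfl

/-- The last flag of a nonempty word is `true` if the last pair contains a letter that is too
large. -/
theorem exists_pairFlags_eq_append {g : ℕ → List ℕ} {π : List ℕ} (h : π ≠ [])
    (hg : ¬ (g (π.length - 1)).Sublist π) : ∃ d, pairFlags g π = d ++ [true] := by
  have hm : π.length = π.length - 1 + 1 := by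
    have := List.length_pos_iff.mpr h
    omega
  unfold pairFlags
  rw [hm, List.range_succ, List.map_append]
  refine ⟨_, congrArg _ ?_⟩
  have : (g (π.length - 1)).isSublist π = false := by
    rw [Bool.eq_false_iff, ne_eq, List.isSublist_iff_sublist]
    exact hg
  simp [this]

/-- The possible steps for `321` in terms of the index `u` of the flag behind which the new letter
is inserted: all flags before it have to be `false`. -/
theorem sum_stepsPlus321 (d : List Bool) (φ : List Bool → ℕ) :
    (∑ u ∈ Finset.range (d ++ [true]).length,
      if (∀ b ∈ (d ++ [true]).take u, b = false) then
        φ ((d ++ [true]).take u ++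
          true :: decide ((d ++ [true]).length ≤ u + 1) :: (d ++ [true]).drop (u + 1))
      else 0) = ((stepsPlus321 (d ++ [true])).map φ).sum := by
  induction d generalizing φ with
  | nil => simp [stepsPlus321]
  | cons a d ih =>
    rw [List.cons_append, List.length_cons, Finset.sum_range_succ']
    cases a with
    | true =>
      obtain ⟨b, c, hbc⟩ : ∃ b c, d ++ [true] = b :: c := by
        cases d with
        | nil => exact ⟨_, _, rfl⟩
        | cons b d => exact ⟨_, _, rfl⟩
      rw [hbc]
      simp [stepsPlus321]
    | false =>
      have := ih fun c => φ (false :: c)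
      simp only [stepsPlus321, List.map_cons, List.map_map, List.sum_cons, Function.comp_def]
      rw [← this, add_comm]
      simp

/-- Setting one flag of the first block to `true`: the flag at the end of the block is `true`
already, the others are changed. -/
theorem sum_flips_add (d : List Bool) (φ : List Bool → ℕ) :
    (∑ u ∈ Finset.range (d ++ [true]).length,
      if (∀ b ∈ (d ++ [true]).take u, b = false) then
        φ ((d ++ [true]).take u ++ true :: (d ++ [true]).drop (u + 1))
      else 0) = φ (d ++ [true]) + ((flips (d ++ [true])).map φ).sum := by
  induction d generalizing φ with
  | nil => simp [flips]
  | cons a d ih =>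
    rw [List.cons_append, List.length_cons, Finset.sum_range_succ']
    cases a with
    | true => simp [flips]
    | false =>
      have := ih fun c => φ (false :: c)
      simp only [flips, List.map_cons, List.map_map, List.sum_cons, Function.comp_def]
      rw [add_left_comm, ← this, add_comm]
      simp

theorem forall_mem_take_pairFlags {g : ℕ → List ℕ} {π : List ℕ} {u : ℕ} (hu : u ≤ π.length) :
    (∀ b ∈ (pairFlags g π).take u, b = false) ↔ ∀ s < u, (g s).Sublist π := by
  constructor
  · intro h s hs
    have hs' : s < ((pairFlags g π).take u).length := by
      simp only [List.length_take, length_pairFlags]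
      omega
    have := h _ (List.getElem_mem hs')
    rw [List.getElem_take, getElem_pairFlags] at this
    simpa using this
  · intro h b hb
    obtain ⟨s, hs, rfl⟩ := List.getElem_of_mem hb
    rw [List.getElem_take, getElem_pairFlags]
    simp only [List.length_take, length_pairFlags] at hs
    simpa using h s (by omega)

/-- The next letter may have value `v` in a word that avoids `321` if and only if the letters
less than `v` form an increasing word. -/
theorem wordAvoids_consRank_321 {π : List ℕ} (hπ : π.Perm (List.range π.length))
    (hA : (dashed [[3], [2], [1]]).WordAvoids π) {v : ℕ} (hv : v ≤ π.length) :
    (dashed [[3], [2], [1]]).WordAvoids (List.consRank v π) ↔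
      ∀ s < v - 1, [s, s + 1].Sublist π := by
  have hnd := List.nodup_of_perm_range hπ
  have hmem : ∀ x, x ∈ π ↔ x < π.length := fun x => List.mem_iff_lt_of_perm_range hπ
  rw [wordAvoids_consRank_three wordAvoids_321 hA]
  constructor
  · intro h s hs
    rw [List.pair_sublist_iff_idxOf hnd]
    refine ⟨?_, (hmem _).mpr (by omega)⟩
    by_contra hlt
    have hne : π.idxOf (s + 1) ≠ π.idxOf s := fun h' => by
      have := (List.idxOf_inj ((hmem _).mpr (by omega))).mp h'
      omega
    have := h (s + 1) s ((List.pair_sublist_iff_idxOf hnd _ _).mpr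
      ⟨by omega, (hmem _).mpr (by omega)⟩)
    rw [if_neg (by omega), if_neg (by omega)] at this
    omega
  · intro h x y hxy hP
    have hx : y < x ∧ x < v := by split_ifs at hP <;> omega
    have hlt := ((List.pair_sublist_iff_idxOf hnd _ _).mp hxy).1
    have key : ∀ i, y + i < v → π.idxOf y ≤ π.idxOf (y + i) := fun i => by
      induction i with
      | zero => intro _; exact le_rfl
      | succ i ih =>
        intro hi
        have := ((List.pair_sublist_iff_idxOf hnd _ _).mp (h (y + i) (by omega))).1
        exact (ih (by omega)).trans this.le
    have := key (x - y) (by omega)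
    rw [show y + (x - y) = x by omega] at this
    omega

/-- The next letter may have value `v` in a word that avoids `312` if and only if the letters
less than `v` form a decreasing word. -/
theorem wordAvoids_consRank_312 {π : List ℕ} (hπ : π.Perm (List.range π.length))
    (hA : (dashed [[3], [1], [2]]).WordAvoids π) {v : ℕ} (hv : v ≤ π.length) :
    (dashed [[3], [1], [2]]).WordAvoids (List.consRank v π) ↔
      ∀ s < v - 1, [s + 1, s].Sublist π := by
  have hnd := List.nodup_of_perm_range hπ
  have hmem : ∀ x, x ∈ π ↔ x < π.length := fun x => List.mem_iff_lt_of_perm_range hπ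
  rw [wordAvoids_consRank_three wordAvoids_312 hA]
  constructor
  · intro h s hs
    rw [List.pair_sublist_iff_idxOf hnd]
    refine ⟨?_, (hmem _).mpr (by omega)⟩
    by_contra hlt
    have hne : π.idxOf (s + 1) ≠ π.idxOf s := fun h' => by
      have := (List.idxOf_inj ((hmem _).mpr (by omega))).mp h'
      omega
    have := h s (s + 1) ((List.pair_sublist_iff_idxOf hnd _ _).mpr
      ⟨by omega, (hmem _).mpr (by omega)⟩)
    rw [if_neg (by omega), if_neg (by omega)] at this
    omega
  · intro h x y hxy hP
    have hx : x < y ∧ y < v := by split_ifs at hP <;> omega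
    have hlt := ((List.pair_sublist_iff_idxOf hnd _ _).mp hxy).1
    have key : ∀ i, x + i < v → π.idxOf (x + i) ≤ π.idxOf x := fun i => by
      induction i with
      | zero => intro _; exact le_rfl
      | succ i ih =>
        intro hi
        have := ((List.pair_sublist_iff_idxOf hnd _ _).mp (h (x + i) (by omega))).1
        exact this.le.trans (ih (by omega))
    have := key (y - x) (by omega)
    rw [show x + (y - x) = y by omega] at this
    omega

theorem pair_succ_sublist_consRank {π : List ℕ} (hπ : π.Perm (List.range π.length)) {v : ℕ}
    (hv : v ≤ π.length) (s : ℕ) : [s, s + 1].Sublist (List.consRank v π) ↔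
      (s + 1 < v ∧ [s, s + 1].Sublist π) ∨ (s = v ∧ v < π.length) ∨
        (v < s ∧ [s - 1, s - 1 + 1].Sublist π) := by
  rw [List.pair_sublist_consRank hπ hv]
  constructor
  · rintro (⟨rfl, h1, h2⟩ | ⟨x, y, h, h1, h2⟩)
    · omega
    · split_ifs at h1 h2
      · obtain ⟨rfl, rfl⟩ : s = x + 1 ∧ y = x + 1 := by omega
        exact Or.inr (Or.inr ⟨by omega, h⟩)
      · omega
      · omega
      · subst h1 h2
        exact Or.inl ⟨by omega, h⟩
  · rintro (⟨h1, h2⟩ | ⟨rfl, h1⟩ | ⟨h1, h2⟩)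
    · exact Or.inr ⟨_, _, h2, if_neg (by omega), if_neg (by omega)⟩
    · exact Or.inl ⟨rfl, by omega, by omega⟩
    · refine Or.inr ⟨_, _, h2, ?_, ?_⟩
      · rw [if_pos (by omega)]; omega
      · rw [if_pos (by omega)]; omega

theorem succ_pair_sublist_consRank {π : List ℕ} (hπ : π.Perm (List.range π.length)) {v : ℕ}
    (hv : v ≤ π.length) (s : ℕ) : [s + 1, s].Sublist (List.consRank v π) ↔
      (s + 1 < v ∧ [s + 1, s].Sublist π) ∨ s + 1 = v ∨
        (v < s ∧ [s - 1 + 1, s - 1].Sublist π) := by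
  rw [List.pair_sublist_consRank hπ hv]
  constructor
  · rintro (⟨rfl, h1, h2⟩ | ⟨x, y, h, h1, h2⟩)
    · omega
    · split_ifs at h1 h2
      · obtain ⟨rfl, rfl⟩ : s = y + 1 ∧ x = y + 1 := by omega
        exact Or.inr (Or.inr ⟨by omega, h⟩)
      · omega
      · omega
      · subst h1 h2
        exact Or.inl ⟨by omega, h⟩
  · rintro (⟨h1, h2⟩ | rfl | ⟨h1, h2⟩)
    · exact Or.inr ⟨_, _, h2, if_neg (by omega), if_neg (by omega)⟩
    · exact Or.inl ⟨rfl, by omega, by omega⟩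
    · refine Or.inr ⟨_, _, h2, ?_, ?_⟩
      · rw [if_pos (by omega)]; omega
      · rw [if_pos (by omega)]; omega

/-- A new least letter in front comes before the letter that was least. -/
theorem pairFlags_consRank_zero_321 {π : List ℕ} (hπ : π.Perm (List.range π.length)) :
    pairFlags (fun s => [s, s + 1]) (List.consRank 0 π) =
      decide (π.length = 0) :: pairFlags (fun s => [s, s + 1]) π := by
  refine List.ext_getElem (by simp [length_pairFlags]) fun s h1 h2 => ?_
  rw [getElem_pairFlags, Bool.eq_iff_iff, Bool.not_eq_true', Bool.eq_false_iff, ne_eq,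
    List.isSublist_iff_sublist, pair_succ_sublist_consRank hπ (Nat.zero_le _)]
  cases s with
  | zero => simp
  | succ s => simp [getElem_pairFlags, Bool.eq_false_iff]

/-- A new letter of value `u + 1` in front comes before `u`, so the flag of `u` is `true`; it comes
before `u + 2`, so its own flag is `false` unless it is the largest letter. -/
theorem pairFlags_consRank_succ_321 {π : List ℕ} (hπ : π.Perm (List.range π.length)) {u : ℕ}
    (hu : u < π.length) :
    pairFlags (fun s => [s, s + 1]) (List.consRank (u + 1) π) =
      (pairFlags (fun s => [s, s + 1]) π).take u ++
        true :: decide (π.length ≤ u + 1) ::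
          (pairFlags (fun s => [s, s + 1]) π).drop (u + 1) := by
  refine List.ext_getElem (by simp [length_pairFlags]; omega) fun s h1 h2 => ?_
  rw [getElem_pairFlags, Bool.eq_iff_iff, Bool.not_eq_true', Bool.eq_false_iff, ne_eq,
    List.isSublist_iff_sublist, pair_succ_sublist_consRank hπ (by omega)]
  have hlen : ((pairFlags (fun s => [s, s + 1]) π).take u).length = u := by
    simp [length_pairFlags]; omega
  rcases lt_trichotomy s u with h | rfl | h
  · rw [List.getElem_append_left (by omega), List.getElem_take, getElem_pairFlags]
    have e1 : s + 1 < u + 1 := by omega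
    have e2 : s ≠ u + 1 := by omega
    have e3 : ¬ u + 1 < s := by omega
    simp [e1, e2, e3, Bool.eq_false_iff]
  · rw [List.getElem_append_right (by omega)]
    simp [hlen]
  · obtain ⟨i, rfl⟩ := Nat.exists_eq_add_of_lt h
    rw [List.getElem_append_right (by omega)]
    have e : u + i + 1 - ((pairFlags (fun s => [s, s + 1]) π).take u).length = i + 1 := by omega
    simp only [e, List.getElem_cons_succ]
    cases i with
    | zero => simp
    | succ i =>
      simp only [List.getElem_cons_succ, List.getElem_drop, getElem_pairFlags]
      have e2 : ¬ u + (i + 1) + 1 < u := by omega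
      have e3 : u + 1 + i = u + (i + 1) := by omega
      simp [e2, e3, Bool.eq_false_iff]

theorem pairFlags_consRank_zero_312 {π : List ℕ} (hπ : π.Perm (List.range π.length)) :
    pairFlags (fun s => [s + 1, s]) (List.consRank 0 π) =
      true :: pairFlags (fun s => [s + 1, s]) π := by
  refine List.ext_getElem (by simp [length_pairFlags]) fun s h1 h2 => ?_
  rw [getElem_pairFlags, Bool.eq_iff_iff, Bool.not_eq_true', Bool.eq_false_iff, ne_eq,
    List.isSublist_iff_sublist, succ_pair_sublist_consRank hπ (Nat.zero_le _)]
  cases s with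
  | zero => simp
  | succ s => simp [getElem_pairFlags, Bool.eq_false_iff]

/-- A new letter of value `u + 1` in front comes before `u`, so the flag of `u` is `false`; it comes
before `u + 2`, so its own flag is `true`. The smaller flags are `false` since the letters up to `u`
form a decreasing word; this allows the new flag `false` to be put at the front. -/
theorem pairFlags_consRank_succ_312 {π : List ℕ} (hπ : π.Perm (List.range π.length)) {u : ℕ}
    (hu : u < π.length) (hsub : ∀ s < u, [s + 1, s].Sublist π) :
    pairFlags (fun s => [s + 1, s]) (List.consRank (u + 1) π) =
      false :: ((pairFlags (fun s => [s + 1, s]) π).take u ++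
        true :: (pairFlags (fun s => [s + 1, s]) π).drop (u + 1)) := by
  refine List.ext_getElem (by simp [length_pairFlags]; omega) fun s h1 h2 => ?_
  rw [getElem_pairFlags, Bool.eq_iff_iff, Bool.not_eq_true', Bool.eq_false_iff, ne_eq,
    List.isSublist_iff_sublist, succ_pair_sublist_consRank hπ (by omega)]
  have hlen : ((pairFlags (fun s => [s + 1, s]) π).take u).length = u := by
    simp [length_pairFlags]; omega
  have hsmall : ∀ s ≤ u, (s + 1 < u + 1 ∧ [s + 1, s].Sublist π) ∨ s + 1 = u + 1 ∨
      (u + 1 < s ∧ [s - 1 + 1, s - 1].Sublist π) := fun s hs => by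
    rcases hs.lt_or_eq with h | rfl
    · exact Or.inl ⟨by omega, hsub s h⟩
    · exact Or.inr (Or.inl rfl)
  cases s with
  | zero =>
    refine iff_of_false (not_not.mpr (hsmall 0 (Nat.zero_le _))) ?_
    simp
  | succ s =>
    rw [List.getElem_cons_succ]
    rcases lt_trichotomy s u with h | rfl | h
    · rw [List.getElem_append_left (by omega), List.getElem_take, getElem_pairFlags]
      refine iff_of_false (not_not.mpr (hsmall _ h)) ?_
      simpa using hsub s h
    · rw [List.getElem_append_right (by omega)]
      simp [hlen]
    · obtain ⟨i, rfl⟩ := Nat.exists_eq_add_of_lt h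
      rw [List.getElem_append_right (by omega)]
      have e : u + i + 1 - ((pairFlags (fun s => [s + 1, s]) π).take u).length = i + 1 := by omega
      have e1 : ¬ u + i + 1 + 1 < u := by omega
      have e2 : u + 1 + i = u + i + 1 := by omega
      have e3 : u + i + 1 + 1 ≠ u := by omega
      simp only [e, List.getElem_cons_succ, List.getElem_drop, getElem_pairFlags]
      simp [e1, e2, e3, Bool.eq_false_iff]

theorem pathCount_321 (p : List Bool) :
    pathCount (dashed [[3], [2], [1]]).WordAvoids p [] = stackRun steps321 p emptyWeight [] := by
  refine pathCount_eq_stackRun (by decide) (fun s => [s, s + 1]) steps321 ?_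
    (fun π s hπ => List.pair_sublist_eraseMin hπ _ _) p
  intro π hπ hA B _ hB φ
  rw [Finset.sum_range_succ', if_pos ((hB 0).mpr ((wordAvoids_consRank_321 hπ hA
    (Nat.zero_le _)).mpr fun s hs => absurd hs (Nat.not_lt_zero _))),
    pairFlags_consRank_zero_321 hπ]
  by_cases hne : π = []
  · subst hne
    simp [pairFlags, steps321]
  · obtain ⟨d, hd⟩ := exists_pairFlags_eq_append (g := fun s => [s, s + 1]) hne fun h => by
      have h1 := (List.mem_iff_lt_of_perm_range hπ).mp
        (h.subset (show π.length - 1 + 1 ∈ _ by simp))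
      omega
    have hlen : (d ++ [true]).length = π.length := by rw [← hd, length_pairFlags]
    have hsteps : steps321 (d ++ [true]) =
        (false :: (d ++ [true])) :: stepsPlus321 (d ++ [true]) := by
      cases d <;> rfl
    have h0 : π.length ≠ 0 := fun h => hne (List.length_eq_zero_iff.mp h)
    rw [hd, hsteps, List.map_cons, List.sum_cons, ← sum_stepsPlus321, add_comm, hlen]
    simp only [h0, decide_false]
    refine congrArg _ (Finset.sum_congr rfl fun u hu => ?_)
    have hu' := Finset.mem_range.mp hu
    rw [pairFlags_consRank_succ_321 hπ hu', hd]
    refine if_congr ?_ rfl rfl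
    rw [hB, wordAvoids_consRank_321 hπ hA hu', ← hd, forall_mem_take_pairFlags hu'.le,
      Nat.succ_sub_one]

theorem pathCount_312 (p : List Bool) :
    pathCount (dashed [[3], [1], [2]]).WordAvoids p [] = stackRun steps312 p emptyWeight [] := by
  refine pathCount_eq_stackRun (by decide) (fun s => [s + 1, s]) steps312 ?_
    (fun π s hπ => List.pair_sublist_eraseMin hπ _ _) p
  intro π hπ hA B _ hB φ
  rw [Finset.sum_range_succ', if_pos ((hB 0).mpr ((wordAvoids_consRank_312 hπ hA
    (Nat.zero_le _)).mpr fun s hs => absurd hs (Nat.not_lt_zero _))),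
    pairFlags_consRank_zero_312 hπ]
  by_cases hne : π = []
  · subst hne
    simp [pairFlags, steps312]
  · obtain ⟨d, hd⟩ := exists_pairFlags_eq_append (g := fun s => [s + 1, s]) hne fun h => by
      have h1 := (List.mem_iff_lt_of_perm_range hπ).mp
        (h.subset (show π.length - 1 + 1 ∈ _ by simp))
      omega
    have hlen : (d ++ [true]).length = π.length := by rw [← hd, length_pairFlags]
    have hsteps : steps312 (d ++ [true]) = (false :: (d ++ [true])) ::
        (true :: (d ++ [true])) :: (flips (d ++ [true])).map (List.cons false) := by
      cases d <;> rfl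
    rw [hd, hsteps, List.map_cons, List.map_cons, List.sum_cons, List.sum_cons, List.map_map,
      add_left_comm, Function.comp_def, ← sum_flips_add d fun c => φ (false :: c), add_comm, hlen]
    refine congrArg _ (Finset.sum_congr rfl fun u hu => ?_)
    have hu' := Finset.mem_range.mp hu
    have hiff : B (u + 1) ↔ ∀ s < u, [s + 1, s].Sublist π := by
      rw [hB, wordAvoids_consRank_312 hπ hA hu', Nat.succ_sub_one]
    rw [← hd]
    by_cases hBu : B (u + 1)
    · rw [if_pos hBu, if_pos ((forall_mem_take_pairFlags hu'.le).mpr (hiff.mp hBu)),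
        pairFlags_consRank_succ_312 hπ hu' (hiff.mp hBu)]
    · rw [if_neg hBu, if_neg fun h => hBu (hiff.mpr ((forall_mem_take_pairFlags hu'.le).mp h))]

/-! ### Shape-Wilf-equivalences -/

/-- On every board there is at most one placement that avoids `12`, and at most one that avoids
`21`, both under the same condition on the board. -/
theorem shapeWilfEquiv_12_21 : ShapeWilfEquiv (dashed [[1], [2]]) (dashed [[2], [1]]) :=
  fun m D hD => by
    rw [boardCount_eq_pathCount (by decide) (by decide) hD,
      boardCount_eq_pathCount (by decide) (by decide) hD, pathCount_12, pathCount_21]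

theorem shapeWilfEquiv_123_321 :
    ShapeWilfEquiv (dashed [[1], [2], [3]]) (dashed [[3], [2], [1]]) :=
  fun m D hD => by
    rw [boardCount_eq_pathCount (by decide) (by decide) hD,
      boardCount_eq_pathCount (by decide) (by decide) hD, pathCount_123, pathCount_321,
      stackRun_steps321_eq_thresholdCount]

theorem shapeWilfEquiv_123_132 :
    ShapeWilfEquiv (dashed [[1], [2], [3]]) (dashed [[1], [3], [2]]) :=
  fun m D hD => by
    rw [boardCount_eq_pathCount (by decide) (by decide) hD,
      boardCount_eq_pathCount (by decide) (by decide) hD, pathCount_123, pathCount_132]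

/-- The patterns `312` and `231` are inverse to each other, and inversion of placements transposes
the board. -/
theorem shapeWilfEquiv_312_231 :
    ShapeWilfEquiv (dashed [[3], [1], [2]]) (dashed [[2], [3], [1]]) :=
  fun m D hD => by
    have hD' : IsBoard fun x y => D y x := fun x x' y y' hx hy => hD hy hx
    have hsymm : (show Equiv.Perm (Fin 3) from (dashed [[3], [1], [2]]).σ).symm =
        (dashed [[2], [3], [1]]).σ := by
      refine Equiv.ext fun i => ?_
      rw [Equiv.symm_apply_eq]
      revert i
      decide
    have h : inverse (dashed [[3], [1], [2]]) = dashed [[2], [3], [1]] :=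
      eq_of_ofFn_eq
        (congrArg (fun e : Equiv.Perm (Fin 3) => List.ofFn fun i => (e i : ℕ)) hsymm)
        (by decide)
    rw [← h, show D = fun x y => (fun a b => D b a) y x from rfl,
      boardCount_inverse (by decide) m fun a b => D b a,
      boardCount_eq_pathCount (by decide) (by decide) hD',
      boardCount_eq_pathCount (by decide) (by decide) hD, pathCount_312, pathCount_312,
      boundary_transpose hD, stackRun_steps312_transposePath]

end VincularPattern

/-! ### Direct sums with a varying lower summand -/

namespace VincularPattern

theorem complement_reverse_directSum (p q : VincularPattern) :
    (directSum p q).complement.reverse =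
      directSum q.complement.reverse p.complement.reverse := by
  refine eq_of_ofFn_eq ?_ ?_
  · refine List.ext_getElem (by simp; omega) fun i h1 h2 => ?_
    simp only [List.length_ofFn] at h1 h2
    simp only [List.getElem_ofFn]
    change ((Fin.rev ((directSum p q).σ (Fin.rev ⟨i, h1⟩)) : Fin (p.k + q.k)) : ℕ) = _
    rcases lt_or_ge i q.k with h | h
    · have e1 : (Fin.rev ⟨i, h1⟩ : Fin (p.k + q.k)) = Fin.natAdd p.k (Fin.rev ⟨i, h⟩) :=
        Fin.ext (by simp [Fin.rev]; omega)
      have e2 := directSum_σ_castAdd q.complement.reverse p.complement.reverse ⟨i, h⟩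
      change (directSum q.complement.reverse p.complement.reverse).σ ⟨i, h2⟩ = _ at e2
      rw [e1, directSum_σ_natAdd, e2]
      simp [Fin.rev]
      omega
    · have h' : i - q.k < p.k := by change i < p.k + q.k at h1; omega
      have e1 : (Fin.rev ⟨i, h1⟩ : Fin (p.k + q.k)) =
          Fin.castAdd q.k (Fin.rev ⟨i - q.k, h'⟩) :=
        Fin.ext (by simp [Fin.rev]; omega)
      have e2 := directSum_σ_natAdd q.complement.reverse p.complement.reverse ⟨i - q.k, h'⟩
      have e3 : (Fin.natAdd q.k ⟨i - q.k, h'⟩ : Fin (q.k + p.k)) = ⟨i, h2⟩ :=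
        Fin.ext (by simp; omega)
      change (directSum q.complement.reverse p.complement.reverse).σ
        (Fin.natAdd q.k ⟨i - q.k, h'⟩) = _ at e2
      rw [e3] at e2
      rw [e1, directSum_σ_castAdd, e2]
      simp [Fin.rev]
      omega
  · have hp : ∀ j ∈ p.X, 1 ≤ j ∧ j ≤ p.k - 1 := fun j hj => Finset.mem_Icc.mp (p.X_subset hj)
    change (p.X ∪ q.X.image (· + p.k)).image (p.k + q.k - ·) =
      q.X.image (q.k - ·) ∪ (p.X.image (p.k - ·)).image (· + q.k)
    rw [Finset.image_union, Finset.image_image, Finset.image_image, Finset.union_comm]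
    congr 1
    · refine Finset.image_congr fun j _ => ?_
      simp only [Function.comp_apply]
      omega
    · refine Finset.image_congr fun j hj => ?_
      have := hp j hj
      simp only [Function.comp_apply]
      omega

theorem wilfEquiv_complement_reverse (p : VincularPattern) :
    WilfEquiv p.complement.reverse p :=
  (wilfEquiv_reverse p.complement).trans (wilfEquiv_complement p)

instance (p : VincularPattern) : Decidable p.IsConsecutive :=
  inferInstanceAs (Decidable (_ = _))

theorem IsConsecutive.complement_reverse {p : VincularPattern} (hp : p.IsConsecutive) :
    p.complement.reverse.IsConsecutive := by
  change p.X.image (p.k - ·) = Finset.Icc 1 (p.k - 1)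
  rw [show p.X = Finset.Icc 1 (p.k - 1) from hp]
  ext x
  simp only [Finset.mem_image, Finset.mem_Icc]
  exact ⟨by rintro ⟨j, hj, rfl⟩; omega, fun hx => ⟨p.k - x, by omega, by omega⟩⟩

/-- The lower summand of a direct sum may be replaced, too, by reversal and complementation. -/
theorem wilfEquiv_directSum_left_of_isConsecutive {σ σ' : VincularPattern} (hk : 0 < σ.k)
    (hk' : 0 < σ'.k) (hσ : σ.IsConsecutive) (hσ' : σ'.IsConsecutive) (h : WilfEquiv σ σ')
    (τ : VincularPattern) : WilfEquiv (directSum σ τ) (directSum σ' τ) := by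
  refine (wilfEquiv_complement_reverse _).symm.trans
    (WilfEquiv.trans ?_ (wilfEquiv_complement_reverse _))
  rw [complement_reverse_directSum, complement_reverse_directSum]
  exact wilfEquiv_directSum_of_isConsecutive _ hk hk' hσ.complement_reverse hσ'.complement_reverse
    ((wilfEquiv_complement_reverse σ).trans (h.trans (wilfEquiv_complement_reverse σ').symm))

theorem WilfEquiv.of_eq {p p' q q' : VincularPattern} (h : WilfEquiv p q) (hp : p = p')
    (hq : q = q') : WilfEquiv p' q' := hp ▸ hq ▸ h

/-! ### Patterns with at most five letters -/

theorem wilfEquiv_consecutive_12_21 : WilfEquiv (dashed [[1, 2]]) (dashed [[2, 1]]) :=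
  (wilfEquiv_reverse (dashed [[2, 1]])).of_eq (eq_of_ofFn_eq (by decide) (by decide)) rfl

theorem wilfEquiv_consecutive_123_321 : WilfEquiv (dashed [[1, 2, 3]]) (dashed [[3, 2, 1]]) :=
  (wilfEquiv_reverse (dashed [[3, 2, 1]])).of_eq (eq_of_ofFn_eq (by decide) (by decide)) rfl

theorem wilfEquiv_consecutive_213_231 : WilfEquiv (dashed [[2, 1, 3]]) (dashed [[2, 3, 1]]) :=
  (wilfEquiv_complement (dashed [[2, 3, 1]])).of_eq (eq_of_ofFn_eq (by decide) (by decide)) rfl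

theorem wilfEquiv_consecutive_231_132 : WilfEquiv (dashed [[2, 3, 1]]) (dashed [[1, 3, 2]]) :=
  (wilfEquiv_reverse (dashed [[1, 3, 2]])).of_eq (eq_of_ofFn_eq (by decide) (by decide)) rfl

theorem wilfEquiv_consecutive_132_312 : WilfEquiv (dashed [[1, 3, 2]]) (dashed [[3, 1, 2]]) :=
  (wilfEquiv_complement (dashed [[3, 1, 2]])).of_eq (eq_of_ofFn_eq (by decide) (by decide)) rfl

/-- The block `12` at the beginning, below all other letters, may be replaced by `21`. -/
theorem wilfEquiv_directSum_12_21 (τ : VincularPattern) :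
    WilfEquiv (directSum (dashed [[1, 2]]) τ) (directSum (dashed [[2, 1]]) τ) :=
  wilfEquiv_directSum_left_of_isConsecutive (by decide) (by decide) (by decide) (by decide)
    wilfEquiv_consecutive_12_21 τ

theorem wilfEquiv_123_4_321_4 :
    WilfEquiv (dashed [[1, 2, 3], [4]]) (dashed [[3, 2, 1], [4]]) :=
  (wilfEquiv_directSum_left_of_isConsecutive (by decide) (by decide) (by decide)
    (by decide) wilfEquiv_consecutive_123_321 (dashed [[1]])).of_eq
    (eq_of_ofFn_eq (by decide) (by decide)) (eq_of_ofFn_eq (by decide) (by decide))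

theorem wilfEquiv_213_4_231_4 :
    WilfEquiv (dashed [[2, 1, 3], [4]]) (dashed [[2, 3, 1], [4]]) :=
  (wilfEquiv_directSum_left_of_isConsecutive (by decide) (by decide) (by decide)
    (by decide) wilfEquiv_consecutive_213_231 (dashed [[1]])).of_eq
    (eq_of_ofFn_eq (by decide) (by decide)) (eq_of_ofFn_eq (by decide) (by decide))

theorem wilfEquiv_231_4_132_4 :
    WilfEquiv (dashed [[2, 3, 1], [4]]) (dashed [[1, 3, 2], [4]]) :=
  (wilfEquiv_directSum_left_of_isConsecutive (by decide) (by decide) (by decide)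
    (by decide) wilfEquiv_consecutive_231_132 (dashed [[1]])).of_eq
    (eq_of_ofFn_eq (by decide) (by decide)) (eq_of_ofFn_eq (by decide) (by decide))

theorem wilfEquiv_132_4_312_4 :
    WilfEquiv (dashed [[1, 3, 2], [4]]) (dashed [[3, 1, 2], [4]]) :=
  (wilfEquiv_directSum_left_of_isConsecutive (by decide) (by decide) (by decide)
    (by decide) wilfEquiv_consecutive_132_312 (dashed [[1]])).of_eq
    (eq_of_ofFn_eq (by decide) (by decide)) (eq_of_ofFn_eq (by decide) (by decide))

theorem wilfEquiv_12_3_4_12_4_3 :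
    WilfEquiv (dashed [[1, 2], [3], [4]]) (dashed [[1, 2], [4], [3]]) :=
  (wilfEquiv_directSum_of_shapeWilfEquiv (dashed [[1, 2]]) (by decide) (by decide) (by decide)
    (by decide) shapeWilfEquiv_12_21).of_eq (eq_of_ofFn_eq (by decide) (by decide))
    (eq_of_ofFn_eq (by decide) (by decide))

theorem wilfEquiv_12_3_4_21_3_4 :
    WilfEquiv (dashed [[1, 2], [3], [4]]) (dashed [[2, 1], [3], [4]]) :=
  (wilfEquiv_directSum_12_21 (dashed [[1], [2]])).of_eq
    (eq_of_ofFn_eq (by decide) (by decide)) (eq_of_ofFn_eq (by decide) (by decide))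

theorem wilfEquiv_12_4_3_21_4_3 :
    WilfEquiv (dashed [[1, 2], [4], [3]]) (dashed [[2, 1], [4], [3]]) :=
  (wilfEquiv_directSum_12_21 (dashed [[2], [1]])).of_eq
    (eq_of_ofFn_eq (by decide) (by decide)) (eq_of_ofFn_eq (by decide) (by decide))

theorem wilfEquiv_12_34_12_43 :
    WilfEquiv (dashed [[1, 2], [3, 4]]) (dashed [[1, 2], [4, 3]]) :=
  (wilfEquiv_directSum_of_isConsecutive (dashed [[1, 2]]) (by decide) (by decide) (by decide)
    (by decide) wilfEquiv_consecutive_12_21).of_eq (eq_of_ofFn_eq (by decide) (by decide))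
    (eq_of_ofFn_eq (by decide) (by decide))

theorem wilfEquiv_12_34_21_34 :
    WilfEquiv (dashed [[1, 2], [3, 4]]) (dashed [[2, 1], [3, 4]]) :=
  (wilfEquiv_directSum_12_21 (dashed [[1, 2]])).of_eq
    (eq_of_ofFn_eq (by decide) (by decide)) (eq_of_ofFn_eq (by decide) (by decide))

theorem wilfEquiv_12_43_21_43 :
    WilfEquiv (dashed [[1, 2], [4, 3]]) (dashed [[2, 1], [4, 3]]) :=
  (wilfEquiv_directSum_12_21 (dashed [[2, 1]])).of_eq
    (eq_of_ofFn_eq (by decide) (by decide)) (eq_of_ofFn_eq (by decide) (by decide))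

theorem wilfEquiv_12_345_12_543 :
    WilfEquiv (dashed [[1, 2], [3, 4, 5]]) (dashed [[1, 2], [5, 4, 3]]) :=
  (wilfEquiv_directSum_of_isConsecutive (dashed [[1, 2]]) (by decide) (by decide) (by decide)
    (by decide) wilfEquiv_consecutive_123_321).of_eq (eq_of_ofFn_eq (by decide) (by decide))
    (eq_of_ofFn_eq (by decide) (by decide))

theorem wilfEquiv_12_345_21_345 :
    WilfEquiv (dashed [[1, 2], [3, 4, 5]]) (dashed [[2, 1], [3, 4, 5]]) :=
  (wilfEquiv_directSum_12_21 (dashed [[1, 2, 3]])).of_eq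
    (eq_of_ofFn_eq (by decide) (by decide)) (eq_of_ofFn_eq (by decide) (by decide))

theorem wilfEquiv_12_543_21_543 :
    WilfEquiv (dashed [[1, 2], [5, 4, 3]]) (dashed [[2, 1], [5, 4, 3]]) :=
  (wilfEquiv_directSum_12_21 (dashed [[3, 2, 1]])).of_eq
    (eq_of_ofFn_eq (by decide) (by decide)) (eq_of_ofFn_eq (by decide) (by decide))

theorem wilfEquiv_12_435_12_453 :
    WilfEquiv (dashed [[1, 2], [4, 3, 5]]) (dashed [[1, 2], [4, 5, 3]]) :=
  (wilfEquiv_directSum_of_isConsecutive (dashed [[1, 2]]) (by decide) (by decide) (by decide)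
    (by decide) wilfEquiv_consecutive_213_231).of_eq (eq_of_ofFn_eq (by decide) (by decide))
    (eq_of_ofFn_eq (by decide) (by decide))

theorem wilfEquiv_12_453_12_354 :
    WilfEquiv (dashed [[1, 2], [4, 5, 3]]) (dashed [[1, 2], [3, 5, 4]]) :=
  (wilfEquiv_directSum_of_isConsecutive (dashed [[1, 2]]) (by decide) (by decide) (by decide)
    (by decide) wilfEquiv_consecutive_231_132).of_eq (eq_of_ofFn_eq (by decide) (by decide))
    (eq_of_ofFn_eq (by decide) (by decide))

theorem wilfEquiv_12_354_12_534 :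
    WilfEquiv (dashed [[1, 2], [3, 5, 4]]) (dashed [[1, 2], [5, 3, 4]]) :=
  (wilfEquiv_directSum_of_isConsecutive (dashed [[1, 2]]) (by decide) (by decide) (by decide)
    (by decide) wilfEquiv_consecutive_132_312).of_eq (eq_of_ofFn_eq (by decide) (by decide))
    (eq_of_ofFn_eq (by decide) (by decide))

theorem wilfEquiv_21_435_21_453 :
    WilfEquiv (dashed [[2, 1], [4, 3, 5]]) (dashed [[2, 1], [4, 5, 3]]) :=
  (wilfEquiv_directSum_of_isConsecutive (dashed [[2, 1]]) (by decide) (by decide) (by decide)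
    (by decide) wilfEquiv_consecutive_213_231).of_eq (eq_of_ofFn_eq (by decide) (by decide))
    (eq_of_ofFn_eq (by decide) (by decide))

theorem wilfEquiv_21_453_21_354 :
    WilfEquiv (dashed [[2, 1], [4, 5, 3]]) (dashed [[2, 1], [3, 5, 4]]) :=
  (wilfEquiv_directSum_of_isConsecutive (dashed [[2, 1]]) (by decide) (by decide) (by decide)
    (by decide) wilfEquiv_consecutive_231_132).of_eq (eq_of_ofFn_eq (by decide) (by decide))
    (eq_of_ofFn_eq (by decide) (by decide))

theorem wilfEquiv_21_354_21_534 :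
    WilfEquiv (dashed [[2, 1], [3, 5, 4]]) (dashed [[2, 1], [5, 3, 4]]) :=
  (wilfEquiv_directSum_of_isConsecutive (dashed [[2, 1]]) (by decide) (by decide) (by decide)
    (by decide) wilfEquiv_consecutive_132_312).of_eq (eq_of_ofFn_eq (by decide) (by decide))
    (eq_of_ofFn_eq (by decide) (by decide))

theorem wilfEquiv_12_435_21_435 :
    WilfEquiv (dashed [[1, 2], [4, 3, 5]]) (dashed [[2, 1], [4, 3, 5]]) :=
  (wilfEquiv_directSum_12_21 (dashed [[2, 1, 3]])).of_eq
    (eq_of_ofFn_eq (by decide) (by decide)) (eq_of_ofFn_eq (by decide) (by decide))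

theorem wilfEquiv_123_4_5_321_4_5 :
    WilfEquiv (dashed [[1, 2, 3], [4], [5]]) (dashed [[3, 2, 1], [4], [5]]) :=
  (wilfEquiv_directSum_left_of_isConsecutive (by decide) (by decide) (by decide)
    (by decide) wilfEquiv_consecutive_123_321 (dashed [[1], [2]])).of_eq
    (eq_of_ofFn_eq (by decide) (by decide)) (eq_of_ofFn_eq (by decide) (by decide))

theorem wilfEquiv_213_4_5_231_4_5 :
    WilfEquiv (dashed [[2, 1, 3], [4], [5]]) (dashed [[2, 3, 1], [4], [5]]) :=
  (wilfEquiv_directSum_left_of_isConsecutive (by decide) (by decide) (by decide)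
    (by decide) wilfEquiv_consecutive_213_231 (dashed [[1], [2]])).of_eq
    (eq_of_ofFn_eq (by decide) (by decide)) (eq_of_ofFn_eq (by decide) (by decide))

theorem wilfEquiv_231_4_5_132_4_5 :
    WilfEquiv (dashed [[2, 3, 1], [4], [5]]) (dashed [[1, 3, 2], [4], [5]]) :=
  (wilfEquiv_directSum_left_of_isConsecutive (by decide) (by decide) (by decide)
    (by decide) wilfEquiv_consecutive_231_132 (dashed [[1], [2]])).of_eq
    (eq_of_ofFn_eq (by decide) (by decide)) (eq_of_ofFn_eq (by decide) (by decide))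

theorem wilfEquiv_132_4_5_312_4_5 :
    WilfEquiv (dashed [[1, 3, 2], [4], [5]]) (dashed [[3, 1, 2], [4], [5]]) :=
  (wilfEquiv_directSum_left_of_isConsecutive (by decide) (by decide) (by decide)
    (by decide) wilfEquiv_consecutive_132_312 (dashed [[1], [2]])).of_eq
    (eq_of_ofFn_eq (by decide) (by decide)) (eq_of_ofFn_eq (by decide) (by decide))

theorem wilfEquiv_12_3_4_5_12_5_4_3 :
    WilfEquiv (dashed [[1, 2], [3], [4], [5]]) (dashed [[1, 2], [5], [4], [3]]) :=
  (wilfEquiv_directSum_of_shapeWilfEquiv (dashed [[1, 2]]) (by decide) (by decide) (by decide)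
    (by decide) shapeWilfEquiv_123_321).of_eq (eq_of_ofFn_eq (by decide) (by decide))
    (eq_of_ofFn_eq (by decide) (by decide))

theorem wilfEquiv_12_3_4_5_12_3_5_4 :
    WilfEquiv (dashed [[1, 2], [3], [4], [5]]) (dashed [[1, 2], [3], [5], [4]]) :=
  (wilfEquiv_directSum_of_shapeWilfEquiv (dashed [[1, 2]]) (by decide) (by decide) (by decide)
    (by decide) shapeWilfEquiv_123_132).of_eq (eq_of_ofFn_eq (by decide) (by decide))
    (eq_of_ofFn_eq (by decide) (by decide))

theorem wilfEquiv_21_3_4_5_21_5_4_3 :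
    WilfEquiv (dashed [[2, 1], [3], [4], [5]]) (dashed [[2, 1], [5], [4], [3]]) :=
  (wilfEquiv_directSum_of_shapeWilfEquiv (dashed [[2, 1]]) (by decide) (by decide) (by decide)
    (by decide) shapeWilfEquiv_123_321).of_eq (eq_of_ofFn_eq (by decide) (by decide))
    (eq_of_ofFn_eq (by decide) (by decide))

theorem wilfEquiv_21_3_4_5_21_3_5_4 :
    WilfEquiv (dashed [[2, 1], [3], [4], [5]]) (dashed [[2, 1], [3], [5], [4]]) :=
  (wilfEquiv_directSum_of_shapeWilfEquiv (dashed [[2, 1]]) (by decide) (by decide) (by decide)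
    (by decide) shapeWilfEquiv_123_132).of_eq (eq_of_ofFn_eq (by decide) (by decide))
    (eq_of_ofFn_eq (by decide) (by decide))

theorem wilfEquiv_12_3_4_5_21_3_4_5 :
    WilfEquiv (dashed [[1, 2], [3], [4], [5]]) (dashed [[2, 1], [3], [4], [5]]) :=
  (wilfEquiv_directSum_12_21 (dashed [[1], [2], [3]])).of_eq
    (eq_of_ofFn_eq (by decide) (by decide)) (eq_of_ofFn_eq (by decide) (by decide))

theorem wilfEquiv_12_4_3_5_21_4_3_5 :
    WilfEquiv (dashed [[1, 2], [4], [3], [5]]) (dashed [[2, 1], [4], [3], [5]]) :=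
  (wilfEquiv_directSum_12_21 (dashed [[2], [1], [3]])).of_eq
    (eq_of_ofFn_eq (by decide) (by decide)) (eq_of_ofFn_eq (by decide) (by decide))

theorem wilfEquiv_12_5_3_4_12_4_5_3 :
    WilfEquiv (dashed [[1, 2], [5], [3], [4]]) (dashed [[1, 2], [4], [5], [3]]) :=
  (wilfEquiv_directSum_of_shapeWilfEquiv (dashed [[1, 2]]) (by decide) (by decide) (by decide)
    (by decide) shapeWilfEquiv_312_231).of_eq (eq_of_ofFn_eq (by decide) (by decide))
    (eq_of_ofFn_eq (by decide) (by decide))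

theorem wilfEquiv_12_5_3_4_21_5_3_4 :
    WilfEquiv (dashed [[1, 2], [5], [3], [4]]) (dashed [[2, 1], [5], [3], [4]]) :=
  (wilfEquiv_directSum_12_21 (dashed [[3], [1], [2]])).of_eq
    (eq_of_ofFn_eq (by decide) (by decide)) (eq_of_ofFn_eq (by decide) (by decide))

theorem wilfEquiv_12_4_5_3_21_4_5_3 :
    WilfEquiv (dashed [[1, 2], [4], [5], [3]]) (dashed [[2, 1], [4], [5], [3]]) :=
  (wilfEquiv_directSum_12_21 (dashed [[2], [3], [1]])).of_eq
    (eq_of_ofFn_eq (by decide) (by decide)) (eq_of_ofFn_eq (by decide) (by decide))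

end VincularPattern

theorem mainTheorem4 :
    -- a: 123-4 ~ 321-4
    (VincularPattern.WilfEquiv (.dashed [[1, 2, 3], [4]]) (.dashed [[3, 2, 1], [4]])) ∧
    -- b: 213-4 ~ 231-4 ~ 132-4 ~ 312-4
    (VincularPattern.WilfEquiv (.dashed [[2, 1, 3], [4]]) (.dashed [[2, 3, 1], [4]]) ∧
      VincularPattern.WilfEquiv (.dashed [[2, 3, 1], [4]]) (.dashed [[1, 3, 2], [4]]) ∧
      VincularPattern.WilfEquiv (.dashed [[1, 3, 2], [4]]) (.dashed [[3, 1, 2], [4]])) ∧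
    -- c: 12-3-4 ~ 12-4-3 ~ 21-3-4 ~ 21-4-3
    (VincularPattern.WilfEquiv (.dashed [[1, 2], [3], [4]]) (.dashed [[1, 2], [4], [3]]) ∧
      VincularPattern.WilfEquiv (.dashed [[1, 2], [4], [3]]) (.dashed [[2, 1], [3], [4]]) ∧
      VincularPattern.WilfEquiv (.dashed [[2, 1], [3], [4]]) (.dashed [[2, 1], [4], [3]])) ∧
    -- d: 12-34 ~ 12-43 ~ 21-34 ~ 21-43
    (VincularPattern.WilfEquiv (.dashed [[1, 2], [3, 4]]) (.dashed [[1, 2], [4, 3]]) ∧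
      VincularPattern.WilfEquiv (.dashed [[1, 2], [4, 3]]) (.dashed [[2, 1], [3, 4]]) ∧
      VincularPattern.WilfEquiv (.dashed [[2, 1], [3, 4]]) (.dashed [[2, 1], [4, 3]])) ∧
    -- e: 12-345 ~ 21-345 ~ 12-543 ~ 21-543
    (VincularPattern.WilfEquiv (.dashed [[1, 2], [3, 4, 5]]) (.dashed [[2, 1], [3, 4, 5]]) ∧
      VincularPattern.WilfEquiv (.dashed [[2, 1], [3, 4, 5]]) (.dashed [[1, 2], [5, 4, 3]]) ∧
      VincularPattern.WilfEquiv (.dashed [[1, 2], [5, 4, 3]]) (.dashed [[2, 1], [5, 4, 3]])) ∧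
    -- f: 12-435 ~ 12-453 ~ 12-534 ~ 12-354 ~ 21-435 ~ 21-453 ~ 21-534 ~ 21-354
    (VincularPattern.WilfEquiv (.dashed [[1, 2], [4, 3, 5]]) (.dashed [[1, 2], [4, 5, 3]]) ∧
      VincularPattern.WilfEquiv (.dashed [[1, 2], [4, 5, 3]]) (.dashed [[1, 2], [5, 3, 4]]) ∧
      VincularPattern.WilfEquiv (.dashed [[1, 2], [5, 3, 4]]) (.dashed [[1, 2], [3, 5, 4]]) ∧
      VincularPattern.WilfEquiv (.dashed [[1, 2], [3, 5, 4]]) (.dashed [[2, 1], [4, 3, 5]]) ∧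
      VincularPattern.WilfEquiv (.dashed [[2, 1], [4, 3, 5]]) (.dashed [[2, 1], [4, 5, 3]]) ∧
      VincularPattern.WilfEquiv (.dashed [[2, 1], [4, 5, 3]]) (.dashed [[2, 1], [5, 3, 4]]) ∧
      VincularPattern.WilfEquiv (.dashed [[2, 1], [5, 3, 4]]) (.dashed [[2, 1], [3, 5, 4]])) ∧
    -- g: 123-4-5 ~ 321-4-5
    (VincularPattern.WilfEquiv (.dashed [[1, 2, 3], [4], [5]]) (.dashed [[3, 2, 1], [4], [5]])) ∧
    -- h: 213-4-5 ~ 231-4-5 ~ 132-4-5 ~ 312-4-5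
    (VincularPattern.WilfEquiv (.dashed [[2, 1, 3], [4], [5]]) (.dashed [[2, 3, 1], [4], [5]]) ∧
      VincularPattern.WilfEquiv (.dashed [[2, 3, 1], [4], [5]]) (.dashed [[1, 3, 2], [4], [5]]) ∧
      VincularPattern.WilfEquiv (.dashed [[1, 3, 2], [4], [5]]) (.dashed [[3, 1, 2], [4], [5]])) ∧
    -- i: 12-3-4-5 ~ 12-5-4-3 ~ 12-3-5-4 ~ 21-3-4-5 ~ 21-5-4-3 ~ 21-3-5-4
    (VincularPattern.WilfEquiv (.dashed [[1, 2], [3], [4], [5]]) (.dashed [[1, 2], [5], [4], [3]]) ∧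
      VincularPattern.WilfEquiv (.dashed [[1, 2], [5], [4], [3]]) (.dashed [[1, 2], [3], [5], [4]]) ∧
      VincularPattern.WilfEquiv (.dashed [[1, 2], [3], [5], [4]]) (.dashed [[2, 1], [3], [4], [5]]) ∧
      VincularPattern.WilfEquiv (.dashed [[2, 1], [3], [4], [5]]) (.dashed [[2, 1], [5], [4], [3]]) ∧
      VincularPattern.WilfEquiv (.dashed [[2, 1], [5], [4], [3]]) (.dashed [[2, 1], [3], [5], [4]])) ∧
    -- j: 12-4-3-5 ~ 21-4-3-5
    (VincularPattern.WilfEquiv (.dashed [[1, 2], [4], [3], [5]]) (.dashed [[2, 1], [4], [3], [5]])) ∧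
    -- k: 12-5-3-4 ~ 12-4-5-3 ~ 21-5-3-4 ~ 21-4-5-3
    (VincularPattern.WilfEquiv (.dashed [[1, 2], [5], [3], [4]]) (.dashed [[1, 2], [4], [5], [3]]) ∧
      VincularPattern.WilfEquiv (.dashed [[1, 2], [4], [5], [3]]) (.dashed [[2, 1], [5], [3], [4]]) ∧
      VincularPattern.WilfEquiv (.dashed [[2, 1], [5], [3], [4]]) (.dashed [[2, 1], [4], [5], [3]])) := by
  open VincularPattern in
  exact ⟨wilfEquiv_123_4_321_4,
    ⟨wilfEquiv_213_4_231_4,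
     wilfEquiv_231_4_132_4,
     wilfEquiv_132_4_312_4⟩,
    ⟨wilfEquiv_12_3_4_12_4_3,
     wilfEquiv_12_3_4_12_4_3.symm.trans wilfEquiv_12_3_4_21_3_4,
     wilfEquiv_12_3_4_21_3_4.symm.trans
        (wilfEquiv_12_3_4_12_4_3.trans wilfEquiv_12_4_3_21_4_3)⟩,
    ⟨wilfEquiv_12_34_12_43,
     wilfEquiv_12_34_12_43.symm.trans wilfEquiv_12_34_21_34,
     wilfEquiv_12_34_21_34.symm.trans
        (wilfEquiv_12_34_12_43.trans wilfEquiv_12_43_21_43)⟩,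
    ⟨wilfEquiv_12_345_21_345,
     wilfEquiv_12_345_21_345.symm.trans wilfEquiv_12_345_12_543,
     wilfEquiv_12_543_21_543⟩,
    ⟨wilfEquiv_12_435_12_453,
     wilfEquiv_12_453_12_354.trans wilfEquiv_12_354_12_534,
     wilfEquiv_12_354_12_534.symm,
     (wilfEquiv_12_435_12_453.trans wilfEquiv_12_453_12_354).symm.trans wilfEquiv_12_435_21_435,
     wilfEquiv_21_435_21_453,
     wilfEquiv_21_453_21_354.trans wilfEquiv_21_354_21_534,
     wilfEquiv_21_354_21_534.symm⟩,
    wilfEquiv_123_4_5_321_4_5,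
    ⟨wilfEquiv_213_4_5_231_4_5,
     wilfEquiv_231_4_5_132_4_5,
     wilfEquiv_132_4_5_312_4_5⟩,
    ⟨wilfEquiv_12_3_4_5_12_5_4_3,
     wilfEquiv_12_3_4_5_12_5_4_3.symm.trans wilfEquiv_12_3_4_5_12_3_5_4,
     wilfEquiv_12_3_4_5_12_3_5_4.symm.trans wilfEquiv_12_3_4_5_21_3_4_5,
     wilfEquiv_21_3_4_5_21_5_4_3,
     wilfEquiv_21_3_4_5_21_5_4_3.symm.trans wilfEquiv_21_3_4_5_21_3_5_4⟩,
    wilfEquiv_12_4_3_5_21_4_3_5,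
    ⟨wilfEquiv_12_5_3_4_12_4_5_3,
     wilfEquiv_12_5_3_4_12_4_5_3.symm.trans wilfEquiv_12_5_3_4_21_5_3_4,
     wilfEquiv_12_5_3_4_21_5_3_4.symm.trans
        (wilfEquiv_12_5_3_4_12_4_5_3.trans wilfEquiv_12_4_5_3_21_4_5_3)⟩⟩
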